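/- Let $\mathbb F$ be a field of characteristic $0$ and $A$ a differential algebra over $\mathbb F$ (a commutative unital algebra with a derivation $\partial$). For $a(\partial)=\sum_n a_n\partial^n\in A[\partial]$ write $a^*(\lambda)=\sum_n(-\lambda-\partial)^n(a_n)\in A[\lambda]$; the notation $(|_{x=\partial}\,y)$ means that the indeterminate $x$ is replaced by $\partial$ acting on $y$ only. A Lie conformal algebroid (LCAd) over $A$ is a left $A[\partial]$-module $E$ with an $\mathbb F$-bilinear $\lambda$-bracket $[\cdot_\lambda\cdot]:E\times E\to E[\lambda]$ making it a Lie conformal algebra, and a left $A[\partial]$-module homomorphism $\theta$ from $E$ to the conformal derivations of $A$, such that $[u_\lambda a(\partial)v]=a(\lambda+x)(|_{x=\partial}[u_\lambda v])+\theta(u)_\lambda(a(x))(|_{x=\partial}v)$ and $\theta([u_\lambda v])_\mu(a)=\theta(u)_\lambda(\theta(v)_{\mu-\lambda}(a))-\theta(v)_{\mu-\lambda}(\theta(u)_\lambda(a))$. An $E$-module is a left $A[\partial]$-module $M$ with an $\mathbb F$-bilinear $\lambda$-action $E\times M\to M[\lambda]$ such that $u_\lambda(a(\partial)m)=a(\lambda+x)(|_{x=\partial}u_\lambda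 m)+\theta(u)_\lambda(a(x))(|_{x=\partial}m)$, $(a(\partial)u)_\lambda m=(|_{x=\partial}a^*(\lambda))(u_{\lambda+x}m)$ and $[u_\lambda v]_\mu m=u_\lambda(v_{\mu-\lambda}m)-v_{\mu-\lambda}(u_\lambda m)$. For $k\ge0$ let $\widetilde C^k(E,M)$ be the space of linear maps $\varphi_{\lambda_1,\dots,\lambda_k}:E^{\otimes k}\to M[\lambda_1,\dots,\lambda_k]$ such that $$\varphi_{\lambda_1,\dots,\lambda_k}(a_1(\partial)u_1,\dots,a_k(\partial)u_k)=(|_{x_1=\partial}a_1^*(\lambda_1))\cdots(|_{x_k=\partial}a_k^*(\lambda_k))\,\varphi_{\lambda_1+x_1,\dots,\lambda_k+x_k}(u_1,\dots,u_k)$$ and $\varphi_{\lambda_1,\dots,\lambda_k}(u_1,\dots,u_k)=\mathrm{sign}(\pi)\,\varphi_{\lambda_{\pi(1)},\dots,\lambda_{\pi(k)}}(u_{\pi(1)},\dots,u_{\pi(k)})$ for all $\pi\in S_k$. Let $C^k(E,M)$ be defined in the same way with values in $M[\lambda_1,\dots,\lambda_k]/\langle\partial+\lambda_1+\dots+\lambda_k\rangle$.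 On both define $$(d\varphi)_{\lambda_1,\dots,\lambda_{k+1}}(u_1,\dots,u_{k+1})=\sum_{i}(-1)^{i+1}{u_i}_{\lambda_i}\big(\varphi_{\lambda_1,\overset{i}{\check\dots},\lambda_{k+1}}(u_1,\overset{i}{\check\dots},u_{k+1})\big)+\sum_{i<j}(-1)^{i+j}\varphi_{\lambda_i+\lambda_j,\lambda_1,\overset{i}{\check\dots}\overset{j}{\check\dots},\lambda_{k+1}}\big([{u_i}_{\lambda_i}u_j],u_1,\overset{i}{\check\dots}\overset{j}{\check\dots},u_{k+1}\big),$$ denoted $\widetilde d$ on $\widetilde C^\bullet$. Let $\partial$ act on $\widetilde C^k$ by $(\partial\varphi)(u_1,\dots,u_k)=(\lambda_1+\dots+\lambda_k+\partial)\varphi(u_1,\dots,u_k)$, and let $p_*:\widetilde C^k\to C^k$ be composition with the quotient map. Let $\widetilde H^k(E,M)$ (basic cohomology) and $H^k(E,M)$ (LCAd cohomology) be $\ker/\mathrm{im}$ of the differential in degree $k$ on $\widetilde C^\bullet$ and $C^\bullet$; for $k=0$ the image is $0$. Let $E$ be an LCAd over $A$ that is free as a left $A[\partial]$-module, and $M$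 an $E$-module. Then: 1. $\widetilde C^\bullet(E,M)$, $\partial\widetilde C^\bullet(E,M)$ (with differential $\widetilde d$) and $C^\bullet(E,M)$ are complexes (the differentials are well defined and square to zero), and $0\to\partial\widetilde C^\bullet\to\widetilde C^\bullet\xrightarrow{p_*}C^\bullet\to0$ is a short exact sequence of complexes. 2. The map $\partial:\widetilde C^\bullet\to\partial\widetilde C^\bullet$ induces isomorphisms $\widetilde H^k(E,M)\simeq H^k(\partial\widetilde C^\bullet,\widetilde d)$ for $k\ge1$. 3. There is a long exact sequence $$\widetilde H^0(E,M)\xrightarrow{\partial}\widetilde H^0(E,M)\xrightarrow{p_*}H^0(E,M)\xrightarrow{\delta}\widetilde H^1(E,M)\to\cdots\to\widetilde H^k(E,M)\xrightarrow{\partial}\widetilde H^k(E,M)\xrightarrow{p_*}H^k(E,M)\xrightarrow{\delta}\widetilde H^{k+1}(E,M)\to\cdots,$$ exact at every term except the first, where $\partial$ and $p_*$ are the induced maps and $\delta$ is the linear map with $\delta[p_*\varphi]=[\psi]$ whenever $\varphi\in\widetilde C^k$, $dp_*\varphi=0$, $\psi\in\widetilde C^{k+1}$, $\widetilde d\psi=0$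 and $\widetilde d\varphi=\partial\psi$. 4. If $\widetilde H^k(E,M)=0$ for all $k\ge d$, then $H^k(E,M)=0$ for all $k\ge d$. -/

import Mathlib

open scoped TensorProduct

noncomputable section

namespace LCAd

universe uF uA uE uM

/-! ### Polynomials with coefficients in a module -/

/-- `M[λ_s : s ∈ σ]`, realised as `F[λ_s : s ∈ σ] ⊗ M`. -/
abbrev LPoly (F : Type*) [Field F] (σ : Type*) (M : Type*) [AddCommGroup M] [Module F M] :=
  MvPolynomial σ F ⊗[F] M

section Poly

variable {F : Type*} [Field F] {σ τ : Type*}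
variable {M N : Type*} [AddCommGroup M] [Module F M] [AddCommGroup N] [Module F N]

/-- The element `m`, as a constant polynomial in `M[λ_s]`. -/
def const (σ : Type*) : M →ₗ[F] LPoly F σ M := TensorProduct.mk F (MvPolynomial σ F) M 1

/-- Substitution of the variables: `f(λ) ↦ f(g(λ))` for a homomorphism `g` of polynomial rings. -/
def subst (g : MvPolynomial σ F →ₐ[F] MvPolynomial τ F) : LPoly F σ M →ₗ[F] LPoly F τ M :=
  LinearMap.rTensor M g.toLinearMap

/-- For `f ∈ M[λ]` (one variable), the element `f(ℓ) ∈ M[λ_s : s ∈ σ]`. -/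
def evalAt (ℓ : MvPolynomial σ F) : LPoly F Unit M →ₗ[F] LPoly F σ M :=
  subst (MvPolynomial.aeval fun _ => ℓ)

/-- For a linear map `φ_λ : M → N[λ]` and a polynomial `ℓ`, the map `φ_ℓ`, extended
`F[λ_s : s ∈ σ]`-linearly to a map `M[λ_s] → N[λ_s]`. -/
def actAt (φ : M →ₗ[F] LPoly F Unit N) (ℓ : MvPolynomial σ F) :
    LPoly F σ M →ₗ[MvPolynomial σ F] LPoly F σ N :=
  (evalAt ℓ ∘ₗ φ).liftBaseChange (MvPolynomial σ F)

theorem actAt_smul (c : F) (φ : M →ₗ[F] LPoly F Unit N) (ℓ : MvPolynomial σ F) :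
    actAt (c • φ) ℓ = c • actAt φ ℓ := by
  ext m
  simp [actAt]

/-- The operator `D`, acting on the coefficients of polynomials. -/
def coeffD (σ : Type*) (D : M →ₗ[F] M) : Module.End (MvPolynomial σ F) (LPoly F σ M) :=
  D.baseChange (MvPolynomial σ F)

theorem aeval_smul_field (T : Module.End (MvPolynomial σ F) (LPoly F σ M)) (c : F)
    (q : Polynomial (MvPolynomial σ F)) :
    Polynomial.aeval T (c • q) = c • Polynomial.aeval T q :=
  ((Polynomial.aeval T).toLinearMap.restrictScalars F).map_smul c q

/-- `(|_{x = ∂} f(g(λ, x)))`: in each term `p(λ) m` of `f` substitute the variables of `p` by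
polynomials `g` in the variables `λ` and `x`, and then let `x` act as `D` on the coefficient `m`. -/
def substD (D : M →ₗ[F] M) (g : MvPolynomial σ F →ₐ[F] Polynomial (MvPolynomial τ F)) :
    LPoly F σ M →ₗ[F] LPoly F τ M :=
  TensorProduct.lift (LinearMap.mk₂ F
    (fun (p : MvPolynomial σ F) (m : M) => Polynomial.aeval (coeffD τ D) (g p) (const τ m))
    (by intros; simp) (by intros; simp [aeval_smul_field]) (by intros; simp) (by intros; simp))

/-- The operator `∂ + ∑_s λ_s` on `M[λ_s : s ∈ σ]`. -/
def total (σ : Type*) [Fintype σ] (D : M →ₗ[F] M) :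
    Module.End (MvPolynomial σ F) (LPoly F σ M) :=
  coeffD σ D + (∑ s, MvPolynomial.X s : MvPolynomial σ F) • 1

/-- The substitution `λ_i ↦ λ_i + x`, which keeps the other variables. -/
def shift [DecidableEq σ] (i : σ) :
    MvPolynomial σ F →ₐ[F] Polynomial (MvPolynomial σ F) :=
  MvPolynomial.aeval fun j =>
    Polynomial.C (MvPolynomial.X j) + if j = i then Polynomial.X else 0

end Poly

/-! ### Differential algebras and modules over differential operators -/

section Diff

variable {F : Type uF} [Field F] {A : Type uA} [CommRing A] [Algebra F A]

/-- A left `A[∂]`-module structure on an `A`-module `M`, where `A` is a differential algebra with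
derivation `δ`: the action `D` of `∂`, with `∂ ∘ a = a ∘ ∂ + δ(a)`. -/
structure DiffModule (δ : Derivation F A A) (M : Type*) [AddCommGroup M] [Module F M]
    [Module A M] where
  /-- the action of `∂` -/
  D : M →ₗ[F] M
  D_smul : ∀ (a : A) (m : M), D (a • m) = δ a • m + a • D m

variable {M : Type*} [AddCommGroup M] [Module F M] [Module A M] [IsScalarTower F A M]
variable {δ : Derivation F A A}

/-- The action of a differential operator `a(∂) = ∑ a_n ∂ ^ n ∈ A[∂]`, given by its symbol
`a = ∑ a_n x ^ n`. -/
def DiffModule.op (X : DiffModule δ M) (a : Polynomial A) (m : M) : M :=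
  a.sum fun n c => c • (X.D ^ n) m

/-- `M` is free as a left `A[∂]`-module: there is a family `e` such that every element of `M` is,
in a unique way, a finite sum `∑ a_i(∂) e_i` with `a_i(∂) ∈ A[∂]`. -/
def DiffModule.IsFree {M : Type uM} [AddCommGroup M] [Module F M] [Module A M]
    (X : DiffModule δ M) : Prop :=
  ∃ (ι : Type uM) (e : ι → M),
    Function.Bijective fun c : ι →₀ Polynomial A => c.sum fun i a => X.op a (e i)

variable {σ : Type*}

/-- Multiplication by `a ∈ A` of the coefficients of an element of `M[λ_s]`. -/
def coeffMul (a : A) : LPoly F σ M →ₗ[F] LPoly F σ M :=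
  LinearMap.lTensor _ (Algebra.lsmul F F M a)

/-- The product `b(λ) m ∈ M[λ_s]` of `b(λ) ∈ A[λ_s]` and `m ∈ M`. -/
def mulVec (m : M) : LPoly F σ A →ₗ[F] LPoly F σ M :=
  LinearMap.lTensor _ ((LinearMap.toSpanSingleton A M m).restrictScalars F)

/-- `a(λ_i + ∂) f`, that is `a(λ_i + x)(|_{x = ∂} f) = ∑ a_n (λ_i + ∂) ^ n f`,
for `a(∂) ∈ A[∂]` and `f ∈ M[λ_s]`. -/
def opShift (D : M →ₗ[F] M) (i : σ) (a : Polynomial A) (f : LPoly F σ M) : LPoly F σ M :=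
  a.sum fun n c => coeffMul c
    (((coeffD σ D + (MvPolynomial.X i : MvPolynomial σ F) • 1) ^ n :
      Module.End (MvPolynomial σ F) (LPoly F σ M)) f)

/-- `φ_λ(a(x))(|_{x = ∂} m) = ∑ φ_λ(a_n) ∂ ^ n m` for `φ_λ : A → A[λ]` and `a(∂) ∈ A[∂]`. -/
def opVec (D : M →ₗ[F] M) (φ : A →ₗ[F] LPoly F Unit A) (a : Polynomial A) (m : M) :
    LPoly F Unit M :=
  a.sum fun n c => mulVec ((D ^ n) m) (φ c)

/-- `a^*(λ_i) = ∑ (-λ_i - ∂) ^ n a_n`, the symbol of the adjoint `∑ (-∂) ^ n ∘ a_n` of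
`a(∂) ∈ A[∂]`. -/
def adjSymbol (δ : Derivation F A A) (i : σ) (a : Polynomial A) : LPoly F σ A :=
  a.sum fun n c =>
    ((-coeffD σ (δ : A →ₗ[F] A) - (MvPolynomial.X i : MvPolynomial σ F) • 1) ^ n :
      Module.End (MvPolynomial σ F) (LPoly F σ A))
      (const σ c)

/-- `(|_{x = ∂} b(λ)) f_{λ_i + x}`: replace `λ_i` by `λ_i + x` in `f ∈ M[λ_s]`, let `x` act as `∂`
on the coefficients of `b ∈ A[λ_s]`, and multiply. -/
def shiftMul [DecidableEq σ] (δ : Derivation F A A) (i : σ) (b : LPoly F σ A) :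
    LPoly F σ M →ₗ[F] LPoly F σ M :=
  TensorProduct.lift (LinearMap.mk₂ F
    (fun (p : MvPolynomial σ F) (m : M) =>
      mulVec m (Polynomial.aeval (coeffD σ (δ : A →ₗ[F] A)) (shift i p) b))
    (by intros; simp) (by intros; simp [aeval_smul_field])
    (by
      intro p m m'
      simp [mulVec, LinearMap.toSpanSingleton_add, LinearMap.restrictScalars_add,
        LinearMap.lTensor_add])
    (by
      intro c p m
      have h : ((LinearMap.toSpanSingleton A M (c • m)).restrictScalars F) =
          c • (LinearMap.toSpanSingleton A M m).restrictScalars F := by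
        ext a
        exact smul_algebra_smul_comm c a m
      simp [mulVec, h, LinearMap.lTensor_smul]))

/-- `(|_{x = ∂} a^*(λ_i)) f_{λ_i + x}` for `a(∂) ∈ A[∂]` and `f ∈ M[λ_s]`. -/
def adjMul [DecidableEq σ] (δ : Derivation F A A) (i : σ) (a : Polynomial A) :
    LPoly F σ M →ₗ[F] LPoly F σ M :=
  shiftMul δ i (adjSymbol δ i a)

end Diff

/-! ### Lie conformal algebroids and their modules -/

section Algebroid

variable {F : Type uF} [Field F] {A : Type uA} [CommRing A] [Algebra F A]

/-- The variable `λ` of `M[λ]`. -/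
abbrev lam (F : Type*) [Field F] : MvPolynomial Unit F := MvPolynomial.X ()

/-- The variable `λ` of `M[λ, μ]`. -/
abbrev lam2 (F : Type*) [Field F] : MvPolynomial (Fin 2) F := MvPolynomial.X 0

/-- The variable `μ` of `M[λ, μ]`. -/
abbrev mu2 (F : Type*) [Field F] : MvPolynomial (Fin 2) F := MvPolynomial.X 1

/-- `φ_λ : A → A[λ]` is a conformal derivation of the differential algebra `(A, δ)`:
`φ_λ(a(∂) b) = (|_{x = ∂} b) φ_λ(a(x)) + a(λ + x)(|_{x = ∂} φ_λ(b))`. -/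
def IsConformalDerivation (δ : Derivation F A A) (φ : A →ₗ[F] LPoly F Unit A) : Prop :=
  ∀ (a : Polynomial A) (b : A),
    φ (a.sum fun n c => c * ((δ : A →ₗ[F] A) ^ n) b) =
      opVec (δ : A →ₗ[F] A) φ a b + opShift (δ : A →ₗ[F] A) () a (φ b)

/-- A Lie conformal algebra over `F`: the `F[∂]`-module `(E, D)` with the `λ`-bracket
`[u_λ v] = bracket u v`. -/
structure IsLieConformalAlgebra {E : Type*} [AddCommGroup E] [Module F E] (D : E →ₗ[F] E)
    (bracket : E →ₗ[F] E →ₗ[F] LPoly F Unit E) : Prop where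
  sesq_left : ∀ u v, bracket (D u) v = -(lam F • bracket u v)
  sesq_right : ∀ u v, bracket u (D v) = coeffD Unit D (bracket u v) + lam F • bracket u v
  /-- `[v_λ u] = - (|_{x = ∂} [u_{-λ-x} v])` -/
  skew : ∀ u v, bracket v u =
    -substD D (MvPolynomial.aeval fun _ => -Polynomial.C (lam F) - Polynomial.X) (bracket u v)
  /-- `[u_λ [v_μ w]] - [v_μ [u_λ w]] = [[u_λ v]_{λ+μ} w]` -/
  jacobi : ∀ u v w,
    actAt (bracket u) (lam2 F) (evalAt (mu2 F) (bracket v w)) -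
        actAt (bracket v) (mu2 F) (evalAt (lam2 F) (bracket u w)) =
      actAt (bracket.flip w) (lam2 F + mu2 F) (evalAt (lam2 F) (bracket u v))

/-- A Lie conformal algebroid structure on `E` over the differential algebra `(A, δ)`. -/
structure LieConformalAlgebroid (δ : Derivation F A A) (E : Type uE) [AddCommGroup E]
    [Module F E] [Module A E] [IsScalarTower F A E] extends DiffModule δ E where
  /-- the `λ`-bracket `[u_λ v]` -/
  bracket : E →ₗ[F] E →ₗ[F] LPoly F Unit E
  isLieConformalAlgebra : IsLieConformalAlgebra D bracket
  /-- the anchor map `u ↦ θ(u)_λ` -/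
  anchor : E →ₗ[F] A →ₗ[F] LPoly F Unit A
  anchor_derivation : ∀ u, IsConformalDerivation δ (anchor u)
  /-- `θ` is a homomorphism of left `A[∂]`-modules -/
  anchor_op : ∀ (a : Polynomial A) (u : E) (b : A),
    anchor (toDiffModule.op a u) b = adjMul δ () a (anchor u b)
  /-- `[u_λ a(∂) v] = a(λ + x)(|_{x = ∂} [u_λ v]) + θ(u)_λ(a(x))(|_{x = ∂} v)` -/
  bracket_op : ∀ (u : E) (a : Polynomial A) (v : E),
    bracket u (toDiffModule.op a v) =
      opShift D () a (bracket u v) + opVec D (anchor u) a v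
  /-- `θ([u_λ v])_μ(a) = θ(u)_λ(θ(v)_{μ-λ}(a)) - θ(v)_{μ-λ}(θ(u)_λ(a))` -/
  anchor_bracket : ∀ (u v : E) (a : A),
    actAt (anchor.flip a) (mu2 F) (evalAt (lam2 F) (bracket u v)) =
      actAt (anchor u) (lam2 F) (evalAt (mu2 F - lam2 F) (anchor v a)) -
        actAt (anchor v) (mu2 F - lam2 F) (evalAt (lam2 F) (anchor u a))

variable {δ : Derivation F A A}
variable {E : Type uE} [AddCommGroup E] [Module F E] [Module A E] [IsScalarTower F A E]

/-- A module structure on `M` over the Lie conformal algebroid `L`. -/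
structure LieConformalAlgebroid.Rep (L : LieConformalAlgebroid δ E) (M : Type uM)
    [AddCommGroup M] [Module F M] [Module A M] [IsScalarTower F A M] extends DiffModule δ M where
  /-- the `λ`-action `u_λ m` -/
  act : E →ₗ[F] M →ₗ[F] LPoly F Unit M
  /-- `u_λ (a(∂) m) = a(λ + x)(|_{x = ∂} u_λ m) + θ(u)_λ(a(x))(|_{x = ∂} m)` -/
  act_op : ∀ (u : E) (a : Polynomial A) (m : M),
    act u (toDiffModule.op a m) = opShift D () a (act u m) + opVec D (L.anchor u) a m
  /-- `(a(∂) u)_λ m = (|_{x = ∂} a^*(λ)) (u_{λ+x} m)` -/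
  op_act : ∀ (a : Polynomial A) (u : E) (m : M),
    act (L.op a u) m = adjMul δ () a (act u m)
  /-- `[u_λ v]_μ m = u_λ (v_{μ-λ} m) - v_{μ-λ} (u_λ m)` -/
  bracket_act : ∀ (u v : E) (m : M),
    actAt (act.flip m) (mu2 F) (evalAt (lam2 F) (L.bracket u v)) =
      actAt (act u) (lam2 F) (evalAt (mu2 F - lam2 F) (act v m)) -
        actAt (act v) (mu2 F - lam2 F) (evalAt (lam2 F) (act u m))

end Algebroid

/-! ### Reduction modulo `⟨∂ + λ_1 + ... + λ_k⟩` -/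

section Reduction

variable {F : Type uF} [Field F] {M : Type uM} [AddCommGroup M] [Module F M]

/-- `M[λ_1, ..., λ_k] / ⟨∂ + λ_1 + ... + λ_k⟩`. -/
abbrev QPoly (k : ℕ) (D : M →ₗ[F] M) :=
  LPoly F (Fin k) M ⧸ LinearMap.range (total (Fin k) D)

/-- The quotient map `p : M[λ_1, ..., λ_k] → M[λ_1, ..., λ_k] / ⟨∂ + λ_1 + ... + λ_k⟩`. -/
def proj (k : ℕ) (D : M →ₗ[F] M) : LPoly F (Fin k) M →ₗ[F] QPoly k D :=
  (Submodule.mkQ (LinearMap.range (total (Fin k) D))).restrictScalars F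

theorem proj_surjective (k : ℕ) (D : M →ₗ[F] M) : Function.Surjective (proj k D) :=
  fun y => by
    obtain ⟨x, rfl⟩ := Submodule.Quotient.mk_surjective _ y
    exact ⟨x, rfl⟩

/-- An `F`-linear map between modules over two `F`-algebras, induced on quotients by submodules. -/
def quotMap {R R' V W : Type*} [CommRing R] [CommRing R'] [Algebra F R] [Algebra F R']
    [AddCommGroup V] [Module F V] [Module R V] [IsScalarTower F R V]
    [AddCommGroup W] [Module F W] [Module R' W] [IsScalarTower F R' W]
    (P : Submodule R V) (Q : Submodule R' W) (f : V →ₗ[F] W) (h : ∀ x ∈ P, f x ∈ Q) :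
    (V ⧸ P) →ₗ[F] (W ⧸ Q) :=
  (Submodule.Quotient.restrictScalarsEquiv F Q).toLinearMap ∘ₗ
    Submodule.mapQ (P.restrictScalars F) (Q.restrictScalars F) f h ∘ₗ
    (Submodule.Quotient.restrictScalarsEquiv F P).symm.toLinearMap

/-- The map induced on the quotients by a map commuting with the operators `∂ + ∑ λ_i`. -/
def descend {k l : ℕ} {D : M →ₗ[F] M} (f : LPoly F (Fin k) M →ₗ[F] LPoly F (Fin l) M)
    (h : ∀ x, f (total (Fin k) D x) = total (Fin l) D (f x)) : QPoly k D →ₗ[F] QPoly l D :=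
  quotMap _ _ f (by rintro _ ⟨x, rfl⟩; exact ⟨f x, (h x).symm⟩)

@[simp]
theorem descend_proj {k l : ℕ} {D : M →ₗ[F] M}
    (f : LPoly F (Fin k) M →ₗ[F] LPoly F (Fin l) M)
    (h : ∀ x, f (total (Fin k) D x) = total (Fin l) D (f x)) (x : LPoly F (Fin k) M) :
    descend f h (proj k D x) = proj l D (f x) := rfl

end Reduction

/-! ### Operations entering the cochain complexes -/

section Operations

variable {F : Type uF} [Field F] {M : Type uM} [AddCommGroup M] [Module F M]

theorem total_tmul {σ : Type*} [Fintype σ] (D : M →ₗ[F] M) (p : MvPolynomial σ F) (m : M) :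
    total σ D (p ⊗ₜ[F] m) = p ⊗ₜ[F] D m + ((∑ s, MvPolynomial.X s) * p) ⊗ₜ[F] m := by
  simp [total, coeffD, TensorProduct.smul_tmul']

theorem subst_total {σ τ : Type*} [Fintype σ] [Fintype τ] (D : M →ₗ[F] M)
    (g : MvPolynomial σ F →ₐ[F] MvPolynomial τ F)
    (hg : g (∑ s, MvPolynomial.X s) = ∑ s, MvPolynomial.X s) (x : LPoly F σ M) :
    subst g (total σ D x) = total τ D (subst g x) := by
  induction x using TensorProduct.induction_on with
  | zero => simp
  | add x y hx hy => simp only [map_add, hx, hy]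
  | tmul p m =>
    rw [total_tmul]
    simp only [subst, map_add, LinearMap.rTensor_tmul, AlgHom.toLinearMap_apply, map_mul, hg,
      total_tmul]

/-- The simultaneous permutation `λ_i ↦ λ_{π(i)}` of the variables. -/
def perm {k : ℕ} (π : Equiv.Perm (Fin k)) : LPoly F (Fin k) M →ₗ[F] LPoly F (Fin k) M :=
  subst (MvPolynomial.rename π)

theorem perm_total {k : ℕ} (D : M →ₗ[F] M) (π : Equiv.Perm (Fin k)) (x : LPoly F (Fin k) M) :
    perm π (total (Fin k) D x) = total (Fin k) D (perm π x) :=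
  subst_total D _ (by simpa using Equiv.sum_comp π (fun s => MvPolynomial.X (R := F) s)) x

/-- For `i < j`, the substitution
`f(λ_1, ..., λ_k) ↦ f(λ_i + λ_j, λ_1, ..., λ_{k+1})`, with `λ_i` and `λ_j` omitted in the dots.
Here `i` stands for the element `i` of `Fin (n + 1)` seen in `Fin (n + 2)`. -/
def merge {n : ℕ} (i : Fin (n + 1)) (j : Fin (n + 2)) :
    LPoly F (Fin (n + 1)) M →ₗ[F] LPoly F (Fin (n + 2)) M :=
  subst (MvPolynomial.aeval (Fin.cons (MvPolynomial.X i.castSucc + MvPolynomial.X j)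
    fun r => MvPolynomial.X (j.succAbove (i.succAbove r))))

theorem merge_total {n : ℕ} (D : M →ₗ[F] M) (i : Fin (n + 1)) (j : Fin (n + 2))
    (hij : i.castSucc < j) (x : LPoly F (Fin (n + 1)) M) :
    merge i j (total (Fin (n + 1)) D x) = total (Fin (n + 2)) D (merge i j x) := by
  refine subst_total D _ ?_ x
  rw [Fin.sum_univ_succAbove _ j, Fin.sum_univ_succAbove (fun s => MvPolynomial.X (j.succAbove s)) i,
    Fin.sum_univ_succ, Fin.succAbove_of_castSucc_lt _ _ hij]
  simp only [map_add, map_sum, MvPolynomial.aeval_X, Fin.cons_zero, Fin.cons_succ]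
  ring

variable {A : Type uA} [CommRing A] [Algebra F A] {δ : Derivation F A A}
variable [Module A M] [IsScalarTower F A M]

theorem coeffD_mulVec {σ : Type*} (X : DiffModule δ M) (m : M) (y : LPoly F σ A) :
    coeffD σ X.D (mulVec m y) =
      mulVec (X.D m) y + mulVec m (coeffD σ (δ : A →ₗ[F] A) y) := by
  induction y using TensorProduct.induction_on with
  | zero => simp
  | add x y hx hy => simp only [map_add, hx, hy]; abel
  | tmul p a =>
    simp [mulVec, coeffD, X.D_smul, TensorProduct.tmul_add, add_comm]

theorem mulVec_smul {σ : Type*} (m : M) (q : MvPolynomial σ F) (y : LPoly F σ A) :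
    mulVec m (q • y) = q • mulVec m y := by
  induction y using TensorProduct.induction_on with
  | zero => simp
  | add x y hx hy => simp only [smul_add, map_add, hx, hy]
  | tmul p a => simp [mulVec, TensorProduct.smul_tmul']

theorem shiftMul_tmul {σ : Type*} [DecidableEq σ] (i : σ) (b : LPoly F σ A)
    (p : MvPolynomial σ F) (m : M) : shiftMul δ i b (p ⊗ₜ[F] m) =
      mulVec m (Polynomial.aeval (coeffD σ (δ : A →ₗ[F] A)) (shift i p) b) := rfl

theorem adjMul_total {k : ℕ} (X : DiffModule δ M) (i : Fin k) (a : Polynomial A)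
    (x : LPoly F (Fin k) M) :
    adjMul δ i a (total (Fin k) X.D x) = total (Fin k) X.D (adjMul δ i a x) := by
  have hs : shift i (∑ s, MvPolynomial.X s : MvPolynomial (Fin k) F) =
      Polynomial.C (∑ s, MvPolynomial.X s) + Polynomial.X := by
    simp [shift, Finset.sum_add_distrib]
  induction x using TensorProduct.induction_on with
  | zero => simp
  | add x y hx hy => simp only [map_add, hx, hy]
  | tmul p m =>
    rw [total_tmul]
    simp only [adjMul, map_add, shiftMul_tmul, map_mul,
      hs, Module.End.mul_apply, LinearMap.add_apply, Polynomial.aeval_C, Polynomial.aeval_X,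
      Module.algebraMap_end_apply, total, LinearMap.smul_apply, Module.End.one_apply,
      coeffD_mulVec, mulVec_smul]
    abel

variable {E : Type uE} [AddCommGroup E] [Module F E] [Module A E] [IsScalarTower F A E]
variable {L : LieConformalAlgebroid δ E}

/-- `f ↦ u_{λ_i} f(λ_1, ..., λ_{k+1})`, with `λ_i` omitted from the arguments of `f`. -/
def LieConformalAlgebroid.Rep.actIns (R : L.Rep M) {k : ℕ} (i : Fin (k + 1)) :
    E →ₗ[F] LPoly F (Fin k) M →ₗ[F] LPoly F (Fin (k + 1)) M :=
  LinearMap.mk₂ F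
    (fun u f => actAt (R.act u) (MvPolynomial.X i) (subst (MvPolynomial.rename i.succAbove) f))
    (by
      intro u v f
      simp [actAt, LinearMap.comp_add])
    (by
      intro c u f
      rw [map_smul, actAt_smul, LinearMap.smul_apply])
    (by intros; simp)
    (by
      intro c u f
      rw [map_smul, LinearMap.map_smul_of_tower])

theorem LieConformalAlgebroid.Rep.actIns_apply (R : L.Rep M) {k : ℕ} (i : Fin (k + 1)) (u : E)
    (f : LPoly F (Fin k) M) : R.actIns i u f =
      actAt (R.act u) (MvPolynomial.X i) (subst (MvPolynomial.rename i.succAbove) f) := rfl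

theorem IsConformalDerivation.map_one {φ : A →ₗ[F] LPoly F Unit A}
    (h : IsConformalDerivation δ φ) : φ 1 = 0 := by
  have h1 := h (Polynomial.C 1) 1
  have hc : ∀ f : LPoly F Unit A, coeffMul (A := A) 1 f = f := fun f => by
    have : Algebra.lsmul F F A (1 : A) = LinearMap.id := by ext; simp
    rw [coeffMul, this, LinearMap.lTensor_id, LinearMap.id_apply]
  have hv : mulVec (F := F) (σ := Unit) (1 : A) (φ 1) = φ 1 := by
    have : ((LinearMap.toSpanSingleton A A (1 : A)).restrictScalars F) = LinearMap.id := by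
      ext; simp
    rw [mulVec, this, LinearMap.lTensor_id, LinearMap.id_apply]
  rw [opVec, opShift, Polynomial.sum_C_index (by simp), Polynomial.sum_C_index (by simp),
    Polynomial.sum_C_index (by simp [coeffMul])] at h1
  simpa [hc, hv] using h1

theorem coeffD_subst {σ τ : Type*} (g : MvPolynomial σ F →ₐ[F] MvPolynomial τ F) (D : M →ₗ[F] M)
    (x : LPoly F σ M) : subst g (coeffD σ D x) = coeffD τ D (subst g x) := by
  induction x using TensorProduct.induction_on with
  | zero => simp
  | add x y hx hy => simp only [map_add, hx, hy]
  | tmul p m => simp [subst, coeffD]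

theorem subst_smul {σ τ : Type*} (g : MvPolynomial σ F →ₐ[F] MvPolynomial τ F)
    (q : MvPolynomial σ F) (x : LPoly F σ M) : subst g (q • x) = g q • subst g x := by
  induction x using TensorProduct.induction_on with
  | zero => simp
  | add x y hx hy => simp only [smul_add, map_add, hx, hy]
  | tmul p m => simp [subst, TensorProduct.smul_tmul']

theorem act_D (R : L.Rep M) (u : E) (m : M) :
    R.act u (R.D m) = coeffD Unit R.D (R.act u m) + lam F • R.act u m := by
  have h := R.act_op u Polynomial.X m
  have hc : ∀ f : LPoly F Unit M, coeffMul (A := A) 1 f = f := by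
    intro f
    have : Algebra.lsmul F F M (1 : A) = LinearMap.id := by ext; simp
    rw [coeffMul, this, LinearMap.lTensor_id, LinearMap.id_apply]
  have hX : R.op (Polynomial.X : Polynomial A) m = R.D m := by
    simp [DiffModule.op, Polynomial.sum_X_index]
  rw [hX, opShift, opVec, Polynomial.sum_X_index (by simp [coeffMul]),
    Polynomial.sum_X_index (by simp)] at h
  simpa [(L.anchor_derivation u).map_one, hc] using h

theorem actAt_coeffD {σ : Type*} (R : L.Rep M) (u : E) (ℓ : MvPolynomial σ F)
    (x : LPoly F σ M) :
    actAt (R.act u) ℓ (coeffD σ R.D x) =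
      coeffD σ R.D (actAt (R.act u) ℓ x) + ℓ • actAt (R.act u) ℓ x := by
  induction x using TensorProduct.induction_on with
  | zero => simp
  | add x y hx hy => simp only [smul_add, map_add, hx, hy]; abel
  | tmul p m =>
    have h : evalAt ℓ (R.act u (R.D m)) =
        coeffD σ R.D (evalAt ℓ (R.act u m)) + ℓ • evalAt ℓ (R.act u m) := by
      rw [act_D, map_add, evalAt, coeffD_subst, subst_smul]
      simp
    simp only [coeffD] at h
    simp [actAt, coeffD, h, smul_smul, mul_comm]

theorem actIns_total (R : L.Rep M) {k : ℕ} (i : Fin (k + 1)) (u : E) (x : LPoly F (Fin k) M) :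
    R.actIns i u (total (Fin k) R.D x) = total (Fin (k + 1)) R.D (R.actIns i u x) := by
  simp only [LieConformalAlgebroid.Rep.actIns_apply, total, LinearMap.add_apply,
    LinearMap.smul_apply, Module.End.one_apply, map_add, coeffD_subst, subst_smul, actAt_coeffD,
    map_smul, Fin.sum_univ_succAbove _ i, add_smul, map_sum, MvPolynomial.rename_X]
  abel

end Operations

/-! ### The differential -/

section Differential

variable {F : Type uF} [Field F] {E : Type uE} [AddCommGroup E] [Module F E]

/-- `F`-multilinear maps `E^k → N`, that is, linear maps `E^{⊗ k} → N`. -/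
abbrev Multi (F : Type*) [Field F] (E : Type*) [AddCommGroup E] [Module F E] (k : ℕ) (N : Type*)
    [AddCommGroup N] [Module F N] :=
  MultilinearMap F (fun _ : Fin k => E) N

variable {N N' : Type*} [AddCommGroup N] [Module F N] [AddCommGroup N'] [Module F N']

/-- The part `∑_i (-1)^i u_i ⬝ φ(..., omit u_i, ...)` of the differential (indices start at `0`),
where `act i u` is the operator `N → N'` by which `u` acts when it stands at place `i`. -/
def diffAct {k : ℕ} (act : Fin (k + 1) → E →ₗ[F] N →ₗ[F] N') :
    Multi F E k N →ₗ[F] Multi F E (k + 1) N' :=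
  ∑ i : Fin (k + 1), (-1 : F) ^ (i : ℕ) •
    { toFun := fun φ => LinearMap.uncurryMid i
        { toFun := fun u => (act i u).compMultilinearMap φ
          map_add' := by intros; ext; simp
          map_smul' := by intros; ext; simp }
      map_add' := by intros; ext; simp [LinearMap.uncurryMid]
      map_smul' := by intros; ext; simp [LinearMap.uncurryMid] }

theorem diffAct_apply {k : ℕ} (act : Fin (k + 1) → E →ₗ[F] N →ₗ[F] N') (φ : Multi F E k N)
    (u : Fin (k + 1) → E) :
    diffAct act φ u =
      ∑ i : Fin (k + 1), (-1 : F) ^ (i : ℕ) • act i (u i) (φ fun r => u (i.succAbove r)) := by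
  simp [diffAct, LinearMap.uncurryMid]
  rfl

variable {n : ℕ} {R : Type*} [CommRing R] [Algebra F R] [Module R N'] [IsScalarTower F R N']

instance : IsScalarTower F R (Multi F E n N') :=
  ⟨fun a r f => by ext u; simp⟩

/-- For `φ : E^{n+1} → N` and a map `g : N → N'`, where `N'` is an `R`-module, the map
`x ↦ g(φ(x, ...))`, extended `R`-linearly to `x ∈ R ⊗ E`. -/
def firstSlot (R : Type*) [CommRing R] [Algebra F R] [Module R N'] [IsScalarTower F R N']
    (g : N →ₗ[F] N') (φ : Multi F E (n + 1) N) : R ⊗[F] E →ₗ[R] Multi F E n N' :=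
  (MultilinearMap.curryLeft (g.compMultilinearMap φ)).liftBaseChange R

@[simp]
theorem firstSlot_tmul (g : N →ₗ[F] N') (φ : Multi F E (n + 1) N) (r : R) (v : E)
    (u : Fin n → E) : firstSlot R g φ (r ⊗ₜ[F] v) u = r • g (φ (Fin.cons v u)) := by
  simp [firstSlot]

theorem firstSlot_add (g : N →ₗ[F] N') (φ ψ : Multi F E (n + 1) N) (x : R ⊗[F] E)
    (u : Fin n → E) : firstSlot R g (φ + ψ) x u = firstSlot R g φ x u + firstSlot R g ψ x u := by
  induction x using TensorProduct.induction_on with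
  | zero => simp
  | add x y hx hy => simp only [map_add, add_apply, hx, hy]; abel
  | tmul r v => simp

theorem firstSlot_smul (g : N →ₗ[F] N') (c : F) (φ : Multi F E (n + 1) N) (x : R ⊗[F] E)
    (u : Fin n → E) : firstSlot R g (c • φ) x u = c • firstSlot R g φ x u := by
  induction x using TensorProduct.induction_on with
  | zero => simp
  | add x y hx hy => simp only [map_add, add_apply, hx, hy, smul_add]
  | tmul r v => simpa using smul_algebra_smul_comm c r (g (φ (Fin.cons v u)))

/-- The part `∑_{i < j} (-1)^{i+j} φ([u_i u_j], ..., omit u_i and u_j, ...)` of the differential.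
Here `[{u_i}_{λ_i} u_j]` is an element of `E[λ_1, ..., λ_{n+2}]`, in which `φ` is extended linearly
over polynomials, and `merge i j` is the substitution of variables for the pair `(i, j)`. -/
def diffBracket [Module (MvPolynomial (Fin (n + 2)) F) N']
    [IsScalarTower F (MvPolynomial (Fin (n + 2)) F) N']
    (bracket : E →ₗ[F] E →ₗ[F] LPoly F Unit E)
    (merge : Fin (n + 1) → Fin (n + 2) → N →ₗ[F] N') :
    Multi F E (n + 1) N →ₗ[F] Multi F E (n + 2) N' :=
  ∑ i : Fin (n + 1), ∑ j : Fin (n + 2) with i.castSucc < j,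
    (-1 : F) ^ ((i : ℕ) + (j : ℕ)) •
    { toFun := fun φ => LinearMap.uncurryMid j
        { toFun := fun v => LinearMap.uncurryMid i
            ((firstSlot (MvPolynomial (Fin (n + 2)) F) (merge i j) φ).restrictScalars F ∘ₗ
              evalAt (MvPolynomial.X i.castSucc) ∘ₗ bracket.flip v)
          map_add' := by intros; ext; simp [LinearMap.uncurryMid]
          map_smul' := by intros; ext; simp [LinearMap.uncurryMid] }
      map_add' := by intros; ext; simp [LinearMap.uncurryMid, firstSlot_add]
      map_smul' := by intros; ext; simp [LinearMap.uncurryMid, firstSlot_smul] }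

theorem diffBracket_apply [Module (MvPolynomial (Fin (n + 2)) F) N']
    [IsScalarTower F (MvPolynomial (Fin (n + 2)) F) N']
    (bracket : E →ₗ[F] E →ₗ[F] LPoly F Unit E)
    (merge : Fin (n + 1) → Fin (n + 2) → N →ₗ[F] N') (φ : Multi F E (n + 1) N)
    (u : Fin (n + 2) → E) :
    diffBracket bracket merge φ u =
      ∑ i : Fin (n + 1), ∑ j : Fin (n + 2) with i.castSucc < j,
        (-1 : F) ^ ((i : ℕ) + (j : ℕ)) •
          firstSlot (MvPolynomial (Fin (n + 2)) F) (merge i j) φ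
            (evalAt (MvPolynomial.X i.castSucc) (bracket (u i.castSucc) (u j)))
            (fun r => u (j.succAbove (i.succAbove r))) := by
  simp only [diffBracket, LinearMap.sum_apply, sum_apply]
  refine Finset.sum_congr rfl fun i _ => Finset.sum_congr rfl fun j hj => ?_
  have hij : j.succAbove i = i.castSucc :=
    Fin.succAbove_of_castSucc_lt _ _ (Finset.mem_filter.1 hj).2
  simp only [LinearMap.smul_apply, smul_apply, LinearMap.coe_mk, AddHom.coe_mk,
    LinearMap.uncurryMid, MultilinearMap.mk'_apply, Fin.removeNth, hij]
  rfl

/-- The differential `φ ↦ dφ` on multilinear maps `E^k → N_k`, for a sequence of target spaces with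
the operators which enter its formula. For `k = 0` the sum with the brackets is empty. -/
def diff {N : ℕ → Type*} [∀ k, AddCommGroup (N k)] [∀ k, Module F (N k)]
    [∀ k, Module (MvPolynomial (Fin k) F) (N k)]
    [∀ k, IsScalarTower F (MvPolynomial (Fin k) F) (N k)]
    (bracket : E →ₗ[F] E →ₗ[F] LPoly F Unit E)
    (act : ∀ k, Fin (k + 1) → E →ₗ[F] N k →ₗ[F] N (k + 1))
    (merge : ∀ n, Fin (n + 1) → Fin (n + 2) → N (n + 1) →ₗ[F] N (n + 2)) :
    ∀ k, Multi F E k (N k) →ₗ[F] Multi F E (k + 1) (N (k + 1))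
  | 0 => diffAct (act 0)
  | n + 1 => diffAct (act (n + 1)) + diffBracket bracket (merge n)

theorem diff_natural {N N' : ℕ → Type*} [∀ k, AddCommGroup (N k)] [∀ k, Module F (N k)]
    [∀ k, Module (MvPolynomial (Fin k) F) (N k)]
    [∀ k, IsScalarTower F (MvPolynomial (Fin k) F) (N k)]
    [∀ k, AddCommGroup (N' k)] [∀ k, Module F (N' k)]
    [∀ k, Module (MvPolynomial (Fin k) F) (N' k)]
    [∀ k, IsScalarTower F (MvPolynomial (Fin k) F) (N' k)]
    (bracket : E →ₗ[F] E →ₗ[F] LPoly F Unit E)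
    (act : ∀ k, Fin (k + 1) → E →ₗ[F] N k →ₗ[F] N (k + 1))
    (merge : ∀ n, Fin (n + 1) → Fin (n + 2) → N (n + 1) →ₗ[F] N (n + 2))
    (act' : ∀ k, Fin (k + 1) → E →ₗ[F] N' k →ₗ[F] N' (k + 1))
    (merge' : ∀ n, Fin (n + 1) → Fin (n + 2) → N' (n + 1) →ₗ[F] N' (n + 2))
    (h : ∀ k, N k →ₗ[F] N' k)
    (hsmul : ∀ k (q : MvPolynomial (Fin k) F) x, h k (q • x) = q • h k x)
    (hact : ∀ k i u x, h (k + 1) (act k i u x) = act' k i u (h k x))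
    (hmerge : ∀ n (i : Fin (n + 1)) (j : Fin (n + 2)), i.castSucc < j → ∀ x,
      h (n + 2) (merge n i j x) = merge' n i j (h (n + 1) x))
    (k : ℕ) (φ : Multi F E k (N k)) :
    diff bracket act' merge' k ((h k).compMultilinearMap φ) =
      (h (k + 1)).compMultilinearMap (diff bracket act merge k φ) := by
  have h1 : ∀ k (φ : Multi F E k (N k)), diffAct (act' k) ((h k).compMultilinearMap φ) =
      (h (k + 1)).compMultilinearMap (diffAct (act k) φ) := by
    intro k φ
    ext u
    simp [diffAct_apply, hact]
  cases k with
  | zero => exact h1 0 φ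
  | succ n =>
    have h2 : ∀ (i : Fin (n + 1)) (j : Fin (n + 2)), i.castSucc < j →
        ∀ (x : LPoly F (Fin (n + 2)) E) (u : Fin n → E),
        firstSlot (MvPolynomial (Fin (n + 2)) F) (merge' n i j)
            ((h (n + 1)).compMultilinearMap φ) x u =
          h (n + 2) (firstSlot (MvPolynomial (Fin (n + 2)) F) (merge n i j) φ x u) := by
      intro i j hij x u
      induction x using TensorProduct.induction_on with
      | zero => simp
      | add x y hx hy => simp only [map_add, add_apply, hx, hy]
      | tmul r v => simp [hmerge n i j hij, hsmul]
    simp only [diff, LinearMap.add_apply, h1]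
    ext u
    simp only [add_apply, LinearMap.compMultilinearMap_apply, map_add, diffBracket_apply, map_sum,
      map_smul]
    congr 1
    refine Finset.sum_congr rfl fun i _ => Finset.sum_congr rfl fun j hj => ?_
    rw [h2 i j (Finset.mem_filter.1 hj).2]

end Differential

/-! ### Cohomology of a sequence of maps on a sequence of subspaces -/

section Cohomology

variable {F : Type*} [Field F] {V : ℕ → Type*} [∀ k, AddCommGroup (V k)] [∀ k, Module F (V k)]

/-- `ker (d |_{C^k})`. -/
def cocycles (d : ∀ k, V k →ₗ[F] V (k + 1)) (C : ∀ k, Submodule F (V k)) (k : ℕ) :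
    Submodule F (V k) :=
  C k ⊓ LinearMap.ker (d k)

/-- `im (d |_{C^{k-1}})`, which is `0` for `k = 0`. -/
def coboundaries (d : ∀ k, V k →ₗ[F] V (k + 1)) (C : ∀ k, Submodule F (V k)) :
    ∀ k, Submodule F (V k)
  | 0 => ⊥
  | k + 1 => (C k).map (d k)

/-- The subspaces `C^k` form a complex with differential `d`. -/
def IsComplex (d : ∀ k, V k →ₗ[F] V (k + 1)) (C : ∀ k, Submodule F (V k)) : Prop :=
  ∀ k, ∀ φ ∈ C k, d k φ ∈ C (k + 1) ∧ d (k + 1) (d k φ) = 0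

/-- The cohomology `ker (d |_{C^k}) / im (d |_{C^{k-1}})` of a complex. -/
abbrev Cohomology (d : ∀ k, V k →ₗ[F] V (k + 1)) (C : ∀ k, Submodule F (V k)) (k : ℕ) :=
  cocycles d C k ⧸ (coboundaries d C k).submoduleOf (cocycles d C k)

/-- The cohomology class of a cocycle. -/
def cls (d : ∀ k, V k →ₗ[F] V (k + 1)) (C : ∀ k, Submodule F (V k)) (k : ℕ) :
    cocycles d C k →ₗ[F] Cohomology d C k :=
  Submodule.mkQ _

variable {W : ℕ → Type*} [∀ k, AddCommGroup (W k)] [∀ k, Module F (W k)]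

/-- The map induced in cohomology by a morphism of complexes. -/
def cohMap {d : ∀ k, V k →ₗ[F] V (k + 1)} {C : ∀ k, Submodule F (V k)}
    {d' : ∀ k, W k →ₗ[F] W (k + 1)} {C' : ∀ k, Submodule F (W k)}
    (f : ∀ k, V k →ₗ[F] W k) (hC : ∀ k, ∀ φ ∈ C k, f k φ ∈ C' k)
    (hd : ∀ k φ, d' k (f k φ) = f (k + 1) (d k φ)) (k : ℕ) :
    Cohomology d C k →ₗ[F] Cohomology d' C' k :=
  Submodule.mapQ _ _
    ((f k).restrict (p := cocycles d C k) (q := cocycles d' C' k) fun φ hφ =>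
      ⟨hC k φ hφ.1, by
        have h : d k φ = 0 := hφ.2
        simp [hd, h]⟩)
    (by
      rintro ⟨φ, hφ⟩ hb
      change φ ∈ coboundaries d C k at hb
      change f k φ ∈ coboundaries d' C' k
      cases k with
      | zero =>
        have h : φ = 0 := hb
        simp [h, coboundaries]
      | succ k =>
        obtain ⟨ψ, hψ, rfl⟩ := hb
        exact ⟨f k ψ, hC k ψ hψ, hd k ψ⟩)

end Cohomology

/-! ### The cochain complexes of a Lie conformal algebroid -/

section Complexes

variable {F : Type uF} [Field F] {A : Type uA} [CommRing A] [Algebra F A]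
variable {δ : Derivation F A A}
variable {E : Type uE} [AddCommGroup E] [Module F E] [Module A E] [IsScalarTower F A E]
variable {L : LieConformalAlgebroid δ E}
variable {M : Type uM} [AddCommGroup M] [Module F M] [Module A M] [IsScalarTower F A M]

/-- The multilinear maps `φ : E^k → N` which satisfy, in each argument,
`φ(..., a(∂) u_i, ...) = (|_{x = ∂} a^*(λ_i)) φ_{..., λ_i + x, ...}(..., u_i, ...)`, and
`φ_{λ_1, ..., λ_k}(u_1, ..., u_k) =
  sign(π) φ_{λ_{π(1)}, ..., λ_{π(k)}}(u_{π(1)}, ..., u_{π(k)})` for all permutations `π`.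
The operators on the right sides are given on the target `N` by `adj` and `prm`. -/
def cochains (X : DiffModule δ E) {N : Type*} [AddCommGroup N] [Module F N] {k : ℕ}
    (adj : Fin k → Polynomial A → N →ₗ[F] N) (prm : Equiv.Perm (Fin k) → N →ₗ[F] N) :
    Submodule F (Multi F E k N) where
  carrier := {φ |
    (∀ (u : Fin k → E) (i : Fin k) (a : Polynomial A),
      φ (Function.update u i (X.op a (u i))) = adj i a (φ u)) ∧
    ∀ (π : Equiv.Perm (Fin k)) (u : Fin k → E),
      φ u = (Equiv.Perm.sign π : ℤ) • prm π (φ (u ∘ π))}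
  add_mem' := by
    rintro φ ψ ⟨h1, h2⟩ ⟨h3, h4⟩
    refine ⟨fun u i a => ?_, fun π u => ?_⟩
    · simp [h1, h3]
    · rw [add_apply, h2 π u, h4 π u]
      simp
  zero_mem' := ⟨fun u i a => by simp, fun π u => by simp⟩
  smul_mem' := by
    rintro c φ ⟨h1, h2⟩
    refine ⟨fun u i a => ?_, fun π u => ?_⟩
    · simp [h1]
    · rw [smul_apply, h2 π u, smul_apply, map_smul, smul_comm]

theorem cochains_natural {E : Type*} [AddCommGroup E] [Module F E] [Module A E]
    (X : DiffModule δ E) {N N' : Type*} [AddCommGroup N] [Module F N]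
    [AddCommGroup N'] [Module F N'] {k : ℕ}
    (adj : Fin k → Polynomial A → N →ₗ[F] N) (prm : Equiv.Perm (Fin k) → N →ₗ[F] N)
    (adj' : Fin k → Polynomial A → N' →ₗ[F] N') (prm' : Equiv.Perm (Fin k) → N' →ₗ[F] N')
    (h : N →ₗ[F] N') (hadj : ∀ i a x, h (adj i a x) = adj' i a (h x))
    (hprm : ∀ π x, h (prm π x) = prm' π (h x)) :
    ∀ φ ∈ cochains X adj prm, h.compMultilinearMap φ ∈ cochains X adj' prm' := by
  rintro φ ⟨h1, h2⟩
  refine ⟨fun u i a => ?_, fun π u => ?_⟩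
  · simp [h1, hadj]
  · rw [LinearMap.compMultilinearMap_apply, h2 π u, map_zsmul, hprm]
    rfl

namespace LieConformalAlgebroid.Rep

variable (R : L.Rep M)

/-- The target space `M[λ_1, ..., λ_k]` of basic `k`-cochains. -/
abbrev BasicTarget (_R : L.Rep M) (k : ℕ) := LPoly F (Fin k) M

/-- The target space `M[λ_1, ..., λ_k] / ⟨∂ + λ_1 + ... + λ_k⟩` of `k`-cochains. -/
abbrev Target (k : ℕ) := QPoly k R.D

/-- The space `C̃^k(E, M)` of basic `k`-cochains. -/
def basicCochains (k : ℕ) : Submodule F (Multi F E k (R.BasicTarget k)) :=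
  cochains L.toDiffModule (fun i a => adjMul δ i a) perm

/-- The differential of basic cochains. -/
def basicDiff : ∀ k, Multi F E k (R.BasicTarget k) →ₗ[F] Multi F E (k + 1) (R.BasicTarget (k + 1)) :=
  diff (N := R.BasicTarget) L.bracket (fun _ i => R.actIns i) (fun _ i j => merge i j)

/-- The operation of `u ∈ E` at place `i` on the target spaces of cochains. -/
def actInsQ {k : ℕ} (i : Fin (k + 1)) : E →ₗ[F] R.Target k →ₗ[F] R.Target (k + 1) :=
  LinearMap.mk₂ F (fun u f => descend (R.actIns i u) (actIns_total R i u) f)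
    (by
      intro u v f
      obtain ⟨f, rfl⟩ := proj_surjective _ _ f
      exact congrArg (proj (k + 1) R.D) (LinearMap.map_add₂ (R.actIns i) u v f))
    (by
      intro c u f
      obtain ⟨f, rfl⟩ := proj_surjective _ _ f
      exact congrArg (proj (k + 1) R.D) (LinearMap.map_smul₂ (R.actIns i) c u f))
    (fun u f g => map_add (descend (R.actIns i u) (actIns_total R i u)) f g)
    (fun c u f => map_smul (descend (R.actIns i u) (actIns_total R i u)) c f)

/-- The substitution `merge i j`, for `i < j`, on the target spaces of cochains. -/
def mergeQ {n : ℕ} (i : Fin (n + 1)) (j : Fin (n + 2)) :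
    R.Target (n + 1) →ₗ[F] R.Target (n + 2) :=
  if hij : i.castSucc < j then descend (merge i j) (merge_total R.D i j hij) else 0

/-- The space `C^k(E, M)` of `k`-cochains. -/
def cochains (k : ℕ) : Submodule F (Multi F E k (R.Target k)) :=
  LCAd.cochains L.toDiffModule
    (fun i a => descend (adjMul δ i a) (adjMul_total R.toDiffModule i a))
    (fun π => descend (perm π) (perm_total R.D π))

/-- The differential of cochains. -/
def diff : ∀ k, Multi F E k (R.Target k) →ₗ[F] Multi F E (k + 1) (R.Target (k + 1)) :=
  LCAd.diff (N := R.Target) L.bracket (fun _ i => R.actInsQ i) (fun _ i j => R.mergeQ i j)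

/-- The action of `∂` on basic cochains: `(∂ φ)(u) = (λ_1 + ... + λ_k + ∂) φ(u)`. -/
def partialMap (k : ℕ) : Multi F E k (R.BasicTarget k) →ₗ[F] Multi F E k (R.BasicTarget k) :=
  ((total (Fin k) R.D).restrictScalars F).compMultilinearMapₗ F

/-- `p_* φ = p ∘ φ`. -/
def pStar (k : ℕ) : Multi F E k (R.BasicTarget k) →ₗ[F] Multi F E k (R.Target k) :=
  (proj k R.D).compMultilinearMapₗ F

theorem partialMap_mem (k : ℕ) : ∀ φ ∈ R.basicCochains k, R.partialMap k φ ∈ R.basicCochains k :=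
  cochains_natural _ _ _ _ _ _ (fun i a x => (adjMul_total R.toDiffModule i a x).symm)
    (fun π x => (perm_total R.D π x).symm)

theorem basicDiff_partialMap (k : ℕ) (φ : Multi F E k (R.BasicTarget k)) :
    R.basicDiff k (R.partialMap k φ) = R.partialMap (k + 1) (R.basicDiff k φ) :=
  diff_natural (N := R.BasicTarget) (N' := R.BasicTarget) _ _ _ _ _
    (fun k => (total (Fin k) R.D).restrictScalars F)
    (fun k q x => (total (Fin k) R.D).map_smul q x)
    (fun _ i u x => (actIns_total R i u x).symm)
    (fun _ i j hij x => (merge_total R.D i j hij x).symm) k φ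

theorem pStar_mem (k : ℕ) : ∀ φ ∈ R.basicCochains k, R.pStar k φ ∈ R.cochains k :=
  cochains_natural _ _ _ _ _ _ (fun _ _ x => (descend_proj _ _ x).symm)
    (fun _ x => (descend_proj _ _ x).symm)

theorem proj_smul (k : ℕ) (q : MvPolynomial (Fin k) F) (x : R.BasicTarget k) :
    proj k R.D (q • x) = q • (proj k R.D x : R.Target k) := rfl

theorem actInsQ_proj (k : ℕ) (i : Fin (k + 1)) (u : E) (x : R.BasicTarget k) :
    R.actInsQ i u (proj k R.D x) = proj (k + 1) R.D (R.actIns i u x) := rfl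

theorem mergeQ_proj (n : ℕ) (i : Fin (n + 1)) (j : Fin (n + 2)) (hij : i.castSucc < j)
    (x : R.BasicTarget (n + 1)) :
    R.mergeQ i j (proj (n + 1) R.D x) = proj (n + 2) R.D (merge i j x) := by
  have h : R.mergeQ i j = descend (merge i j) (merge_total R.D i j hij) := dif_pos hij
  rw [h, descend_proj]

theorem diff_pStar (k : ℕ) (φ : Multi F E k (R.BasicTarget k)) :
    R.diff k (R.pStar k φ) = R.pStar (k + 1) (R.basicDiff k φ) := by
  have h := diff_natural (N := R.BasicTarget) (N' := R.Target) L.bracket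
    (fun _ i => R.actIns i) (fun _ i j => merge i j)
    (fun _ i => R.actInsQ i) (fun _ i j => R.mergeQ i j)
    (fun k => proj k R.D) (fun k q x => R.proj_smul k q x)
    (fun k i u x => (R.actInsQ_proj k i u x).symm)
    (fun n i j hij x => (R.mergeQ_proj n i j hij x).symm) k φ
  exact h

/-- The subcomplex `∂ C̃^•(E, M)` of the basic complex. -/
def partialCochains (k : ℕ) : Submodule F (Multi F E k (R.BasicTarget k)) :=
  (R.basicCochains k).map (R.partialMap k)

/-- The basic cohomology `H̃^k(E, M)`. -/
abbrev BasicH (k : ℕ) := Cohomology R.basicDiff R.basicCochains k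

/-- The cohomology `H^k(E, M)`. -/
abbrev H (k : ℕ) := Cohomology R.diff R.cochains k

/-- The cohomology `H^k(∂ C̃^•(E, M))`. -/
abbrev PartialH (k : ℕ) := Cohomology R.basicDiff R.partialCochains k

/-- The map `H̃^k(E, M) → H̃^k(E, M)` induced by the action of `∂` on basic cochains. -/
def partialH (k : ℕ) : R.BasicH k →ₗ[F] R.BasicH k :=
  cohMap R.partialMap R.partialMap_mem R.basicDiff_partialMap k

/-- The map `H̃^k(E, M) → H^k(E, M)` induced by `p_*`. -/
def pStarH (k : ℕ) : R.BasicH k →ₗ[F] R.H k :=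
  cohMap R.pStar R.pStar_mem R.diff_pStar k

/-- The map `H̃^k(E, M) → H^k(∂ C̃^•(E, M))` induced by `∂ : C̃^• → ∂ C̃^•`. -/
def ontoPartialH (k : ℕ) : R.BasicH k →ₗ[F] R.PartialH k :=
  cohMap R.partialMap (fun _ _ hφ => Submodule.mem_map_of_mem hφ) R.basicDiff_partialMap k

end LieConformalAlgebroid.Rep

end Complexes

end LCAd

end

set_option linter.unusedSectionVars false

noncomputable section

namespace LCAd

universe uF uA uE uM

/-! ### Evaluation of polynomials at points -/

section Evaluation

variable {F : Type*} [Field F] {σ τ : Type*}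
variable {M N : Type*} [AddCommGroup M] [Module F M] [AddCommGroup N] [Module F N]

/-! The field is infinite, so an element of `M[λ_1, ..., λ_k]` is determined by its values at
`F`-points (`ev_ext`), and a basic cochain by an ordinary `M`-valued function of `k` points of `G =
F × E`, its `pointCochain`. On `G` there is the bracket `(r, u), (s, v) ↦ (r + s, [u_r v])`, and
`(r, u)` acts on `M` by `u_r`. The Jacobi and module axioms evaluate to the Leibniz identity and to
the identity of an action, and the differential evaluates to the Chevalley–Eilenberg formula. On
skew functions this formula agrees (`leibnizD_succ_eq`) with the operator determined by Cartan's
relation `ι_x d = L_x - d ι_x`, for which `d² = 0` follows by induction on the degree from `[L_x,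
L_y] = L_{[x, y]}` and `[d, L_x] = 0` (`leibnizD_leibnizD`).

The bracket on `G` need not be skew, but it becomes so inside a sesquilinear cochain, where `∂` acts
as minus the parameter of the slot (`IsSesquilinear.slotSkew`). This makes `dφ` skew
(`IsSkew.leibnizD`), and then its sesquilinearity need only be checked in the last argument, where
`d` is assembled from operations that preserve the group `sesquilinear` (`sesquilinear_lie`).

For `k ≥ 1` the operator `∂ + ∑ λ_i` is injective, by descending induction on the degree in one
variable (`total_injective`). Hence a basic cochain killed by `p_*` is `∂` of a basic cochain
(`exists_partialMap_eq`). Freeness of `E` enters only in the surjectivity of `p_*`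
(`exists_basic_lift`): an `F`-linear lift is made sesquilinear in one argument after another by
extension from a basis, then averaged over `S_k`, which uses characteristic `0` once more.

The rest is homological algebra, isolated in `IsQuotientBy`. The sequence is the one attached to `0
→ ∂C̃ → C̃ → C → 0`, with `∂C̃` identified with `C̃` through `∂` in positive degrees. Since `∂` may
have a kernel in degree `0`, the connecting map is built directly from pairs `(φ, ψ)` with `dφ =
∂ψ`, and nothing is claimed at the first term. -/

/-- The value `f(t) ∈ M` of an element `f ∈ R ⊗ M` at an `F`-point `t` of `R`. -/
def pointEval {R : Type*} [CommRing R] [Algebra F R] (t : R →ₐ[F] F) : R ⊗[F] M →ₗ[F] M :=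
  TensorProduct.lid F M ∘ₗ LinearMap.rTensor M t.toLinearMap

@[simp]
theorem pointEval_tmul {R : Type*} [CommRing R] [Algebra F R] (t : R →ₐ[F] F) (p : R) (m : M) :
    pointEval t (p ⊗ₜ[F] m) = t p • m := by
  simp [pointEval]

/-- A basis of `M` over `F` is a basis of `R ⊗ M` over `R`, and evaluation at a point acts on the
coordinates. So points that separate elements of `R` also separate elements of `R ⊗ M`. -/
theorem pointEval_ext {R T : Type*} [CommRing R] [Algebra F R] (e : T → R →ₐ[F] F)
    (he : ∀ p : R, (∀ t, e t p = 0) → p = 0) {x y : R ⊗[F] M}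
    (h : ∀ t, pointEval (e t) x = pointEval (e t) y) : x = y := by
  rw [← sub_eq_zero]
  have h0 : ∀ t, pointEval (e t) (x - y) = 0 := fun t => by rw [map_sub, h, sub_self]
  generalize x - y = z at h0
  let b := Module.Basis.ofVectorSpace F M
  have hb : ∀ t i, b.repr (pointEval (e t) z) i = e t ((b.baseChange R).repr z i) := by
    intro t i
    clear h0
    induction z using TensorProduct.induction_on with
    | zero => simp
    | add x y hx hy => simp only [map_add, Finsupp.add_apply, hx, hy]
    | tmul p m =>
      simp [Module.Basis.baseChange_repr_tmul, Algebra.smul_def, mul_comm]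
  apply (b.baseChange R).repr.injective
  ext i
  rw [map_zero, Finsupp.zero_apply]
  exact he _ fun t => by rw [← hb, h0]; simp

/-- The value `f(t) ∈ M` of `f ∈ M[λ_s : s ∈ σ]` at a point `t`. -/
def ev (t : σ → F) : LPoly F σ M →ₗ[F] M := pointEval (MvPolynomial.aeval t)

@[simp]
theorem ev_tmul (t : σ → F) (p : MvPolynomial σ F) (m : M) :
    ev t (p ⊗ₜ[F] m) = MvPolynomial.eval t p • m := by
  simp [ev, MvPolynomial.aeval_eq_eval]

theorem ev_ext [Infinite F] {x y : LPoly F σ M} (h : ∀ t : σ → F, ev t x = ev t y) : x = y :=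
  pointEval_ext (fun t : σ → F => MvPolynomial.aeval t)
    (fun p hp => MvPolynomial.funext fun t => by simpa [MvPolynomial.aeval_eq_eval] using hp t) h

theorem ev_smul (t : σ → F) (q : MvPolynomial σ F) (x : LPoly F σ M) :
    ev t (q • x) = MvPolynomial.eval t q • ev t x := by
  induction x using TensorProduct.induction_on with
  | zero => simp
  | add x y hx hy => simp only [smul_add, map_add, hx, hy]
  | tmul p m => simp [TensorProduct.smul_tmul', mul_smul]

theorem ev_const (t : σ → F) (m : M) : ev t (const σ m) = m := by
  simp [const]

theorem ev_subst (g : MvPolynomial σ F →ₐ[F] MvPolynomial τ F) (t : τ → F) (x : LPoly F σ M) :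
    ev t (subst g x) = ev (fun s => MvPolynomial.eval t (g (MvPolynomial.X s))) x := by
  have h : ∀ p, MvPolynomial.eval t (g p) =
      MvPolynomial.eval (fun s => MvPolynomial.eval t (g (MvPolynomial.X s))) p := by
    intro p
    induction p using MvPolynomial.induction_on with
    | C a => simp [← MvPolynomial.algebraMap_eq]
    | add p q hp hq => simp only [map_add, hp, hq]
    | mul_X p s hp => simp only [map_mul, hp, MvPolynomial.eval_X]
  induction x using TensorProduct.induction_on with
  | zero => simp
  | add x y hx hy => simp only [map_add, hx, hy]
  | tmul p m =>
    rw [subst, LinearMap.rTensor_tmul, ev_tmul, ev_tmul, ← h]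
    rfl

/-- The value `f(s) ∈ M` of a polynomial `f ∈ M[λ]` in one variable. -/
abbrev ev1 (s : F) : LPoly F Unit M →ₗ[F] M := ev fun _ => s

theorem ev_evalAt (t : σ → F) (ℓ : MvPolynomial σ F) (x : LPoly F Unit M) :
    ev t (evalAt ℓ x) = ev1 (MvPolynomial.eval t ℓ) x := by
  rw [evalAt, ev_subst]
  simp only [MvPolynomial.aeval_X]

theorem ev_actAt (t : σ → F) (φ : M →ₗ[F] LPoly F Unit N) (ℓ : MvPolynomial σ F)
    (x : LPoly F σ M) : ev t (actAt φ ℓ x) = ev1 (MvPolynomial.eval t ℓ) (φ (ev t x)) := by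
  induction x using TensorProduct.induction_on with
  | zero => simp
  | add x y hx hy => simp only [map_add, hx, hy]
  | tmul p m => simp [actAt, ev_smul, ev_evalAt]

theorem ev_coeffD (t : σ → F) (D : M →ₗ[F] M) (x : LPoly F σ M) :
    ev t (coeffD σ D x) = D (ev t x) := by
  induction x using TensorProduct.induction_on with
  | zero => simp
  | add x y hx hy => simp only [map_add, hx, hy]
  | tmul p m => simp [coeffD]

theorem ev_perm {k : ℕ} (π : Equiv.Perm (Fin k)) (t : Fin k → F) (x : LPoly F (Fin k) M) :
    ev t (perm π x) = ev (t ∘ π) x := by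
  simp [perm, ev_subst, Function.comp_def]

theorem ev_merge {n : ℕ} (i : Fin (n + 1)) (j : Fin (n + 2)) (t : Fin (n + 2) → F)
    (x : LPoly F (Fin (n + 1)) M) :
    ev t (merge i j x) =
      ev (Fin.cons (t i.castSucc + t j) fun r => t (j.succAbove (i.succAbove r))) x := by
  rw [merge, ev_subst]
  congr 2
  ext s
  cases s using Fin.cases <;> simp

/-- The restriction of `f ∈ M[λ_s]` to the line through `t` in the direction of `λ_i`, as an
element of `F[x] ⊗ M`. -/
def line [DecidableEq σ] (i : σ) (t : σ → F) : LPoly F σ M →ₗ[F] Polynomial F ⊗[F] M :=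
  LinearMap.rTensor M (MvPolynomial.aeval fun j =>
    Polynomial.C (t j) + if j = i then Polynomial.X else 0).toLinearMap

theorem line_tmul [DecidableEq σ] (i : σ) (t : σ → F) (p : MvPolynomial σ F) (m : M) :
    line i t (p ⊗ₜ[F] m) = (MvPolynomial.aeval fun j =>
      (Polynomial.C (t j) + if j = i then Polynomial.X else 0 : Polynomial F)) p ⊗ₜ[F] m := by
  simp [line]

/-- The substitution `f(x) ↦ f(x + s)` in `F[x] ⊗ M`. -/
def translate (s : F) : Polynomial F ⊗[F] M →ₗ[F] Polynomial F ⊗[F] M :=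
  LinearMap.rTensor M (Polynomial.aeval (Polynomial.X + Polynomial.C s)).toLinearMap

theorem translate_tmul (s : F) (p : Polynomial F) (m : M) :
    translate s (p ⊗ₜ[F] m) = p.comp (Polynomial.X + Polynomial.C s) ⊗ₜ[F] m := by
  simp [translate, Polynomial.comp, Polynomial.aeval_def, Polynomial.algebraMap_eq]

theorem translate_translate (s r : F) (x : Polynomial F ⊗[F] M) :
    translate s (translate r x) = translate (s + r) x := by
  induction x using TensorProduct.induction_on with
  | zero => simp
  | add x y hx hy => simp only [map_add, hx, hy]
  | tmul p m => simp [translate_tmul, Polynomial.comp_assoc, add_assoc]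

/-- Translation along a line only moves the base point. This is how the dependence on the single
parameter `λ_i` is followed while the other parameters stay fixed. -/
theorem translate_line [DecidableEq σ] (i : σ) (t : σ → F) (s : F) (x : LPoly F σ M) :
    translate s (line i t x) = line i (Function.update t i (t i + s)) x := by
  have h : ∀ p : MvPolynomial σ F, (MvPolynomial.aeval (fun j =>
      (Polynomial.C (t j) + if j = i then Polynomial.X else 0 : Polynomial F)) p).comp
        (Polynomial.X + Polynomial.C s) = (MvPolynomial.aeval fun j =>
      (Polynomial.C (Function.update t i (t i + s) j) +
        if j = i then Polynomial.X else 0 : Polynomial F)) p := by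
    intro p
    induction p using MvPolynomial.induction_on with
    | C a => simp
    | add p q hp hq => simp only [map_add, Polynomial.add_comp, hp, hq]
    | mul_X p j hp =>
      simp only [map_mul, Polynomial.mul_comp, hp, MvPolynomial.aeval_X]
      congr 1
      by_cases hj : j = i
      · subst hj
        simp
        ring
      · simp [hj]
  induction x using TensorProduct.induction_on with
  | zero => simp
  | add x y hx hy => simp only [map_add, hx, hy]
  | tmul p m => simp only [line_tmul, translate_tmul, h]

theorem lTensor_translate (φ : M →ₗ[F] N) (s : F) (x : Polynomial F ⊗[F] M) :
    translate s (φ.lTensor (Polynomial F) x) = φ.lTensor (Polynomial F) (translate s x) := by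
  induction x using TensorProduct.induction_on with
  | zero => simp
  | add x y hx hy => simp only [map_add, hx, hy]
  | tmul p m => simp [translate_tmul]

end Evaluation

/-! ### The adjoint action of `A[∂]` at points -/

section Kappa

variable {F : Type uF} [Field F] {A : Type uA} [CommRing A] [Algebra F A] {σ : Type*}
variable {M : Type*} [AddCommGroup M] [Module F M] [Module A M] [IsScalarTower F A M]

/-- The map `f ↦ (|_{x = ∂} c) f(x)` from `F[x] ⊗ M` to `M`, for `c ∈ A`. -/
def derivEval (δ : Derivation F A A) (c : A) : Polynomial F ⊗[F] M →ₗ[F] M :=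
  TensorProduct.lift (LinearMap.mk₂ F
    (fun (p : Polynomial F) (m : M) =>
      (Polynomial.aeval (δ : A →ₗ[F] A) : Polynomial F →ₐ[F] Module.End F A) p c • m)
    (by intros; simp [add_smul]) (by intros; simp) (by intros; simp)
    (by intro a p m; exact smul_algebra_smul_comm _ _ _))

theorem derivEval_tmul (δ : Derivation F A A) (c : A) (p : Polynomial F) (m : M) :
    derivEval δ c (p ⊗ₜ[F] m) =
      (Polynomial.aeval (δ : A →ₗ[F] A) : Polynomial F →ₐ[F] Module.End F A) p c • m := rfl

/-- A derivation kills `1`, so only the constant term in `x` survives. -/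
theorem derivEval_one_eq (δ : Derivation F A A) (x : Polynomial F ⊗[F] M) :
    derivEval δ 1 x = pointEval (Polynomial.aeval 0) x := by
  induction x using TensorProduct.induction_on with
  | zero => simp
  | add x y hx hy => simp only [map_add, hx, hy]
  | tmul p m =>
    have h : (Polynomial.aeval (δ : A →ₗ[F] A) : Polynomial F →ₐ[F] Module.End F A) p 1 =
        algebraMap F A (p.eval 0) := by
      induction p using Polynomial.induction_on' with
      | add p q hp hq => simp only [map_add, LinearMap.add_apply, hp, hq, Polynomial.eval_add]
      | monomial n a =>
        cases n with
        | zero => simp [Algebra.smul_def]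
        | succ n => simp [Polynomial.aeval_monomial, pow_succ]
    rw [derivEval_tmul, h, pointEval_tmul, algebraMap_smul, Polynomial.coe_aeval_eq_eval]

theorem derivEval_one_line (δ : Derivation F A A) [DecidableEq σ] (i : σ) (t : σ → F)
    (x : LPoly F σ M) : derivEval δ 1 (line i t x) = ev t x := by
  rw [derivEval_one_eq]
  induction x using TensorProduct.induction_on with
  | zero => simp
  | add x y hx hy => simp only [map_add, hx, hy]
  | tmul p m =>
    rw [line_tmul, pointEval_tmul, ev_tmul]
    congr 1
    induction p using MvPolynomial.induction_on with
    | C a => simp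
    | add p q hp hq => simp only [map_add, hp, hq]
    | mul_X p j hp =>
      rw [map_mul, map_mul, hp, map_mul]
      by_cases hj : j = i <;> simp [hj]

/-- Pairing with `c = 1` after translation by `s` is evaluation at `x = s`, and over an infinite
field these values determine the polynomial. -/
theorem derivEval_translate_ext [Infinite F] (δ : Derivation F A A) {x y : Polynomial F ⊗[F] M}
    (h : ∀ s, derivEval δ 1 (translate s x) = derivEval δ 1 (translate s y)) : x = y := by
  have h1 : ∀ (s : F) (z : Polynomial F ⊗[F] M),
      derivEval δ 1 (translate s z) = pointEval (Polynomial.aeval s) z := by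
    intro s z
    rw [derivEval_one_eq]
    induction z using TensorProduct.induction_on with
    | zero => simp
    | add x y hx hy => simp only [map_add, hx, hy]
    | tmul p m => simp [translate_tmul, Polynomial.coe_aeval_eq_eval]
  refine pointEval_ext (fun s : F => Polynomial.aeval s)
    (fun p hp => Polynomial.funext fun s => ?_) fun s => ?_
  · simpa [Polynomial.coe_aeval_eq_eval] using hp s
  · rw [← h1, ← h1, h]

theorem ev_mulVec (t : σ → F) (m : M) (y : LPoly F σ A) :
    ev t (mulVec m y) = ev t y • m := by
  induction y using TensorProduct.induction_on with
  | zero => simp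
  | add x y hx hy => simp only [map_add, hx, hy, add_smul]
  | tmul p a => simp [mulVec]

theorem ev_coeffMul (t : σ → F) (a : A) (y : LPoly F σ M) :
    ev t (coeffMul a y) = a • ev t y := by
  induction y using TensorProduct.induction_on with
  | zero => simp
  | add x y hx hy => simp only [map_add, hx, hy, smul_add]
  | tmul p m => simpa [coeffMul] using (smul_algebra_smul_comm (MvPolynomial.eval t p) a m).symm

variable {δ : Derivation F A A}

theorem adjSymbol_C [DecidableEq σ] (i : σ) (c : A) :
    adjSymbol (F := F) δ i (Polynomial.C c) = const σ c := by
  simp [adjSymbol, Polynomial.sum_C_index]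

/-- The substitution `λ_i ↦ λ_i + x` with `x = ∂` on `b` turns multiplication of `x` by `-λ_i` into
the operator `-λ_i - ∂` on `b`. -/
theorem shiftMul_adjOp [DecidableEq σ] (i : σ) (b : LPoly F σ A) (x : LPoly F σ M) :
    shiftMul δ i ((-coeffD σ (δ : A →ₗ[F] A) - (MvPolynomial.X i : MvPolynomial σ F) • 1 :
      Module.End (MvPolynomial σ F) (LPoly F σ A)) b) x =
      shiftMul δ i b (-(MvPolynomial.X i : MvPolynomial σ F) • x) := by
  induction x using TensorProduct.induction_on with
  | zero => simp
  | add x y hx hy => simp only [map_add, smul_add, hx, hy]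
  | tmul p m =>
    rw [TensorProduct.smul_tmul', smul_eq_mul, shiftMul_tmul, shiftMul_tmul, map_mul, mul_comm,
      map_mul, Module.End.mul_apply]
    congr 2
    simp [shift]
    abel_nf

/-- This is the shape in which `a^*` is used from here on: `∂` acts as `-λ_i`, after which the
coefficient `c` acts through its constant symbol. Questions about `A[∂]` thereby reduce to `A` and
powers of a variable. -/
theorem adjMul_eq_sum [DecidableEq σ] (i : σ) (a : Polynomial A) (x : LPoly F σ M) :
    adjMul δ i a x = a.sum fun n c => adjMul δ i (Polynomial.C c)
      ((-(MvPolynomial.X i : MvPolynomial σ F)) ^ n • x) := by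
  have hadd : ∀ b b' : LPoly F σ A,
      shiftMul δ i (b + b') x = shiftMul δ i b x + shiftMul δ i b' x := by
    intro b b'
    induction x using TensorProduct.induction_on with
    | zero => simp
    | add x y hx hy => simp only [map_add, hx, hy]; abel
    | tmul p m => simp only [shiftMul_tmul, map_add]
  have hpow : ∀ n (b : LPoly F σ A) (x : LPoly F σ M),
      shiftMul δ i (((-coeffD σ (δ : A →ₗ[F] A) - (MvPolynomial.X i : MvPolynomial σ F) • 1) ^ n :
        Module.End (MvPolynomial σ F) (LPoly F σ A)) b) x =
      shiftMul δ i b ((-(MvPolynomial.X i : MvPolynomial σ F)) ^ n • x) := by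
    intro n
    induction n with
    | zero => simp
    | succ n ih =>
      intro b x
      rw [pow_succ, Module.End.mul_apply, ih, shiftMul_adjOp, smul_smul, pow_succ']
  let S : LPoly F σ A →+ LPoly F σ M := AddMonoidHom.mk' (fun b => shiftMul δ i b x) hadd
  change S (adjSymbol δ i a) = _
  rw [adjSymbol, Polynomial.sum_def, Polynomial.sum_def, map_sum]
  refine Finset.sum_congr rfl fun n _ => ?_
  rw [adjMul, adjSymbol_C, ← hpow]
  rfl

/-- Evaluation at `t` freezes each `λ_j` to `t_j` but leaves the increment `x` of `λ_i` free to act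
on `c`. Hence the value depends on `f` along a whole line, not just at `t`. -/
theorem ev_adjMul_C [DecidableEq σ] (i : σ) (c : A) (t : σ → F) (x : LPoly F σ M) :
    ev t (adjMul δ i (Polynomial.C c) x) = derivEval δ c (line i t x) := by
  have h : ∀ (p : MvPolynomial σ F) (b : LPoly F σ A),
      ev t (Polynomial.aeval (coeffD σ (δ : A →ₗ[F] A)) (shift i p) b) =
        (Polynomial.aeval (δ : A →ₗ[F] A) : Polynomial F →ₐ[F] Module.End F A)
          ((MvPolynomial.aeval fun j =>
            (Polynomial.C (t j) + if j = i then Polynomial.X else 0 : Polynomial F)) p)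
          (ev t b) := by
    intro p
    induction p using MvPolynomial.induction_on with
    | C a =>
      intro b
      simp [shift, Polynomial.aeval_C, MvPolynomial.algebraMap_eq]
      simp [ev_smul]
    | add p q hp hq => intro b; simp only [map_add, LinearMap.add_apply, hp, hq]
    | mul_X p j hp =>
      intro b
      simp only [map_mul, Module.End.mul_apply, hp]
      congr 1
      by_cases hj : j = i <;> simp [shift, hj, ev_smul, ev_coeffD]
  induction x using TensorProduct.induction_on with
  | zero => simp
  | add x y hx hy => simp only [map_add, hx, hy]
  | tmul p m => rw [adjMul, adjSymbol_C, shiftMul_tmul, ev_mulVec, h, ev_const, line_tmul,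
      derivEval_tmul]

theorem adjMul_C_zero [DecidableEq σ] (i : σ) (x : LPoly F σ M) :
    adjMul δ i (Polynomial.C (0 : A)) x = 0 := by
  rw [adjMul, adjSymbol_C]
  induction x using TensorProduct.induction_on with
  | zero => simp
  | add x y hx hy => simp only [map_add, hx, hy, add_zero]
  | tmul p m => simp [shiftMul_tmul]

theorem adjMul_X [DecidableEq σ] [Infinite F] (i : σ) (x : LPoly F σ M) :
    adjMul δ i (Polynomial.X : Polynomial A) x = -((MvPolynomial.X i : MvPolynomial σ F) • x) := by
  rw [adjMul_eq_sum, Polynomial.sum_X_index (adjMul_C_zero i _)]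
  refine ev_ext fun t => ?_
  rw [ev_adjMul_C, derivEval_one_line]
  simp [ev_smul]

end Kappa

/-! ### Cartan calculus for the Leibniz differential -/

section Cartan

variable {F : Type*} [Field F] {G M : Type*} [AddCommGroup M] [Module F M]

/-- The insertion `ω ↦ ω(x, ...)`. -/
def insertion {k : ℕ} (x : G) : ((Fin (k + 1) → G) → M) →ₗ[F] ((Fin k → G) → M) where
  toFun ω u := ω (Fin.cons x u)
  map_add' _ _ := rfl
  map_smul' _ _ := rfl

theorem insertion_apply {k : ℕ} (x : G) (ω : (Fin (k + 1) → G) → M) (u : Fin k → G) :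
    insertion (F := F) x ω u = ω (Fin.cons x u) := rfl

theorem insertion_ext {k : ℕ} {ω ω' : (Fin (k + 1) → G) → M}
    (h : ∀ x, insertion (F := F) x ω = insertion (F := F) x ω') : ω = ω' := by
  ext g
  rw [← Fin.cons_self_tail g]
  exact congrFun (h (g 0)) (Fin.tail g)

variable (br : G → G → G) (ac : G → M →ₗ[F] M)

/-- The Lie derivative `(L_x ω)(u) = x ω(u) - ∑_i ω(..., [x, u_i], ...)`. -/
def lieD {k : ℕ} (x : G) : ((Fin k → G) → M) →ₗ[F] ((Fin k → G) → M) where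
  toFun ω u := ac x (ω u) - ∑ i, ω (Function.update u i (br x (u i)))
  map_add' ω ω' := by
    ext u
    simp only [Pi.add_apply, map_add, Finset.sum_add_distrib]
    abel
  map_smul' c ω := by
    ext u
    simp only [Pi.smul_apply, map_smul, ← Finset.smul_sum, RingHom.id_apply, smul_sub]

theorem lieD_apply {k : ℕ} (x : G) (ω : (Fin k → G) → M) (u : Fin k → G) :
    lieD br ac x ω u = ac x (ω u) - ∑ i, ω (Function.update u i (br x (u i))) := rfl

/-- The differential determined by `ι_x d = L_x - d ι_x`. -/
def leibnizD : ∀ k, ((Fin k → G) → M) →ₗ[F] ((Fin (k + 1) → G) → M)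
  | 0 =>
    { toFun := fun ω g => lieD br ac (g 0) ω (Fin.tail g)
      map_add' := fun ω ω' => by ext g; simp
      map_smul' := fun c ω => by ext g; simp }
  | k + 1 =>
    { toFun := fun ω g => lieD br ac (g 0) ω (Fin.tail g) -
        leibnizD k (insertion (F := F) (g 0) ω) (Fin.tail g)
      map_add' := fun ω ω' => by ext g; simp; abel
      map_smul' := fun c ω => by ext g; simp [smul_sub] }

theorem insertion_leibnizD_zero (x : G) (ω : (Fin 0 → G) → M) :
    insertion (F := F) x (leibnizD br ac 0 ω) = lieD br ac x ω := rfl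

theorem insertion_leibnizD_succ {k : ℕ} (x : G) (ω : (Fin (k + 1) → G) → M) :
    insertion (F := F) x (leibnizD br ac (k + 1) ω) =
      lieD br ac x ω - leibnizD br ac k (insertion (F := F) x ω) := rfl

theorem leibnizD_zero_cons (x : G) (ω : (Fin 0 → G) → M) (u : Fin 0 → G) :
    leibnizD br ac 0 ω (Fin.cons x u : Fin 1 → G) = lieD br ac x ω u := rfl

theorem leibnizD_succ_cons {k : ℕ} (x : G) (ω : (Fin (k + 1) → G) → M) (u : Fin (k + 1) → G) :
    leibnizD br ac (k + 1) ω (Fin.cons x u : Fin (k + 2) → G) =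
      lieD br ac x ω u - leibnizD br ac k (insertion (F := F) x ω) u := rfl

/-- Cartan's relation `[L_x, ι_y] = ι_{[x, y]}`: the slot filled by `y` contributes the extra term.
-/
theorem insertion_lieD {k : ℕ} (x y : G) (ω : (Fin (k + 1) → G) → M) :
    insertion (F := F) y (lieD br ac x ω) =
      lieD br ac x (insertion (F := F) y ω) - insertion (F := F) (br x y) ω := by
  ext u
  simp only [insertion_apply, lieD_apply, Pi.sub_apply, Fin.sum_univ_succ, Fin.cons_zero,
    Fin.cons_succ, Fin.update_cons_zero, ← Fin.cons_update]
  abel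

/-- `ω` satisfies the Leibniz identity of the bracket in each argument. -/
def SlotLeibniz {k : ℕ} (ω : (Fin k → G) → M) : Prop :=
  ∀ (i : Fin k) (u : Fin k → G) (x y z : G),
    ω (Function.update u i (br x (br y z))) - ω (Function.update u i (br y (br x z))) =
      ω (Function.update u i (br (br x y) z))

/-- `ω` is skew-symmetric on brackets placed in any argument. -/
def SlotSkew {k : ℕ} (ω : (Fin k → G) → M) : Prop :=
  ∀ (i : Fin k) (u : Fin k → G) (x y : G),
    ω (Function.update u i (br x y)) = -ω (Function.update u i (br y x))

/-- `ω` is skew-symmetric. -/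
def IsSkew {k : ℕ} (ω : (Fin k → G) → M) : Prop :=
  ∀ (π : Equiv.Perm (Fin k)) (u : Fin k → G), ω (u ∘ π) = (Equiv.Perm.sign π : ℤ) • ω u

variable {br ac}

theorem SlotLeibniz.insertion {k : ℕ} {ω : (Fin (k + 1) → G) → M} (h : SlotLeibniz br ω) (x : G) :
    SlotLeibniz br (insertion (F := F) x ω) := by
  intro i u y z w
  simp only [insertion_apply, Fin.cons_update]
  exact h _ _ _ _ _

theorem SlotLeibniz.head {k : ℕ} {ω : (Fin (k + 1) → G) → M} (h : SlotLeibniz br ω) (x y z : G) :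
    LCAd.insertion (F := F) (br x (br y z)) ω - LCAd.insertion (F := F) (br y (br x z)) ω =
      LCAd.insertion (F := F) (br (br x y) z) ω := by
  ext u
  simpa [insertion_apply] using h 0 (Fin.cons x u) x y z

theorem SlotSkew.insertion {k : ℕ} {ω : (Fin (k + 1) → G) → M} (h : SlotSkew br ω) (x : G) :
    SlotSkew br (insertion (F := F) x ω) := by
  intro i u y z
  simp only [insertion_apply, Fin.cons_update]
  exact h _ _ _ _

theorem SlotSkew.head {k : ℕ} {ω : (Fin (k + 1) → G) → M} (h : SlotSkew br ω) (x y : G) :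
    LCAd.insertion (F := F) (br x y) ω = -LCAd.insertion (F := F) (br y x) ω := by
  ext u
  simpa [insertion_apply] using h 0 (Fin.cons x u) x y

/-- Induction on the degree by inserting `z`: the mixed terms `ι_{[x, z]} L_y` and `ι_{[y, z]} L_x`
cancel, and the remaining insertions combine by the Leibniz identity. Skew-symmetry plays no role.
-/
theorem lieD_lieD (hac : ∀ x y m, ac (br x y) m = ac x (ac y m) - ac y (ac x m)) {k : ℕ}
    {ω : (Fin k → G) → M} (h : SlotLeibniz br ω) (x y : G) :
    lieD br ac x (lieD br ac y ω) - lieD br ac y (lieD br ac x ω) = lieD br ac (br x y) ω := by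
  induction k with
  | zero =>
    ext u
    simp [lieD_apply, hac]
  | succ k ih =>
    refine insertion_ext (F := F) fun z => ?_
    simp only [map_sub, insertion_lieD, ← ih (h.insertion (F := F) z), ← h.head (F := F)]
    abel

/-- After inserting `y`, the commutator `[d, L_x]` becomes `L_{[x, y]} - [L_x, L_y]`, which
vanishes, plus the same commutator on `ι_y ω`, which vanishes by induction. -/
theorem leibnizD_lieD (hac : ∀ x y m, ac (br x y) m = ac x (ac y m) - ac y (ac x m)) {k : ℕ}
    {ω : (Fin k → G) → M} (h : SlotLeibniz br ω) (x : G) :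
    leibnizD br ac k (lieD br ac x ω) = lieD br ac x (leibnizD br ac k ω) := by
  induction k with
  | zero =>
    refine insertion_ext (F := F) fun y => ?_
    rw [insertion_lieD, insertion_leibnizD_zero, insertion_leibnizD_zero, insertion_leibnizD_zero,
      ← lieD_lieD hac h]
    abel
  | succ k ih =>
    refine insertion_ext (F := F) fun y => ?_
    rw [insertion_lieD, insertion_leibnizD_succ, insertion_leibnizD_succ, insertion_leibnizD_succ,
      ← lieD_lieD hac h, insertion_lieD]
    simp only [map_sub, ih (h.insertion (F := F) y)]
    abel

/-- Cartan's relation gives `ι_y d d = [L_y, d] + d d ι_y`, so `[d, L_y] = 0` allows an induction on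
the degree. -/
theorem leibnizD_leibnizD (hac : ∀ x y m, ac (br x y) m = ac x (ac y m) - ac y (ac x m)) {k : ℕ}
    {ω : (Fin k → G) → M} (h : SlotLeibniz br ω) :
    leibnizD br ac (k + 1) (leibnizD br ac k ω) = 0 := by
  induction k with
  | zero =>
    refine insertion_ext (F := F) fun y => ?_
    rw [insertion_leibnizD_succ, insertion_leibnizD_zero, leibnizD_lieD hac h]
    simp
  | succ k ih =>
    refine insertion_ext (F := F) fun y => ?_
    rw [insertion_leibnizD_succ, insertion_leibnizD_succ, map_sub, leibnizD_lieD hac h,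
      ih (h.insertion (F := F) y)]
    simp

/-- Adjacent transpositions generate the symmetric group, even as a monoid. -/
theorem isSkew_of_adjacent {k : ℕ} {ω : (Fin k → G) → M}
    (h : ∀ i j : Fin k, (j : ℕ) = i + 1 → ∀ u, ω (u ∘ Equiv.swap i j) = -ω u) : IsSkew ω := by
  intro π
  cases k with
  | zero =>
    intro u
    have : u ∘ π = u := Subsingleton.elim _ _
    rw [this, Subsingleton.elim π 1]
    simp
  | succ n =>
    have hπ : π ∈ Submonoid.closure
        (Set.range fun i : Fin n => Equiv.swap i.castSucc i.succ) := by
      rw [Equiv.Perm.mclosure_swap_castSucc_succ]; trivial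
    induction hπ using Submonoid.closure_induction with
    | mem π hπ =>
      obtain ⟨i, rfl⟩ := hπ
      intro u
      rw [h _ _ (by simp), Equiv.Perm.sign_swap (Fin.castSucc_lt_succ).ne]
      simp
    | one => intro u; simp
    | mul π τ _ _ h1 h2 =>
      intro u
      have : u ∘ ⇑(π * τ) = (u ∘ π) ∘ τ := rfl
      rw [this, h2, h1, smul_smul, map_mul]
      simp [mul_comm]

theorem IsSkew.insertion {k : ℕ} {ω : (Fin (k + 1) → G) → M} (h : IsSkew ω) (x : G) :
    IsSkew (insertion (F := F) x ω) := by
  refine isSkew_of_adjacent fun i j hij u => ?_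
  have h1 : (Fin.cons x (u ∘ Equiv.swap i j) : Fin (k + 1) → G) =
      (Fin.cons x u : Fin (k + 1) → G) ∘ Equiv.swap i.succ j.succ := by
    ext r
    cases r using Fin.cases with
    | zero =>
      simp [Equiv.swap_apply_of_ne_of_ne (Fin.succ_ne_zero i).symm (Fin.succ_ne_zero j).symm]
    | succ r =>
      simp only [Fin.cons_succ, Function.comp_apply, Equiv.swap_apply_def, Fin.succ_inj]
      split_ifs <;> simp
  have hne : i ≠ j := fun e => by subst e; omega
  rw [insertion_apply, h1, h, Equiv.Perm.sign_swap (by simpa using hne)]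
  simp [insertion_apply]

theorem IsSkew.swap_head {k : ℕ} {ω : (Fin (k + 2) → G) → M} (h : IsSkew ω) (x y : G) :
    LCAd.insertion (F := F) y (LCAd.insertion (F := F) x ω) =
      -LCAd.insertion (F := F) x (LCAd.insertion (F := F) y ω) := by
  ext u
  have h1 : (Fin.cons x (Fin.cons y u : Fin (k + 1) → G) : Fin (k + 2) → G) =
      (Fin.cons y (Fin.cons x u : Fin (k + 1) → G) : Fin (k + 2) → G) ∘ Equiv.swap 0 1 := by
    ext r
    cases r using Fin.cases with
    | zero => simp
    | succ r =>
      cases r using Fin.cases with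
      | zero => simp
      | succ r =>
        rw [Function.comp_apply, Equiv.swap_apply_of_ne_of_ne (Fin.succ_ne_zero _)
          (by simp [Fin.ext_iff])]
        simp
  simp only [insertion_apply, Pi.neg_apply]
  rw [h1, h, Equiv.Perm.sign_swap (by simp)]
  simp

theorem IsSkew.lieD {k : ℕ} {ω : (Fin k → G) → M} (h : IsSkew ω) (x : G) :
    IsSkew (lieD br ac x ω) := by
  intro π u
  have h1 : ∀ i, Function.update (u ∘ π) i (br x ((u ∘ π) i)) =
      Function.update u (π i) (br x (u (π i))) ∘ π := by
    intro i
    ext r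
    by_cases hr : r = i
    · subst hr; simp
    · simp [hr]
  simp only [lieD_apply, h1, h π, smul_sub, Finset.smul_sum, map_zsmul]
  congr 1
  exact Equiv.sum_comp π fun i =>
    (Equiv.Perm.sign π : ℤ) • ω (Function.update u i (br x (u i)))

/-- For adjacent slots after the first, `ι_x d = L_x - d ι_x` is skew by induction. For the first
two, Cartan's relations give `ι_y ι_x d = L_x ι_y - ι_{[x, y]} - L_y ι_x + d ι_y ι_x`, which is
antisymmetric in `x, y` once the bracket is skew inside `ω`. -/
theorem IsSkew.leibnizD {k : ℕ} {ω : (Fin k → G) → M} (h : IsSkew ω) (h' : SlotSkew br ω) :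
    IsSkew (leibnizD br ac k ω) := by
  induction k with
  | zero =>
    refine isSkew_of_adjacent fun i j hij u => ?_
    omega
  | succ k ih =>
    refine isSkew_of_adjacent fun i j hij u => ?_
    cases j using Fin.cases with
    | zero => simp at hij
    | succ j =>
      have hne : i ≠ j.succ := fun e => by subst e; omega
      cases i using Fin.cases with
      | succ i =>
        have h1 : IsSkew (LCAd.insertion (F := F) (u 0) (LCAd.leibnizD br ac (k + 1) ω)) := by
          intro π v
          rw [insertion_leibnizD_succ, Pi.sub_apply, Pi.sub_apply, smul_sub,
            ← h.lieD (u 0) π v, ← ih (h.insertion (F := F) (u 0)) (h'.insertion (F := F) (u 0))]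
        have h2 : u ∘ Equiv.swap i.succ j.succ =
            (Fin.cons (u 0) (Fin.tail u ∘ Equiv.swap i j) : Fin (k + 2) → G) := by
          ext r
          cases r using Fin.cases with
          | zero =>
            simp [Equiv.swap_apply_of_ne_of_ne (Fin.succ_ne_zero i).symm (Fin.succ_ne_zero j).symm]
          | succ r =>
            simp only [Fin.cons_succ, Function.comp_apply, Equiv.swap_apply_def, Fin.succ_inj]
            split_ifs <;> simp [Fin.tail]
        have h3 := h1 (Equiv.swap i j) (Fin.tail u)
        rw [insertion_apply, insertion_apply, Fin.cons_self_tail] at h3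
        rw [h2, h3, Equiv.Perm.sign_swap (by simpa using hne)]
        simp
      | zero =>
        have hj : j = 0 := by
          ext; simpa using hij
        subst hj
        have key : ∀ x y, LCAd.insertion (F := F) y (LCAd.insertion (F := F) x
            (LCAd.leibnizD br ac (k + 1) ω)) = -LCAd.insertion (F := F) x
              (LCAd.insertion (F := F) y (LCAd.leibnizD br ac (k + 1) ω)) := by
          intro x y
          rw [insertion_leibnizD_succ, insertion_leibnizD_succ, map_sub, map_sub, insertion_lieD,
            insertion_lieD, h'.head (F := F) y x]
          -- For `ω` of degree `1`, `ι_x ω` has degree `0` and the term `d ι_y ι_x ω` is absent.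
          cases k with
          | zero =>
            rw [insertion_leibnizD_zero, insertion_leibnizD_zero]
            abel
          | succ k =>
            rw [insertion_leibnizD_succ, insertion_leibnizD_succ, h.swap_head x y, map_neg]
            abel
        have hu : u = Fin.cons (u 0) (Fin.cons (u 1) (Fin.tail (Fin.tail u)) :
            Fin (k + 1) → G) := by
          rw [← Fin.cons_self_tail u]
          congr 1
          exact (Fin.cons_self_tail (Fin.tail u)).symm
        have hu' : u ∘ Equiv.swap 0 (Fin.succ 0) = (Fin.cons (u 1) (Fin.cons (u 0)
            (Fin.tail (Fin.tail u)) : Fin (k + 1) → G) : Fin (k + 2) → G) := by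
          ext r
          cases r using Fin.cases with
          | zero => simp
          | succ r =>
            cases r using Fin.cases with
            | zero => simp
            | succ r =>
              rw [Function.comp_apply, Equiv.swap_apply_of_ne_of_ne (Fin.succ_ne_zero _)
                (by simp [Fin.ext_iff])]
              simp [Fin.tail]
        have e := congrFun (key (u 1) (u 0)) (Fin.tail (Fin.tail u))
        rw [hu']
        conv_rhs => rw [hu]
        exact e

/-- A property of functions `G → M` which holds for the last argument of `ω`. -/
def LastArg (P : AddSubgroup (G → M)) {k : ℕ} (ω : (Fin (k + 1) → G) → M) : Prop :=
  ∀ u : Fin k → G, (fun z => ω (Fin.snoc u z)) ∈ P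

theorem LastArg.insertion {P : AddSubgroup (G → M)} {k : ℕ} {ω : (Fin (k + 2) → G) → M}
    (h : LastArg P ω) (x : G) : LastArg P (insertion (F := F) x ω) := by
  intro u
  simp only [insertion_apply, Fin.cons_snoc_eq_snoc_cons]
  exact h _

/-- The sum over slots splits: the earlier slots only change the arguments that are held fixed, and
the last slot together with the action gives the operation covered by `hP`. -/
theorem LastArg.lieD {P : AddSubgroup (G → M)}
    (hP : ∀ f ∈ P, ∀ x, (fun z => ac x (f z) - f (br x z)) ∈ P)
    {k : ℕ} {ω : (Fin (k + 1) → G) → M} (h : LastArg P ω) (x : G) :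
    LastArg P (lieD br ac x ω) := by
  intro u
  have h1 : (fun z => LCAd.lieD br ac x ω (Fin.snoc u z)) =
      (fun z => ac x (ω (Fin.snoc u z)) - ω (Fin.snoc u (br x z))) -
        ∑ i, fun z => ω (Fin.snoc (Function.update u i (br x (u i))) z) := by
    ext z
    simp only [lieD_apply, Fin.sum_univ_castSucc, Pi.sub_apply, Finset.sum_apply,
      Fin.snoc_castSucc, Fin.snoc_last, Fin.snoc_update, Fin.update_snoc_last]
    abel
  rw [h1]
  exact sub_mem (hP _ (h u) x) (sum_mem fun i _ => h _)

theorem LastArg.leibnizD_zero {P : AddSubgroup (G → M)} (hP : ∀ m, (fun z => ac z m) ∈ P)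
    (ω : (Fin 0 → G) → M) : LastArg P (leibnizD br ac 0 ω) := by
  intro u
  have : (fun z => LCAd.leibnizD br ac 0 ω (Fin.snoc u z)) = fun z => ac z (ω u) := by
    ext z
    have h1 : (Fin.snoc u z : Fin 1 → G) = Fin.cons z u := by
      ext r
      rw [Fin.fin_one_eq_zero r]
      rfl
    rw [h1, leibnizD_zero_cons, lieD_apply]
    simp
  rw [this]
  exact hP _

/-- Cartan's recursion consumes arguments from the front, so the last argument meets only Lie
derivatives until, in degree `0`, it acts on a fixed element of `M`. -/
theorem LastArg.leibnizD_succ {P : AddSubgroup (G → M)} (hP : ∀ m, (fun z => ac z m) ∈ P)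
    (hP' : ∀ f ∈ P, ∀ x, (fun z => ac x (f z) - f (br x z)) ∈ P)
    {k : ℕ} {ω : (Fin (k + 1) → G) → M} (h : LastArg P ω) :
    LastArg P (leibnizD br ac (k + 1) ω) := by
  induction k with
  | zero =>
    intro u
    rw [← Fin.cons_self_tail u]
    simp only [← Fin.cons_snoc_eq_snoc_cons, leibnizD_succ_cons]
    exact sub_mem (h.lieD hP' _ _) (LastArg.leibnizD_zero hP _ _)
  | succ k ih =>
    intro u
    rw [← Fin.cons_self_tail u]
    simp only [← Fin.cons_snoc_eq_snoc_cons, leibnizD_succ_cons]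
    exact sub_mem (h.lieD hP' _ _) (ih (h.insertion (F := F) _) _)

/-! ### The explicit formula for skew-symmetric cochains -/

/-- Carrying the first argument to place `j` is a cycle of sign `(-1) ^ j`. -/
theorem IsSkew.cons_eq {k : ℕ} {ω : (Fin (k + 1) → G) → M} (h : IsSkew ω) (u : Fin (k + 1) → G)
    (j : Fin (k + 1)) (y : G) :
    (-1 : F) ^ (j : ℕ) • ω (Fin.cons y fun r => u (j.succAbove r)) =
      ω (Function.update u j y) := by
  have h1 : (Fin.cons y (fun r => u (j.succAbove r)) : Fin (k + 1) → G) =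
      Function.update u j y ∘ j.cycleRange.symm := by
    rw [← Fin.cons_removeNth_eq_comp_cycleRange_symm]
    simp [Fin.removeNth_update]
    rfl
  rw [h1, h, Equiv.Perm.sign_symm, Fin.sign_cycleRange]
  -- The two signs live in different rings, one in `F` and one in `ℤ`; their product is checked by
  -- parity.
  rcases neg_one_pow_eq_or F (j : ℕ) with hj | hj <;>
    rcases Nat.even_or_odd (j : ℕ) with hj' | hj' <;> simp [hj'.neg_one_pow]

/-- The part of the differential given by the action. -/
def actSum (ac : G → M →ₗ[F] M) {k : ℕ} (ω : (Fin k → G) → M) (g : Fin (k + 1) → G) : M :=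
  ∑ i : Fin (k + 1), (-1 : F) ^ (i : ℕ) • ac (g i) (ω fun r => g (i.succAbove r))

variable (F) in
/-- The part of the differential given by the bracket. -/
def bracketSum (br : G → G → G) {n : ℕ} (ω : (Fin (n + 1) → G) → M) (g : Fin (n + 2) → G) : M :=
  ∑ i : Fin (n + 1), ∑ j : Fin (n + 2) with i.castSucc < j,
    (-1 : F) ^ ((i : ℕ) + (j : ℕ)) •
      ω (Fin.cons (br (g i.castSucc) (g j)) fun r => g (j.succAbove (i.succAbove r)))

theorem leibnizD_zero_eq (ω : (Fin 0 → G) → M) : leibnizD br ac 0 ω = actSum ac ω := by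
  ext g
  rw [← Fin.cons_self_tail g, leibnizD_zero_cons, lieD_apply,
    actSum]
  simp
  rfl

theorem actSum_cons {k : ℕ} (ω : (Fin (k + 1) → G) → M) (x : G) (u : Fin (k + 1) → G) :
    actSum ac ω (Fin.cons x u : Fin (k + 2) → G) =
      ac x (ω u) - actSum ac (insertion (F := F) x ω) u := by
  rw [actSum, Fin.sum_univ_succ, actSum, sub_eq_add_neg, ← Finset.sum_neg_distrib]
  congr 1
  · simp
  · refine Finset.sum_congr rfl fun i _ => ?_
    have h1 : (fun r => (Fin.cons x u : Fin (k + 2) → G) (i.succ.succAbove r)) =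
        Fin.cons x fun r => u (i.succAbove r) := by
      ext r
      cases r using Fin.cases <;> simp
    rw [h1, insertion_apply]
    simp [pow_succ]

/-- The terms with `i = 0` reassemble the bracket part of the Lie derivative. The overall minus sign
comes from counting `j` in the longer tuple, where it is one larger. -/
theorem IsSkew.bracketSum_head {n : ℕ} {ω : (Fin (n + 1) → G) → M} (h : IsSkew ω) (x : G)
    (u : Fin (n + 1) → G) :
    ∑ j : Fin (n + 2) with (0 : Fin (n + 1)).castSucc < j,
      (-1 : F) ^ (((0 : Fin (n + 1)) : ℕ) + (j : ℕ)) •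
        ω (Fin.cons (br ((Fin.cons x u : Fin (n + 2) → G) (0 : Fin (n + 1)).castSucc)
          ((Fin.cons x u : Fin (n + 2) → G) j)) fun r =>
            (Fin.cons x u : Fin (n + 2) → G) (j.succAbove ((0 : Fin (n + 1)).succAbove r))) =
      -∑ j, ω (Function.update u j (br x (u j))) := by
  rw [Finset.sum_filter, Fin.sum_univ_succ, ← Finset.sum_neg_distrib]
  simp only [Fin.castSucc_zero, lt_irrefl, if_false, zero_add, Fin.succ_pos, if_true]
  refine Finset.sum_congr rfl fun j _ => ?_
  rw [← h.cons_eq (F := F)]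
  simp [pow_succ]

/-- When both indices are positive, lowering them by one preserves `(-1) ^ (i + j)`. The minus sign
comes from exchanging `x` with the bracket in the first two places. -/
theorem IsSkew.bracketSum_cons {n : ℕ} {ω : (Fin (n + 2) → G) → M} (h : IsSkew ω) (x : G)
    (u : Fin (n + 2) → G) :
    bracketSum F br ω (Fin.cons x u : Fin (n + 3) → G) =
      -∑ j, ω (Function.update u j (br x (u j))) -
        bracketSum F br (LCAd.insertion (F := F) x ω) u := by
  rw [bracketSum, Fin.sum_univ_succ, h.bracketSum_head, bracketSum, sub_eq_add_neg,
    ← Finset.sum_neg_distrib]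
  congr 1
  rw [← Finset.sum_neg_distrib]
  refine Finset.sum_congr rfl fun i _ => ?_
  rw [Finset.sum_filter, Fin.sum_univ_succ, Finset.sum_filter, ← Finset.sum_neg_distrib]
  simp only [not_lt_zero, if_false, zero_add]
  refine Finset.sum_congr rfl fun j _ => ?_
  have h2 : i.succ.castSucc < j.succ ↔ i.castSucc < j := by
    rw [Fin.castSucc_succ, Fin.succ_lt_succ_iff]
  simp only [h2]
  split_ifs with hij
  · have h3 : (fun r => (Fin.cons x u : Fin (n + 3) → G)
        (j.succ.succAbove (i.succ.succAbove r))) =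
        (Fin.cons x fun r => u (j.succAbove (i.succAbove r)) : Fin (n + 1) → G) := by
      ext r
      cases r using Fin.cases <;> simp
    have h4 := fun y => congrFun (h.swap_head (F := F) y x)
      fun r => u (j.succAbove (i.succAbove r))
    simp only [insertion_apply, Pi.neg_apply] at h4
    rw [h3, h4, insertion_apply]
    simp only [Fin.castSucc_succ, Fin.cons_succ, Fin.val_succ, smul_neg]
    congr 2
    ring
  · simp

/-- On skew cochains the explicit formula satisfies Cartan's recursion in the first argument, which
determines `d`. -/
theorem leibnizD_succ_eq {n : ℕ} {ω : (Fin (n + 1) → G) → M} (h : IsSkew ω) :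
    leibnizD br ac (n + 1) ω = actSum ac ω + bracketSum F br ω := by
  induction n with
  | zero =>
    ext g
    rw [← Fin.cons_self_tail g, leibnizD_succ_cons,
      leibnizD_zero_eq, Pi.add_apply, actSum_cons, bracketSum, Fin.sum_univ_succ,
      h.bracketSum_head, lieD_apply]
    simp
    abel
  | succ n ih =>
    ext g
    rw [← Fin.cons_self_tail g, leibnizD_succ_cons,
      ih (h.insertion (F := F) _), Pi.add_apply, Pi.add_apply, actSum_cons, h.bracketSum_cons,
      lieD_apply]
    abel

end Cartan

/-! ### The identities of an algebroid at points -/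

section Points

variable {F : Type uF} [Field F] {A : Type uA} [CommRing A] [Algebra F A]
variable {δ : Derivation F A A}
variable {E : Type uE} [AddCommGroup E] [Module F E] [Module A E] [IsScalarTower F A E]
variable {M : Type uM} [AddCommGroup M] [Module F M] [Module A M]

namespace DiffModule

theorem op_C (X : DiffModule δ M) (c : A) (m : M) : X.op (Polynomial.C c) m = c • m := by
  simp [op, Polynomial.sum_C_index]

theorem op_X (X : DiffModule δ M) (m : M) : X.op (Polynomial.X : Polynomial A) m = X.D m := by
  simp [op, Polynomial.sum_X_index]

end DiffModule

variable [IsScalarTower F A M]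

theorem opShift_C {σ : Type*} (D : M →ₗ[F] M) (i : σ) (c : A) (f : LPoly F σ M) :
    opShift D i (Polynomial.C c) f = coeffMul c f := by
  rw [opShift, Polynomial.sum_C_index (by simp [coeffMul])]
  simp

theorem opVec_C (D : M →ₗ[F] M) (φ : A →ₗ[F] LPoly F Unit A) (c : A) (m : M) :
    opVec D φ (Polynomial.C c) m = mulVec m (φ c) := by
  rw [opVec, Polynomial.sum_C_index (by simp)]
  simp

/-- The bracket `((r, u), (s, v)) ↦ (r + s, [u_r v])`. -/
def LieConformalAlgebroid.pointBracket (L : LieConformalAlgebroid δ E) (x y : F × E) : F × E :=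
  (x.1 + y.1, ev1 x.1 (L.bracket x.2 y.2))

/-- The operator `θ(u)_r` on `A`. -/
def LieConformalAlgebroid.pointAnchor (L : LieConformalAlgebroid δ E) (x : F × E) : A →ₗ[F] A :=
  ev1 x.1 ∘ₗ L.anchor x.2

variable {L : LieConformalAlgebroid δ E}

/-- The operator `m ↦ u_r m`. -/
def LieConformalAlgebroid.Rep.pointAct (R : L.Rep M) (x : F × E) : M →ₗ[F] M :=
  ev1 x.1 ∘ₗ R.act x.2

theorem pointBracket_leibniz (L : LieConformalAlgebroid δ E) (r s : F) (u v w : E) :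
    ev1 r (L.bracket u (ev1 s (L.bracket v w))) - ev1 s (L.bracket v (ev1 r (L.bracket u w))) =
      ev1 (r + s) (L.bracket (ev1 r (L.bracket u v)) w) := by
  have h := congrArg (ev ![r, s]) (L.isLieConformalAlgebra.jacobi u v w)
  simpa [ev_actAt, ev_evalAt] using h

theorem pointAct_pointBracket (R : L.Rep M) (x y : F × E) (m : M) :
    R.pointAct (L.pointBracket x y) m =
      R.pointAct x (R.pointAct y m) - R.pointAct y (R.pointAct x m) := by
  -- The axiom carries `μ - λ` as the parameter of the second element, so `μ` is the sum of the two
  -- parameters.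
  have h := congrArg (ev ![x.1, x.1 + y.1]) (R.bracket_act x.2 y.2 m)
  simpa [ev_actAt, ev_evalAt, LieConformalAlgebroid.Rep.pointAct,
    LieConformalAlgebroid.pointBracket] using h

theorem bracket_smul_eval (L : LieConformalAlgebroid δ E) (r : F) (u : E) (c : A) (v : E) :
    ev1 r (L.bracket u (c • v)) =
      c • ev1 r (L.bracket u v) + L.pointAnchor (r, u) c • v := by
  have h := congrArg (ev1 r) (L.bracket_op u (Polynomial.C c) v)
  rw [DiffModule.op_C, opShift_C, opVec_C, map_add, ev_coeffMul, ev_mulVec] at h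
  exact h

theorem bracket_D_eval (L : LieConformalAlgebroid δ E) (r : F) (u v : E) :
    ev1 r (L.bracket u (L.D v)) = L.D (ev1 r (L.bracket u v)) + r • ev1 r (L.bracket u v) := by
  rw [L.isLieConformalAlgebra.sesq_right, map_add, ev_coeffD, ev_smul]
  simp

theorem pointAct_smul (R : L.Rep M) (x : F × E) (c : A) (m : M) :
    R.pointAct x (c • m) = c • R.pointAct x m + L.pointAnchor x c • m := by
  have h := congrArg (ev1 x.1) (R.act_op x.2 (Polynomial.C c) m)
  rw [DiffModule.op_C, opShift_C, opVec_C, map_add, ev_coeffMul, ev_mulVec] at h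
  exact h

/-- The case `a(∂) = ∂` of the axiom; the term containing `φ 1` is zero. -/
theorem IsConformalDerivation.map_deriv {φ : A →ₗ[F] LPoly F Unit A}
    (h : IsConformalDerivation δ φ) (c : A) :
    φ (δ c) = coeffD Unit (δ : A →ₗ[F] A) (φ c) + lam F • φ c := by
  have h1 := h (Polynomial.X) c
  have hc : ∀ f : LPoly F Unit A, coeffMul (A := A) 1 f = f := fun f => by
    have : Algebra.lsmul F F A (1 : A) = LinearMap.id := by ext; simp
    rw [coeffMul, this, LinearMap.lTensor_id, LinearMap.id_apply]
  rw [opVec, opShift, Polynomial.sum_X_index (by simp), Polynomial.sum_X_index (by simp),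
    Polynomial.sum_X_index (by simp [coeffMul]), h.map_one, hc] at h1
  simpa using h1

theorem pointAnchor_deriv (L : LieConformalAlgebroid δ E) (x : F × E) (c : A) :
    L.pointAnchor x (δ c) = δ (L.pointAnchor x c) + x.1 • L.pointAnchor x c := by
  have h := congrArg (ev1 x.1) ((L.anchor_derivation x.2).map_deriv c)
  rw [map_add, ev_coeffD, ev_smul] at h
  simpa [LieConformalAlgebroid.pointAnchor] using h

/-- The action of `u_r` on `M` is a derivation over `θ(u)_r`, and `θ(u)_r p(∂) = p(∂ + r) θ(u)_r`.
This is the source of the translation by `r` in the second term. -/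
theorem pointAct_derivEval (R : L.Rep M) (x : F × E) (c : A) (f : Polynomial F ⊗[F] M) :
    R.pointAct x (derivEval δ c f) =
      derivEval δ c ((R.pointAct x).lTensor (Polynomial F) f) +
        derivEval δ (L.pointAnchor x c) (translate x.1 f) := by
  have hX : ∀ (p : Polynomial F) (c : A),
      (Polynomial.aeval (δ : A →ₗ[F] A) : Polynomial F →ₐ[F] Module.End F A)
        (p * Polynomial.X) c =
      (Polynomial.aeval (δ : A →ₗ[F] A) : Polynomial F →ₐ[F] Module.End F A) p (δ c) := by
    intro p c
    rw [map_mul, Polynomial.aeval_X]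
    rfl
  have hC : ∀ (p : Polynomial F) (r : F) (c : A),
      (Polynomial.aeval (δ : A →ₗ[F] A) : Polynomial F →ₐ[F] Module.End F A)
        (p * Polynomial.C r) c =
      r • (Polynomial.aeval (δ : A →ₗ[F] A) : Polynomial F →ₐ[F] Module.End F A) p c := by
    intro p r c
    rw [map_mul, Polynomial.aeval_C, Module.End.mul_apply, Module.algebraMap_end_apply, map_smul]
  have h : ∀ (p : Polynomial F) (c : A), L.pointAnchor x
      ((Polynomial.aeval (δ : A →ₗ[F] A) : Polynomial F →ₐ[F] Module.End F A) p c) =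
      (Polynomial.aeval (δ : A →ₗ[F] A) : Polynomial F →ₐ[F] Module.End F A)
        (p.comp (Polynomial.X + Polynomial.C x.1)) (L.pointAnchor x c) := by
    intro p
    induction p using Polynomial.induction_on with
    | C a => intro c; simp
    | add p q hp hq => intro c; simp only [map_add, LinearMap.add_apply, hp, hq, Polynomial.add_comp]
    | monomial n a ih =>
      intro c
      rw [pow_succ, ← mul_assoc, hX, ih, Polynomial.mul_comp (Polynomial.C a * Polynomial.X ^ n),
        Polynomial.X_comp, mul_add, map_add,
        LinearMap.add_apply, hX, hC, pointAnchor_deriv, map_add, map_smul]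
  induction f using TensorProduct.induction_on with
  | zero => simp
  | add x y hx hy => simp only [map_add, hx, hy]; abel
  | tmul p m => rw [derivEval_tmul, pointAct_smul, h, LinearMap.lTensor_tmul, derivEval_tmul,
      translate_tmul, derivEval_tmul]

theorem pointAct_smul_left (R : L.Rep M) (s : F) (c : A) (u : E) (m : M) :
    R.pointAct (s, c • u) m = derivEval δ c (translate s (line () (fun _ => 0) (R.act u m))) := by
  have h := congrArg (ev1 s) (R.op_act (Polynomial.C c) u m)
  rw [DiffModule.op_C, ev_adjMul_C] at h
  rw [translate_line]
  have hs : Function.update (fun _ : Unit => (0 : F)) () (0 + s) = fun _ => s := by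
    ext
    simp
  rw [hs]
  exact h

theorem pointAct_D_left [Infinite F] (R : L.Rep M) (s : F) (u : E) (m : M) :
    R.pointAct (s, L.D u) m = -(s • R.pointAct (s, u) m) := by
  have h := congrArg (ev1 s) (R.op_act Polynomial.X u m)
  rw [DiffModule.op_X, adjMul_X, map_neg, ev_smul, MvPolynomial.eval_X] at h
  exact h

/-- Under `h` the operator `D` becomes the scalar `-q`, so the substitution `λ ↦ -λ - ∂`, taken at
`λ = s`, amounts to evaluation at `-s + q`. -/
theorem map_substD_eval (D : E →ₗ[F] E) (q s : F) (h : E →ₗ[F] M)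
    (hD : ∀ v, h (D v) = -(q • h v)) (f : LPoly F Unit E) :
    h (ev1 s (substD D (MvPolynomial.aeval fun _ => -Polynomial.C (lam F) - Polynomial.X) f)) =
      h (ev1 (q - s) f) := by
  have h1 : ∀ (p : MvPolynomial Unit F) (y : LPoly F Unit E),
      h (ev1 s (Polynomial.aeval (coeffD Unit D) ((MvPolynomial.aeval fun _ : Unit =>
        (-Polynomial.C (lam F) - Polynomial.X : Polynomial (MvPolynomial Unit F))) p) y)) =
      MvPolynomial.eval (fun _ => q - s) p • h (ev1 s y) := by
    intro p
    induction p using MvPolynomial.induction_on with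
    | C a =>
      intro y
      simp [Polynomial.aeval_C, ev_smul, MvPolynomial.algebraMap_eq]
    | add p q hp hq => intro y; simp only [map_add, LinearMap.add_apply, hp, hq, add_smul]
    | mul_X p j hp =>
      intro y
      simp only [map_mul, Module.End.mul_apply, hp, mul_smul]
      congr 1
      simp [ev_smul, ev_coeffD, hD, sub_smul]
      abel
  induction f using TensorProduct.induction_on with
  | zero => simp
  | add x y hx hy => simp only [map_add, hx, hy]
  | tmul p m =>
    refine (h1 p _).trans ?_
    rw [ev_const, ev_tmul, map_smul]

/-- The functions `h(s, v)` of `s ∈ F` and `v ∈ E` which are linear in `v` and have the dependence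
on `s` prescribed by sesquilinearity over differential operators. -/
def sesquilinear (M : Type uM) [AddCommGroup M] [Module F M] [Module A M] [IsScalarTower F A M]
    (X : DiffModule δ E) : AddSubgroup (F × E → M) where
  carrier := {h | (∀ s, IsLinearMap F fun v => h (s, v)) ∧
    (∀ s v, h (s, X.D v) = -(s • h (s, v))) ∧
    ∀ v, ∃ f, ∀ s (c : A), h (s, c • v) = derivEval δ c (translate s f)}
  zero_mem' := ⟨fun s => (0 : E →ₗ[F] M).isLinear, fun s v => by simp,
    fun v => ⟨0, fun s c => by simp⟩⟩
  add_mem' := by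
    rintro g h ⟨g1, g2, g3⟩ ⟨h1, h2, h3⟩
    refine ⟨fun s => ((g1 s).mk' _ + (h1 s).mk' _).isLinear, fun s v => ?_, fun v => ?_⟩
    · simp only [Pi.add_apply, g2, h2, smul_add, neg_add]
    · obtain ⟨a, ha⟩ := g3 v
      obtain ⟨b, hb⟩ := h3 v
      exact ⟨a + b, fun s c => by simp only [Pi.add_apply, ha, hb, map_add]⟩
  neg_mem' := by
    rintro h ⟨h1, h2, h3⟩
    refine ⟨fun s => (-(h1 s).mk' _).isLinear, fun s v => ?_, fun v => ?_⟩
    · simp only [Pi.neg_apply, h2, smul_neg]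
    · obtain ⟨b, hb⟩ := h3 v
      exact ⟨-b, fun s c => by simp only [Pi.neg_apply, hb, map_neg]⟩

theorem pointAct_mem_sesquilinear [Infinite F] (R : L.Rep M) (m : M) :
    (fun z => R.pointAct z m) ∈ sesquilinear M L.toDiffModule :=
  ⟨fun s => ((ev1 s ∘ₗ R.act.flip m : E →ₗ[F] M)).isLinear, fun s v => pointAct_D_left R s v m,
    fun v => ⟨_, fun s c => pointAct_smul_left R s c v m⟩⟩

/-- Both `x · h(s, c v)` and `h([x, (s, c v)])` produce an extra term with `θ(x)(c)`, one from the
action and one from the bracket. Both are translated by `x.1 + s`, so they cancel. -/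
theorem sesquilinear_lie (R : L.Rep M) {h : F × E → M} (hh : h ∈ sesquilinear M L.toDiffModule)
    (x : F × E) : (fun z => R.pointAct x (h z) - h (L.pointBracket x z)) ∈
      sesquilinear M L.toDiffModule := by
  obtain ⟨h1, h2, h3⟩ := hh
  refine ⟨fun s => ((R.pointAct x ∘ₗ (h1 s).mk' _ -
    (h1 (x.1 + s)).mk' _ ∘ₗ ev1 x.1 ∘ₗ L.bracket x.2 : E →ₗ[F] M)).isLinear, fun s v => ?_,
    fun v => ?_⟩
  · simp only [LieConformalAlgebroid.pointBracket, bracket_D_eval]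
    rw [(h1 (x.1 + s)).map_add, (h1 (x.1 + s)).map_smul, h2, h2, map_neg, map_smul]
    module
  · obtain ⟨f, hf⟩ := h3 v
    obtain ⟨g, hg⟩ := h3 (ev1 x.1 (L.bracket x.2 v))
    -- This is what multiplies `c` once the terms with `θ(x)(c)` are gone; `g` is translated because
    -- the bracket sits at parameter `x.1 + s`.
    refine ⟨(R.pointAct x).lTensor (Polynomial F) f - translate x.1 g, fun s c => ?_⟩
    simp only [LieConformalAlgebroid.pointBracket, bracket_smul_eval]
    rw [(h1 (x.1 + s)).map_add, hf, hg, hf, pointAct_derivEval, map_sub, map_sub,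
      lTensor_translate, translate_translate, translate_translate, add_comm s]
    abel

/-- `A` and `∂` generate `A[∂]`, and `a^*` decomposes in the same way by `adjMul_eq_sum`. -/
theorem map_op_of_generators {X : DiffModule δ E} {σ : Type*} [DecidableEq σ] {i : σ}
    {ψ : E →ₗ[F] LPoly F σ M}
    (hD : ∀ v, ψ (X.D v) = -(MvPolynomial.X i : MvPolynomial σ F) • ψ v)
    (hC : ∀ (c : A) v, ψ (c • v) = adjMul δ i (Polynomial.C c) (ψ v)) (a : Polynomial A) (v : E) :
    ψ (X.op a v) = adjMul δ i a (ψ v) := by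
  have hpow : ∀ n, ψ ((X.D ^ n) v) = (-(MvPolynomial.X i : MvPolynomial σ F)) ^ n • ψ v := by
    intro n
    induction n with
    | zero => simp
    | succ n ih => rw [pow_succ', Module.End.mul_apply, hD, ih, pow_succ', mul_smul]
  rw [adjMul_eq_sum, DiffModule.op, Polynomial.sum_def, Polynomial.sum_def, map_sum]
  refine Finset.sum_congr rfl fun n _ => ?_
  rw [hC, hpow]

theorem adjMul_iff_sesquilinear [Infinite F] (X : DiffModule δ E) {σ : Type*} [DecidableEq σ]
    (i : σ) (ψ : E →ₗ[F] LPoly F σ M) :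
    (∀ (a : Polynomial A) v, ψ (X.op a v) = adjMul δ i a (ψ v)) ↔
      ∀ t : σ → F, (fun z : F × E => ev (Function.update t i z.1) (ψ z.2)) ∈
        sesquilinear M X := by
  constructor
  · intro h t
    refine ⟨fun s => (ev (Function.update t i s) ∘ₗ ψ).isLinear, fun s v => ?_, fun v =>
      -- The base point has `i`-th coordinate `0`, so that translation by `s` puts the parameter at
      -- `s`.
      ⟨line i (Function.update t i 0) (ψ v), fun s c => ?_⟩⟩
    · simp only
      rw [← X.op_X, h, adjMul_X, map_neg, ev_smul]
      simp
    · simp only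
      rw [← X.op_C, h, ev_adjMul_C, translate_line]
      simp
  · intro h
    have hD : ∀ v, ψ (X.D v) = -(MvPolynomial.X i : MvPolynomial σ F) • ψ v := by
      intro v
      refine ev_ext fun t => ?_
      have := (h t).2.1 (t i) v
      simp only [Function.update_eq_self] at this
      rw [this, ev_smul]
      simp
    have hC : ∀ (c : A) v, ψ (c • v) = adjMul δ i (Polynomial.C c) (ψ v) := by
      intro c v
      refine ev_ext fun t => ?_
      obtain ⟨f, hf⟩ := (h t).2.2 v
      -- The polynomial `f` is only known to exist, but the case `c = 1` prescribes all its values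
      -- and thus identifies it.
      have hf' : f = line i (Function.update t i 0) (ψ v) := by
        refine derivEval_translate_ext δ fun s => ?_
        rw [← hf, translate_line, derivEval_one_line]
        simp
      have := hf (t i) c
      simp only [Function.update_eq_self] at this
      rw [this, hf', translate_line, ev_adjMul_C]
      simp
    exact map_op_of_generators hD hC

end Points

/-! ### The basic complex -/

section BasicComplex

variable {F : Type uF} [Field F] {A : Type uA} [CommRing A] [Algebra F A]
variable {δ : Derivation F A A}
variable {E : Type uE} [AddCommGroup E] [Module F E] [Module A E] [IsScalarTower F A E]
variable {L : LieConformalAlgebroid δ E}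
variable {M : Type uM} [AddCommGroup M] [Module F M] [Module A M] [IsScalarTower F A M]

/-- The function `((t_1, u_1), ..., (t_k, u_k)) ↦ φ_{t_1, ..., t_k}(u_1, ..., u_k)`. -/
def pointCochain {k : ℕ} (φ : Multi F E k (LPoly F (Fin k) M)) (g : Fin k → F × E) : M :=
  ev (fun i => (g i).1) (φ fun i => (g i).2)

theorem pointCochain_apply {k : ℕ} (φ : Multi F E k (LPoly F (Fin k) M)) (t : Fin k → F)
    (u : Fin k → E) : pointCochain φ (fun i => (t i, u i)) = ev t (φ u) := rfl

theorem pointCochain_cons {k : ℕ} (φ : Multi F E (k + 1) (LPoly F (Fin (k + 1)) M)) (x : F × E)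
    (g : Fin k → F × E) : pointCochain φ (Fin.cons x g) =
      ev (Fin.cons x.1 fun i => (g i).1) (φ (Fin.cons x.2 fun i => (g i).2)) := by
  rw [pointCochain]
  congr 2
  · ext i
    cases i using Fin.cases <;> simp
  · ext i
    cases i using Fin.cases <;> simp

theorem pointCochain_update {k : ℕ} (φ : Multi F E k (LPoly F (Fin k) M)) (g : Fin k → F × E)
    (i : Fin k) (x : F × E) : pointCochain φ (Function.update g i x) =
      ev (Function.update (fun i => (g i).1) i x.1)
        (φ (Function.update (fun i => (g i).2) i x.2)) := by
  rw [pointCochain]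
  congr 2
  · ext j
    by_cases h : j = i
    · subst h; simp
    · simp [h]
  · ext j
    by_cases h : j = i
    · subst h; simp
    · simp [h]

theorem ev_actIns (R : L.Rep M) {k : ℕ} (i : Fin (k + 1)) (u : E) (f : LPoly F (Fin k) M)
    (t : Fin (k + 1) → F) :
    ev t (R.actIns i u f) = R.pointAct (t i, u) (ev (fun r => t (i.succAbove r)) f) := by
  rw [R.actIns_apply, ev_actAt, ev_subst]
  simp [LieConformalAlgebroid.Rep.pointAct]

theorem ev_firstSlot {n : ℕ} {N : Type*} [AddCommGroup N] [Module F N]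
    (m : N →ₗ[F] LPoly F (Fin (n + 2)) M) (φ : Multi F E (n + 1) N)
    (x : LPoly F (Fin (n + 2)) E) (u : Fin n → E) (t : Fin (n + 2) → F) :
    ev t (firstSlot (MvPolynomial (Fin (n + 2)) F) m φ x u) = ev t (m (φ (Fin.cons (ev t x) u))) := by
  have h : ∀ v, φ (Fin.cons v u) = φ.curryLeft v u := fun v => rfl
  simp only [h]
  induction x using TensorProduct.induction_on with
  | zero => simp
  | add x y hx hy => simp only [map_add, add_apply, hx, hy]
  | tmul p v => simp [ev_smul]

theorem pointCochain_diffAct (R : L.Rep M) {k : ℕ} (φ : Multi F E k (LPoly F (Fin k) M)) :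
    pointCochain (diffAct (fun i => R.actIns i) φ) = actSum R.pointAct (pointCochain φ) := by
  ext g
  rw [pointCochain, diffAct_apply, map_sum]
  refine Finset.sum_congr rfl fun i _ => ?_
  rw [map_smul, ev_actIns]
  rfl

theorem pointCochain_diffBracket (L : LieConformalAlgebroid δ E) {n : ℕ}
    (φ : Multi F E (n + 1) (LPoly F (Fin (n + 1)) M)) :
    pointCochain (diffBracket L.bracket (fun i j => merge i j) φ) =
      bracketSum F L.pointBracket (pointCochain φ) := by
  ext g
  rw [pointCochain, diffBracket_apply, map_sum]
  refine Finset.sum_congr rfl fun i _ => ?_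
  rw [map_sum]
  refine Finset.sum_congr rfl fun j _ => ?_
  rw [map_smul, ev_firstSlot, ev_merge, ev_evalAt, pointCochain_cons, MvPolynomial.eval_X]
  rfl

theorem pointCochain_injective [Infinite F] {k : ℕ} {φ ψ : Multi F E k (LPoly F (Fin k) M)}
    (h : pointCochain φ = pointCochain ψ) : φ = ψ := by
  ext u
  refine ev_ext fun t => ?_
  rw [← pointCochain_apply, ← pointCochain_apply, h]

theorem isSkew_pointCochain_iff [Infinite F] {k : ℕ} (φ : Multi F E k (LPoly F (Fin k) M)) :
    IsSkew (pointCochain φ) ↔ ∀ (π : Equiv.Perm (Fin k)) (u : Fin k → E),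
      φ u = (Equiv.Perm.sign π : ℤ) • perm π (φ (u ∘ π)) := by
  have hs : ∀ π : Equiv.Perm (Fin k), (Equiv.Perm.sign π : ℤ) * (Equiv.Perm.sign π : ℤ) = 1 := by
    intro π
    rw [← Units.val_mul, Int.units_mul_self, Units.val_one]
  constructor
  · intro h π u
    refine ev_ext fun t => ?_
    have := h π fun i => (t i, u i)
    rw [map_zsmul, ev_perm]
    change _ = (Equiv.Perm.sign π : ℤ) • pointCochain φ ((fun i => (t i, u i)) ∘ π)
    rw [this, smul_smul, hs, one_smul]
    rfl
  · intro h π g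
    rw [pointCochain, pointCochain, h π fun i => (g i).2, map_zsmul, ev_perm, smul_smul, hs,
      one_smul]
    rfl

/-- The three iterated brackets have the same parameter `x.1 + y.1 + z.1`. At this fixed parameter
the slot is linear in `E`, so the Jacobi identity can be applied inside it. -/
theorem slotLeibniz_pointCochain (L : LieConformalAlgebroid δ E) {k : ℕ}
    (φ : Multi F E k (LPoly F (Fin k) M)) : SlotLeibniz L.pointBracket (pointCochain φ) := by
  intro i g x y z
  simp only [pointCochain_update, LieConformalAlgebroid.pointBracket]
  rw [← pointBracket_leibniz, MultilinearMap.map_update_sub, map_sub,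
    add_left_comm y.1, add_assoc]

variable (X : DiffModule δ E)

/-- The sesquilinearity of basic cochains in each argument. -/
def IsSesquilinear {k : ℕ} (φ : Multi F E k (LPoly F (Fin k) M)) (i : Fin k) : Prop :=
  ∀ (u : Fin k → E) (a : Polynomial A),
    φ (Function.update u i (X.op a (u i))) = adjMul δ i a (φ u)

variable {X}

theorem isSesquilinear_iff [Infinite F] {k : ℕ} {φ : Multi F E k (LPoly F (Fin k) M)} {i : Fin k} :
    IsSesquilinear X φ i ↔ ∀ g : Fin k → F × E,
      (fun z => pointCochain φ (Function.update g i z)) ∈ sesquilinear M X := by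
  have h1 : IsSesquilinear X φ i ↔ ∀ (u : Fin k → E) (a : Polynomial A) (v : E),
      φ.toLinearMap u i (X.op a v) = adjMul δ i a (φ.toLinearMap u i v) := by
    constructor
    · intro h u a v
      have := h (Function.update u i v) a
      simpa using this
    · intro h u a
      have := h u a (u i)
      simpa using this
  have h2 : ∀ u, (∀ (a : Polynomial A) (v : E),
      φ.toLinearMap u i (X.op a v) = adjMul δ i a (φ.toLinearMap u i v)) ↔ _ :=
    fun u => adjMul_iff_sesquilinear X i (φ.toLinearMap u i)
  simp only [h1, h2, pointCochain_update]
  constructor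
  · intro h g
    exact h (fun i => (g i).2) fun i => (g i).1
  · intro h u t
    exact h fun i => (t i, u i)

/-- In a slot with parameter `r + s` the operator `∂` acts as `-(r + s)`, so `[v_s u] = -[u_{-s-∂}
v]` becomes `-[u_r v]`. -/
theorem IsSesquilinear.slotSkew [Infinite F] (L : LieConformalAlgebroid δ E) {k : ℕ}
    {φ : Multi F E k (LPoly F (Fin k) M)} (h : ∀ i, IsSesquilinear L.toDiffModule φ i) :
    SlotSkew L.pointBracket (pointCochain φ) := by
  intro i g x y
  obtain ⟨h1, h2, -⟩ := isSesquilinear_iff.1 (h i) g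
  have e := map_substD_eval L.D (x.1 + y.1) y.1 ((h1 (x.1 + y.1)).mk' _)
    (fun v => h2 (x.1 + y.1) v) (L.bracket x.2 y.2)
  have hneg := (h1 (x.1 + y.1)).map_neg
  simp only [IsLinearMap.mk'_apply] at e hneg
  simp only [LieConformalAlgebroid.pointBracket]
  rw [L.isLieConformalAlgebra.skew x.2 y.2, map_neg, add_comm y.1, hneg, e]
  simp

theorem lastArg_iff [Infinite F] {k : ℕ} {φ : Multi F E (k + 1) (LPoly F (Fin (k + 1)) M)} :
    LastArg (sesquilinear M X) (pointCochain φ) ↔ IsSesquilinear X φ (Fin.last k) := by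
  rw [isSesquilinear_iff]
  constructor
  · intro h g
    have := h (Fin.init g)
    rw [← Fin.snoc_init_self g]
    simpa only [Fin.update_snoc_last] using this
  · intro h u
    have := h (Fin.snoc u 0)
    simpa only [Fin.update_snoc_last] using this

theorem perm_adjMul [Infinite F] {k : ℕ} (π : Equiv.Perm (Fin k)) (i : Fin k) (a : Polynomial A)
    (f : LPoly F (Fin k) M) :
    perm π (adjMul δ i a f) = adjMul δ (π i) a (perm π f) := by
  have hl : ∀ (t : Fin k → F) (f : LPoly F (Fin k) M),
      line i (t ∘ π) f = line (π i) t (perm π f) := by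
    intro t f
    induction f using TensorProduct.induction_on with
    | zero => simp
    | add x y hx hy => simp only [map_add, hx, hy]
    | tmul p m =>
      rw [perm, subst, LinearMap.rTensor_tmul, line_tmul, line_tmul]
      simp [MvPolynomial.aeval_rename, Function.comp_def]
  rw [adjMul_eq_sum, adjMul_eq_sum, Polynomial.sum_def, Polynomial.sum_def, map_sum]
  refine Finset.sum_congr rfl fun n _ => ev_ext fun t => ?_
  rw [ev_perm, ev_adjMul_C, ev_adjMul_C, hl, perm, subst_smul]
  simp

/-- The transposition of `i` with the last place carries the condition from one slot to the other,
since permuting variables intertwines the adjoint operators. -/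
theorem isSesquilinear_of_last [Infinite F] {k : ℕ}
    {φ : Multi F E (k + 1) (LPoly F (Fin (k + 1)) M)}
    (hs : ∀ (π : Equiv.Perm (Fin (k + 1))) (u : Fin (k + 1) → E),
      φ u = (Equiv.Perm.sign π : ℤ) • perm π (φ (u ∘ π)))
    (h : IsSesquilinear X φ (Fin.last k)) (i : Fin (k + 1)) : IsSesquilinear X φ i := by
  intro u a
  set π := Equiv.swap i (Fin.last k) with hπ
  have h1 : Function.update u i (X.op a (u i)) ∘ π =
      Function.update (u ∘ π) (Fin.last k) (X.op a ((u ∘ π) (Fin.last k))) := by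
    ext r
    by_cases hr : r = Fin.last k
    · subst hr; simp [hπ]
    · have : π r ≠ i := fun e => hr (by rw [← Equiv.symm_apply_apply π r, e]; simp [hπ])
      simp [hr, this]
  rw [hs π, h1, h, perm_adjMul, hs π u, map_zsmul]
  simp [hπ]

theorem mem_cochains_iff {k : ℕ} {φ : Multi F E k (LPoly F (Fin k) M)} (R : L.Rep M) :
    φ ∈ R.basicCochains k ↔ (∀ i, IsSesquilinear L.toDiffModule φ i) ∧
      ∀ (π : Equiv.Perm (Fin k)) (u : Fin k → E),
        φ u = (Equiv.Perm.sign π : ℤ) • perm π (φ (u ∘ π)) :=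
  ⟨fun h => ⟨fun i u a => h.1 u i a, h.2⟩, fun h => ⟨fun u i a => h.1 i u a, h.2⟩⟩

theorem pointCochain_basicDiff [Infinite F] (R : L.Rep M) {k : ℕ}
    {φ : Multi F E k (LPoly F (Fin k) M)} (h : IsSkew (pointCochain φ)) :
    pointCochain (R.basicDiff k φ) = leibnizD L.pointBracket R.pointAct k (pointCochain φ) := by
  cases k with
  | zero =>
    rw [leibnizD_zero_eq]
    exact pointCochain_diffAct R φ
  | succ n =>
    rw [leibnizD_succ_eq h, ← pointCochain_diffAct, ← pointCochain_diffBracket]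
    ext g
    exact map_add (ev fun i => (g i).1) _ _

/-- Skew-symmetry of `dφ` comes first: it reduces sesquilinearity to the last slot, and it permits
the identification of the second differential with `leibnizD` as well. -/
theorem isComplex_basic [Infinite F] (R : L.Rep M) : IsComplex R.basicDiff R.basicCochains := by
  intro k φ hφ
  obtain ⟨h1, h2⟩ := (mem_cochains_iff R).1 hφ
  have hskew := (isSkew_pointCochain_iff φ).2 h2
  have hskew' : IsSkew (pointCochain (R.basicDiff k φ)) := by
    rw [pointCochain_basicDiff R hskew]
    exact hskew.leibnizD (IsSesquilinear.slotSkew L h1)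
  have hperm := (isSkew_pointCochain_iff _).1 hskew'
  refine ⟨(mem_cochains_iff R).2 ⟨isSesquilinear_of_last hperm (lastArg_iff.1 ?_), hperm⟩, ?_⟩
  · rw [pointCochain_basicDiff R hskew]
    cases k with
    | zero => exact LastArg.leibnizD_zero (pointAct_mem_sesquilinear R) _
    | succ k =>
      exact LastArg.leibnizD_succ (pointAct_mem_sesquilinear R)
        (fun f hf x => sesquilinear_lie R hf x) (lastArg_iff.2 (h1 _))
  · apply pointCochain_injective
    rw [pointCochain_basicDiff R hskew', pointCochain_basicDiff R hskew,
      leibnizD_leibnizD (pointAct_pointBracket R) (slotLeibniz_pointCochain L φ)]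
    ext g
    simp [pointCochain]

end BasicComplex

/-! ### The action of `∂` on basic cochains -/

section Total

variable {F : Type uF} [Field F] {M : Type uM} [AddCommGroup M] [Module F M]

/-- The coefficient of `x ^ n` in an element of `F[x] ⊗ M`. -/
def lineCoeff (n : ℕ) : Polynomial F ⊗[F] M →ₗ[F] M :=
  TensorProduct.lid F M ∘ₗ LinearMap.rTensor M (Polynomial.lcoeff F n)

theorem lineCoeff_tmul (n : ℕ) (p : Polynomial F) (m : M) :
    lineCoeff n (p ⊗ₜ[F] m) = p.coeff n • m := by
  simp [lineCoeff]

theorem exists_lineCoeff_eq_zero (f : Polynomial F ⊗[F] M) :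
    ∃ N, ∀ n, N ≤ n → lineCoeff n f = 0 := by
  induction f using TensorProduct.induction_on with
  | zero => exact ⟨0, by simp⟩
  | add x y hx hy =>
    obtain ⟨a, ha⟩ := hx
    obtain ⟨b, hb⟩ := hy
    exact ⟨max a b, fun n hn => by
      rw [map_add, ha n (le_trans (le_max_left _ _) hn), hb n (le_trans (le_max_right _ _) hn),
        add_zero]⟩
  | tmul p m =>
    exact ⟨p.natDegree + 1, fun n hn => by
      rw [lineCoeff_tmul, Polynomial.coeff_eq_zero_of_natDegree_lt hn, zero_smul]⟩

/-- On the line `∑ λ_s` restricts to `∑ t_s + x`, and multiplication by `x` raises the degree by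
one. -/
theorem lineCoeff_line_total {σ : Type*} [Fintype σ] [DecidableEq σ] (D : M →ₗ[F] M) (i : σ)
    (t : σ → F) (f : LPoly F σ M) (n : ℕ) :
    lineCoeff (n + 1) (line i t (total σ D f)) =
      D (lineCoeff (n + 1) (line i t f)) + (∑ s, t s) • lineCoeff (n + 1) (line i t f) +
        lineCoeff n (line i t f) := by
  induction f using TensorProduct.induction_on with
  | zero => simp
  | add x y hx hy => simp only [map_add, hx, hy, smul_add]; abel
  | tmul p m =>
    have h : (MvPolynomial.aeval fun j =>
        (Polynomial.C (t j) + if j = i then Polynomial.X else 0 : Polynomial F))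
          (∑ s, MvPolynomial.X s : MvPolynomial σ F) =
        Polynomial.C (∑ s, t s) + Polynomial.X := by
      simp [Finset.sum_add_distrib]
    rw [total_tmul, map_add, line_tmul, line_tmul, line_tmul, map_mul, h, map_add]
    simp only [lineCoeff_tmul]
    rw [map_smul, add_mul, Polynomial.coeff_add,
      Polynomial.coeff_C_mul, Polynomial.coeff_X_mul, add_smul, smul_smul, add_assoc]

/-- If `(∂ + ∑ λ_s) f = 0`, then on each line in direction `i` the coefficient of `x ^ n` is
determined by that of `x ^ (n + 1)`. High coefficients vanish, hence all do. Without variables the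
operator would be `D` itself, which is why `σ` is nonempty. -/
theorem total_injective [Infinite F] {σ : Type*} [Fintype σ] [Nonempty σ] (D : M →ₗ[F] M) :
    Function.Injective (total σ D) := by
  classical
  rw [injective_iff_map_eq_zero]
  intro f hf
  obtain ⟨i⟩ := ‹Nonempty σ›
  refine ev_ext fun t => ?_
  obtain ⟨N, hN⟩ := exists_lineCoeff_eq_zero (line i t f)
  -- Descending induction on `n`, with `m` bounding the distance to the degree `N` beyond which
  -- nothing remains.
  have h : ∀ m n, N ≤ n + m → lineCoeff n (line i t f) = 0 := by
    intro m
    induction m with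
    | zero => exact fun n => hN n
    | succ m ih =>
      intro n hn
      have := lineCoeff_line_total D i t f n
      rw [hf, ih (n + 1) (by omega)] at this
      simpa using this.symm
  have h0 : ∀ g : LPoly F σ M, lineCoeff 0 (line i t g) = ev t g := by
    intro g
    induction g using TensorProduct.induction_on with
    | zero => simp
    | add x y hx hy => simp only [map_add, hx, hy]
    | tmul p m =>
      rw [line_tmul, lineCoeff_tmul, ev_tmul]
      congr 1
      induction p using MvPolynomial.induction_on with
      | C a => simp
      | add p q hp hq => simp only [map_add, Polynomial.coeff_add, hp, hq]
      | mul_X p j hp =>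
        rw [map_mul, Polynomial.mul_coeff_zero, hp, map_mul]
        by_cases hj : j = i <;> simp [hj]
  rw [← h0, h N 0 (by omega), map_zero]

/-- Over a field `f` has a linear section on its range, and composing with it preserves
multilinearity. -/
theorem exists_lift {ι E N N' : Type*} [AddCommGroup E] [Module F E] [AddCommGroup N] [Module F N]
    [AddCommGroup N'] [Module F N'] (f : N →ₗ[F] N') (φ : MultilinearMap F (fun _ : ι => E) N')
    (h : ∀ u, ∃ v, f v = φ u) :
    ∃ ψ : MultilinearMap F (fun _ : ι => E) N, f.compMultilinearMap ψ = φ := by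
  obtain ⟨s, hs⟩ := f.rangeRestrict.exists_rightInverse_of_surjective
    (LinearMap.range_rangeRestrict f)
  refine ⟨s.compMultilinearMap (φ.codRestrict (LinearMap.range f) h), ?_⟩
  ext u
  exact congrArg Subtype.val (LinearMap.congr_fun hs ⟨φ u, h u⟩)

end Total

/-! ### The kernel of `p_*` -/

section PartialComplex

variable {F : Type uF} [Field F] {A : Type uA} [CommRing A] [Algebra F A]
variable {δ : Derivation F A A}
variable {E : Type uE} [AddCommGroup E] [Module F E] [Module A E] [IsScalarTower F A E]
variable {L : LieConformalAlgebroid δ E}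
variable {M : Type uM} [AddCommGroup M] [Module F M] [Module A M] [IsScalarTower F A M]

theorem partialMap_injective [Infinite F] (R : L.Rep M) (k : ℕ) :
    Function.Injective (R.partialMap (k + 1)) := by
  intro φ ψ h
  ext u
  exact total_injective R.D (congrArg (fun χ => χ u) h)

theorem pStar_partialMap (R : L.Rep M) (k : ℕ) (φ : Multi F E k (R.BasicTarget k)) :
    R.pStar k (R.partialMap k φ) = 0 := by
  ext u
  exact (Submodule.Quotient.mk_eq_zero _).2 ⟨φ u, rfl⟩

/-- The operator `∂ + ∑ λ_i` commutes with the operators in both cochain conditions and is injective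
in positive degree, so it can be cancelled. In degree `0` the conditions are vacuous. -/
theorem mem_basicCochains_of_partialMap [Infinite F] (R : L.Rep M) (k : ℕ)
    {φ : Multi F E k (R.BasicTarget k)} (h : R.partialMap k φ ∈ R.basicCochains k) :
    φ ∈ R.basicCochains k := by
  cases k with
  | zero =>
    refine ⟨fun u i => i.elim0, fun π u => ?_⟩
    have : u ∘ π = u := Subsingleton.elim _ _
    rw [this, Subsingleton.elim π 1]
    simp [perm, subst]
  | succ k =>
    refine ⟨fun u i a => total_injective R.D ?_, fun π u => total_injective R.D ?_⟩
    · rw [← adjMul_total R.toDiffModule]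
      exact h.1 u i a
    · rw [map_zsmul, ← perm_total]
      exact h.2 π u

theorem exists_partialMap_eq [Infinite F] (R : L.Rep M) (k : ℕ)
    {φ : Multi F E k (R.BasicTarget k)} (h : φ ∈ R.basicCochains k) (h0 : R.pStar k φ = 0) :
    ∃ ψ ∈ R.basicCochains k, R.partialMap k ψ = φ := by
  obtain ⟨ψ, e⟩ := exists_lift ((total (Fin k) R.D).restrictScalars F) φ fun u =>
    (Submodule.Quotient.mk_eq_zero _).1 (congrArg (fun χ => χ u) h0)
  have e' : R.partialMap k ψ = φ := e
  exact ⟨ψ, mem_basicCochains_of_partialMap R k (by rw [e']; exact h), e'⟩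

end PartialComplex

/-! ### Lifting cochains -/

/-! ### Commutation relations of the adjoint operators -/

section AdjMul

variable {F : Type uF} [Field F] {A : Type uA} [CommRing A] [Algebra F A] {σ : Type*}
variable [DecidableEq σ] {δ : Derivation F A A}
variable {M : Type uM} [AddCommGroup M] [Module F M]

theorem lpoly_induction {p : LPoly F σ M → Prop} (hc : ∀ m, p (const σ m))
    (hadd : ∀ x y, p x → p y → p (x + y))
    (hX : ∀ (s : σ) x, p x → p ((MvPolynomial.X s : MvPolynomial σ F) • x)) (x : LPoly F σ M) :
    p x := by
  induction x using TensorProduct.induction_on with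
  | zero => simpa using hc 0
  | add x y hx hy => exact hadd x y hx hy
  | tmul q m =>
    induction q using MvPolynomial.induction_on with
    | C a =>
      have := hc (a • m)
      rwa [const, TensorProduct.mk_apply, TensorProduct.tmul_smul, TensorProduct.smul_tmul',
        ← MvPolynomial.C_1, MvPolynomial.smul_eq_C_mul, ← map_mul, mul_one] at this
    | add q r hq hr => rw [TensorProduct.add_tmul]; exact hadd _ _ hq hr
    | mul_X q s hq =>
      have := hX s _ hq
      rwa [TensorProduct.smul_tmul', smul_eq_mul, mul_comm] at this

variable [Module A M] [IsScalarTower F A M]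

theorem adjMul_C_const (i : σ) (c : A) (m : M) :
    adjMul δ i (Polynomial.C c) (const σ m) = const σ (c • m) := by
  have : const (F := F) σ m = 1 ⊗ₜ[F] m := rfl
  rw [adjMul, adjSymbol_C, this, shiftMul_tmul, map_one, map_one]
  simp [mulVec, const]

theorem adjMul_C_add (i : σ) (c c' : A) (x : LPoly F σ M) :
    adjMul δ i (Polynomial.C (c + c')) x =
      adjMul δ i (Polynomial.C c) x + adjMul δ i (Polynomial.C c') x := by
  simp only [adjMul, adjSymbol_C, LinearMap.map_add]
  induction x using TensorProduct.induction_on with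
  | zero => simp
  | add x y hx hy => simp only [map_add, hx, hy]; abel
  | tmul p m => simp only [shiftMul_tmul, map_add]

theorem adjMul_C_smul (i : σ) (r : F) (c : A) (x : LPoly F σ M) :
    adjMul δ i (Polynomial.C (r • c)) x = r • adjMul δ i (Polynomial.C c) x := by
  simp only [adjMul, adjSymbol_C, map_smul]
  induction x using TensorProduct.induction_on with
  | zero => simp
  | add x y hx hy => simp only [map_add, hx, hy, smul_add]
  | tmul p m => simp only [shiftMul_tmul, LinearMap.map_smul_of_tower, map_smul]

/-- The variable `λ_i` enters as `λ_i + ∂` acting on `c`, which produces the derivative term. -/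
theorem adjMul_C_X_self (i : σ) (c : A) (x : LPoly F σ M) :
    adjMul δ i (Polynomial.C c) ((MvPolynomial.X i : MvPolynomial σ F) • x) =
      (MvPolynomial.X i : MvPolynomial σ F) • adjMul δ i (Polynomial.C c) x +
        adjMul δ i (Polynomial.C (δ c)) x := by
  simp only [adjMul, adjSymbol_C]
  induction x using TensorProduct.induction_on with
  | zero => simp
  | add x y hx hy => simp only [map_add, smul_add, hx, hy]; abel
  | tmul p m =>
    rw [TensorProduct.smul_tmul', smul_eq_mul, mul_comm, shiftMul_tmul, shiftMul_tmul,
      shiftMul_tmul, map_mul, map_mul, Module.End.mul_apply, ← mulVec_smul, ← map_add,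
      ← LinearMap.map_smul, ← map_add]
    congr 2
    simp [shift, const, coeffD, add_comm]

theorem adjMul_C_X_of_ne {i j : σ} (h : j ≠ i) (c : A) (x : LPoly F σ M) :
    adjMul δ i (Polynomial.C c) ((MvPolynomial.X j : MvPolynomial σ F) • x) =
      (MvPolynomial.X j : MvPolynomial σ F) • adjMul δ i (Polynomial.C c) x := by
  simp only [adjMul, adjSymbol_C]
  induction x using TensorProduct.induction_on with
  | zero => simp
  | add x y hx hy => simp only [map_add, smul_add, hx, hy]
  | tmul p m =>
    rw [TensorProduct.smul_tmul', smul_eq_mul, mul_comm, shiftMul_tmul, shiftMul_tmul,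
      map_mul, map_mul, Module.End.mul_apply, ← mulVec_smul, ← LinearMap.map_smul]
    congr 2
    simp [shift, h]

theorem adjMul_C_mul (i : σ) (c c' : A) (x : LPoly F σ M) :
    adjMul δ i (Polynomial.C (c * c')) x =
      adjMul δ i (Polynomial.C c) (adjMul δ i (Polynomial.C c') x) := by
  -- The inductive step at `λ_i` differentiates the coefficients, so the hypothesis is also needed
  -- for `δ c` and `δ c'`.
  induction x using lpoly_induction generalizing c c' with
  | hc m => simp only [adjMul_C_const, mul_smul]
  | hadd x y hx hy => simp only [map_add, hx, hy]
  | hX s x hx =>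
    by_cases h : s = i
    · subst h
      simp only [adjMul_C_X_self, LinearMap.map_add, hx, Derivation.leibniz, smul_eq_mul, adjMul_C_add,
        mul_comm c' (δ c)]
      abel
    · simp only [adjMul_C_X_of_ne h, hx]

theorem adjMul_C_comm {i j : σ} (h : i ≠ j) (c c' : A) (x : LPoly F σ M) :
    adjMul δ i (Polynomial.C c) (adjMul δ j (Polynomial.C c') x) =
      adjMul δ j (Polynomial.C c') (adjMul δ i (Polynomial.C c) x) := by
  induction x using lpoly_induction generalizing c c' with
  | hc m => simp only [adjMul_C_const, smul_comm c c']
  | hadd x y hx hy => simp only [map_add, hx, hy]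
  | hX s x hx =>
    by_cases hi : s = i
    · subst hi
      simp only [adjMul_C_X_self, adjMul_C_X_of_ne h, map_add, hx]
    · by_cases hj : s = j
      · subst hj
        simp only [adjMul_C_X_self, adjMul_C_X_of_ne hi, map_add, hx]
      · simp only [adjMul_C_X_of_ne hi, adjMul_C_X_of_ne hj, hx]

theorem adjMul_C_pow_of_ne {i j : σ} (h : j ≠ i) (c : A) (n : ℕ) (x : LPoly F σ M) :
    adjMul δ i (Polynomial.C c) ((-(MvPolynomial.X j : MvPolynomial σ F)) ^ n • x) =
      (-(MvPolynomial.X j : MvPolynomial σ F)) ^ n • adjMul δ i (Polynomial.C c) x := by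
  induction n generalizing x with
  | zero => simp
  | succ n ih =>
    rw [pow_succ, mul_smul, ih, neg_smul, map_neg, adjMul_C_X_of_ne h, mul_smul, neg_smul]

theorem adjMul_comm_C {i j : σ} (h : i ≠ j) (a : Polynomial A) (c : A) (x : LPoly F σ M) :
    adjMul δ i a (adjMul δ j (Polynomial.C c) x) =
      adjMul δ j (Polynomial.C c) (adjMul δ i a x) := by
  rw [adjMul_eq_sum i a, adjMul_eq_sum i a, Polynomial.sum_def, Polynomial.sum_def, map_sum]
  refine Finset.sum_congr rfl fun n _ => ?_
  rw [← adjMul_C_pow_of_ne h, adjMul_C_comm h]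

theorem adjMul_comm_pow {i j : σ} (h : i ≠ j) (a : Polynomial A) (n : ℕ) (x : LPoly F σ M) :
    adjMul δ i a ((-(MvPolynomial.X j : MvPolynomial σ F)) ^ n • x) =
      (-(MvPolynomial.X j : MvPolynomial σ F)) ^ n • adjMul δ i a x := by
  rw [adjMul_eq_sum i a, adjMul_eq_sum i a, Polynomial.sum_def, Polynomial.sum_def,
    Finset.smul_sum]
  refine Finset.sum_congr rfl fun m _ => ?_
  rw [smul_comm, adjMul_C_pow_of_ne h.symm]

/-- Distinct slots shift distinct variables, and their coefficients commute because `A` is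
commutative. Thus one slot can be corrected without disturbing another. -/
theorem adjMul_comm {i j : σ} (h : i ≠ j) (a b : Polynomial A) (x : LPoly F σ M) :
    adjMul δ i a (adjMul δ j b x) = adjMul δ j b (adjMul δ i a x) := by
  rw [adjMul_eq_sum j b, adjMul_eq_sum j b, Polynomial.sum_def, Polynomial.sum_def, map_sum]
  refine Finset.sum_congr rfl fun n _ => ?_
  rw [adjMul_comm_C h, adjMul_comm_pow h]

/-- `a ↦ a^*`, as a linear map. -/
def adjLin (δ : Derivation F A A) (i : σ) (x : LPoly F σ M) : Polynomial A →ₗ[F] LPoly F σ M :=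
  Polynomial.lsum fun n =>
    { toFun := fun c => adjMul δ i (Polynomial.C c)
        ((-(MvPolynomial.X i : MvPolynomial σ F)) ^ n • x)
      map_add' := fun c c' => adjMul_C_add i c c' _
      map_smul' := fun r c => adjMul_C_smul i r c _ }

theorem adjLin_apply (i : σ) (x : LPoly F σ M) (a : Polynomial A) :
    adjLin δ i x a = adjMul δ i a x := by
  rw [adjMul_eq_sum]
  rfl

end AdjMul

/-! ### Extension from a basis and antisymmetrization -/

section Lift

variable {F : Type uF} [Field F] {A : Type uA} [CommRing A] [Algebra F A]
variable {δ : Derivation F A A}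
variable {E : Type uE} [AddCommGroup E] [Module F E] [Module A E] [IsScalarTower F A E]
variable {M : Type uM} [AddCommGroup M] [Module F M] [Module A M] [IsScalarTower F A M]

namespace DiffModule

variable (X : DiffModule δ E)

/-- `a(∂) ↦ a(∂) v`, as a linear map. -/
def opLin (v : E) : Polynomial A →ₗ[F] E :=
  Polynomial.lsum fun n => (LinearMap.toSpanSingleton A E ((X.D ^ n) v)).restrictScalars F

theorem opLin_apply (v : E) (a : Polynomial A) : X.opLin v a = X.op a v := rfl

theorem op_monomial (n : ℕ) (c : A) (v : E) :
    X.op (Polynomial.monomial n c) v = c • (X.D ^ n) v := by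
  rw [op, Polynomial.sum_monomial_index _ _ (by simp)]

theorem smul_op_monomial (c' : A) (n : ℕ) (c : A) (v : E) :
    c' • X.op (Polynomial.monomial n c) v = X.op (Polynomial.monomial n (c' * c)) v := by
  rw [op_monomial, op_monomial, mul_smul]

theorem D_op_monomial (n : ℕ) (c : A) (v : E) : X.D (X.op (Polynomial.monomial n c) v) =
    X.op (Polynomial.monomial n (δ c)) v + X.op (Polynomial.monomial (n + 1) c) v := by
  rw [op_monomial, op_monomial, op_monomial, X.D_smul, pow_succ', Module.End.mul_apply]

end DiffModule

theorem adjMul_monomial {σ : Type*} [DecidableEq σ] (i : σ) (n : ℕ) (c : A) (x : LPoly F σ M) :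
    adjMul δ i (Polynomial.monomial n c) x =
      adjMul δ i (Polynomial.C c) ((-(MvPolynomial.X i : MvPolynomial σ F)) ^ n • x) := by
  rw [adjMul_eq_sum, Polynomial.sum_monomial_index _ _ (adjMul_C_zero i _)]

/-- A basis of `E` over the differential operators, as a linear equivalence. -/
theorem exists_repr {X : DiffModule δ E} (h : X.IsFree) :
    ∃ (ι : Type uE) (e : ι → E) (r : E ≃ₗ[F] (ι →₀ Polynomial A)),
      ∀ w : ι →₀ Polynomial A, r.symm w = w.sum fun i a => X.op a (e i) := by
  obtain ⟨ι, e, h⟩ := h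
  let f : (ι →₀ Polynomial A) →ₗ[F] E := Finsupp.lsum F fun i => X.opLin (e i)
  have hf : ∀ w, f w = w.sum fun i a => X.op a (e i) := fun w => rfl
  exact ⟨ι, e, (LinearEquiv.ofBijective f (by simpa only [← hf] using h)).symm, hf⟩

section Extend

variable {X : DiffModule δ E} {ι : Type uE} {e : ι → E} {r : E ≃ₗ[F] (ι →₀ Polynomial A)}
variable {σ : Type*} [DecidableEq σ]

/-- The map `∑ a_j(∂) e_j ↦ ∑ (|_{x = ∂} a_j^*(λ_i)) f(e_j)_{λ_i + x}`. -/
def extendLin (δ : Derivation F A A) (e : ι → E) (r : E ≃ₗ[F] (ι →₀ Polynomial A)) (i : σ)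
    (f : E →ₗ[F] LPoly F σ M) : E →ₗ[F] LPoly F σ M :=
  (Finsupp.lsum F fun j => adjLin δ i (f (e j))) ∘ₗ r.toLinearMap

theorem extendLin_apply (i : σ) (f : E →ₗ[F] LPoly F σ M) (v : E) :
    extendLin δ e r i f v = (r v).sum fun j a => adjMul δ i a (f (e j)) := by
  simp only [← adjLin_apply]
  rfl

theorem extendLin_add (i : σ) (f g : E →ₗ[F] LPoly F σ M) (v : E) :
    extendLin δ e r i (f + g) v = extendLin δ e r i f v + extendLin δ e r i g v := by
  simp only [extendLin_apply, LinearMap.add_apply, map_add, Finsupp.sum_add]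

theorem extendLin_smul (i : σ) (c : F) (f : E →ₗ[F] LPoly F σ M) (v : E) :
    extendLin δ e r i (c • f) v = c • extendLin δ e r i f v := by
  simp only [extendLin_apply, LinearMap.smul_apply, map_smul, Finsupp.smul_sum]

theorem extendLin_op_basis (hr : ∀ w : ι →₀ Polynomial A, r.symm w = w.sum fun i a => X.op a (e i))
    (i : σ) (f : E →ₗ[F] LPoly F σ M) (j : ι) (a : Polynomial A) :
    extendLin δ e r i f (X.op a (e j)) = adjMul δ i a (f (e j)) := by
  have h1 : X.op a (e j) = r.symm (Finsupp.single j a) := by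
    rw [hr, Finsupp.sum_single_index]
    exact (X.opLin (e j)).map_zero
  have h2 : adjMul δ i (0 : Polynomial A) (f (e j)) = 0 := by
    rw [← adjLin_apply, map_zero]
  rw [extendLin_apply, h1, LinearEquiv.apply_symm_apply, Finsupp.sum_single_index h2]

theorem span_op_basis (hr : ∀ w : ι →₀ Polynomial A, r.symm w = w.sum fun i a => X.op a (e i))
    {p : E → Prop} (hadd : ∀ v w, p v → p w → p (v + w))
    (h : ∀ j n c, p (X.op (Polynomial.monomial n c) (e j))) (h0 : p 0) (v : E) : p v := by
  rw [← r.symm_apply_apply v, hr, Finsupp.sum]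
  refine Finset.sum_induction _ p hadd h0 fun j _ => ?_
  generalize r v j = a
  induction a using Polynomial.induction_on' with
  | add a b ha hb =>
    rw [← DiffModule.opLin_apply, map_add]
    exact hadd _ _ ha hb
  | monomial n c => exact h j n c

/-- It suffices to test `∂` and `c ∈ A` on the elements `c' ∂ ^ n e_j`. For `∂`, the rule `∂ c' = c'
∂ + δ(c')` matches `adjMul_C_X_self`; for `c`, `adjMul` is multiplicative on constants. -/
theorem extendLin_op (hr : ∀ w : ι →₀ Polynomial A, r.symm w = w.sum fun i a => X.op a (e i))
    (i : σ) (f : E →ₗ[F] LPoly F σ M) (a : Polynomial A) (v : E) :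
    extendLin δ e r i f (X.op a v) = adjMul δ i a (extendLin δ e r i f v) := by
  refine map_op_of_generators (fun v => ?_) (fun c v => ?_) a v
  · refine span_op_basis hr (p := fun v => extendLin δ e r i f (X.D v) =
      -(MvPolynomial.X i : MvPolynomial σ F) • extendLin δ e r i f v) (fun v w hv hw => ?_)
      (fun j n c => ?_) (by simp) v
    · rw [map_add, map_add, hv, hw, map_add, smul_add]
    · rw [X.D_op_monomial, map_add, extendLin_op_basis hr, extendLin_op_basis hr,
        extendLin_op_basis hr, adjMul_monomial, adjMul_monomial, adjMul_monomial, pow_succ',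
        mul_smul, neg_smul, map_neg, adjMul_C_X_self]
      refine Eq.trans ?_ (neg_smul (R := MvPolynomial σ F) (M := LPoly F σ M) _ _).symm
      abel
  · refine span_op_basis hr (p := fun v => extendLin δ e r i f (c • v) =
      adjMul δ i (Polynomial.C c) (extendLin δ e r i f v)) (fun v w hv hw => ?_)
      (fun j n c' => ?_) (by simp) v
    · rw [smul_add, map_add, hv, hw, map_add, map_add]
    · rw [X.smul_op_monomial, extendLin_op_basis hr, extendLin_op_basis hr, adjMul_monomial,
        adjMul_monomial, adjMul_C_mul]

variable {k : ℕ}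

/-- The map `extendLin` in one argument of a multilinear map. -/
def extendSlot (δ : Derivation F A A) (e : ι → E) (r : E ≃ₗ[F] (ι →₀ Polynomial A)) (i : Fin k)
    (ψ : Multi F E k (LPoly F (Fin k) M)) : Multi F E k (LPoly F (Fin k) M) :=
  MultilinearMap.mk' (fun u => extendLin δ e r i (ψ.toLinearMap u i) (u i))
    (by
      intro u j v w
      -- In slot `i` itself the extended map does not depend on `u i`, and linearity is that of
      -- `extendLin`; in any other slot it is inherited from `ψ`.
      by_cases h : j = i
      · subst h
        have (x : E) : ψ.toLinearMap (Function.update u j x) j = ψ.toLinearMap u j := by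
          ext; simp
        simp [this]
      · have : ψ.toLinearMap (Function.update u j (v + w)) i =
            ψ.toLinearMap (Function.update u j v) i + ψ.toLinearMap (Function.update u j w) i := by
          ext
          simp [Function.update_comm h]
        simp [this, extendLin_add, Ne.symm h])
    (by
      intro u j c v
      by_cases h : j = i
      · subst h
        have (x : E) : ψ.toLinearMap (Function.update u j x) j = ψ.toLinearMap u j := by
          ext; simp
        simp [this]
      · have : ψ.toLinearMap (Function.update u j (c • v)) i =
            c • ψ.toLinearMap (Function.update u j v) i := by
          ext
          simp [Function.update_comm h]
        simp [this, extendLin_smul, Ne.symm h])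

theorem extendSlot_apply (i : Fin k) (ψ : Multi F E k (LPoly F (Fin k) M)) (u : Fin k → E) :
    extendSlot δ e r i ψ u = extendLin δ e r i (ψ.toLinearMap u i) (u i) := rfl

theorem isSesquilinear_extendSlot_self
    (hr : ∀ w : ι →₀ Polynomial A, r.symm w = w.sum fun i a => X.op a (e i)) (i : Fin k)
    (ψ : Multi F E k (LPoly F (Fin k) M)) : IsSesquilinear X (extendSlot δ e r i ψ) i := by
  intro u a
  have (x : E) : ψ.toLinearMap (Function.update u i x) i = ψ.toLinearMap u i := by
    ext; simp
  rw [extendSlot_apply, extendSlot_apply, this, Function.update_self, extendLin_op hr]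

/-- The new values are sums of adjoint operators in slot `i` applied to values of `ψ`, and these
commute with the adjoint operators in slot `j`. -/
theorem IsSesquilinear.extendSlot {ψ : Multi F E k (LPoly F (Fin k) M)} {i j : Fin k} (h : i ≠ j)
    (hψ : IsSesquilinear X ψ j) : IsSesquilinear X (extendSlot δ e r i ψ) j := by
  intro u a
  have h1 (x : E) : ψ.toLinearMap (Function.update u j (X.op a (u j))) i x =
      adjMul δ j a (ψ.toLinearMap u i x) := by
    have := hψ (Function.update u i x) a
    simp only [MultilinearMap.toLinearMap_apply]
    rw [Function.update_comm h.symm]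
    simpa [Function.update_of_ne h.symm] using this
  rw [extendSlot_apply, extendSlot_apply, Function.update_of_ne h, extendLin_apply,
    extendLin_apply, Finsupp.sum, Finsupp.sum, map_sum]
  refine Finset.sum_congr rfl fun s _ => ?_
  rw [h1, adjMul_comm h]

/-- On basis vectors nothing has changed, and `φ` already obeys the rule by which the new lift
extends from them, so the reduction is still `φ`. -/
theorem proj_extendSlot {D : DiffModule δ M}
    (hr : ∀ w : ι →₀ Polynomial A, r.symm w = w.sum fun i a => X.op a (e i)) (i : Fin k)
    {ψ : Multi F E k (LPoly F (Fin k) M)} {φ : Multi F E k (QPoly k D.D)}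
    (hψ : (proj k D.D).compMultilinearMap ψ = φ)
    (hφ : ∀ (u : Fin k → E) (a : Polynomial A), φ (Function.update u i (X.op a (u i))) =
      descend (adjMul δ i a) (adjMul_total D i a) (φ u)) :
    (proj k D.D).compMultilinearMap (extendSlot δ e r i ψ) = φ := by
  ext u
  have h1 : ∀ u, proj k D.D (ψ u) = φ u := fun u => congrArg (fun χ => χ u) hψ
  rw [LinearMap.compMultilinearMap_apply, extendSlot_apply, extendLin_apply, Finsupp.sum, map_sum]
  have h2 : ∀ j a, proj k D.D (adjMul δ i a (ψ.toLinearMap u i (e j))) =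
      φ.toLinearMap u i (X.op a (e j)) := by
    intro j a
    have := hφ (Function.update u i (e j)) a
    simp only [MultilinearMap.toLinearMap_apply]
    rw [Function.update_idem, Function.update_self] at this
    rw [this, ← h1, descend_proj]
  simp only [h2]
  rw [← map_sum]
  have h3 := hr (r (u i))
  rw [LinearEquiv.symm_apply_apply, Finsupp.sum] at h3
  rw [← h3]
  simp

/-- The slots are treated one by one: each correction keeps the reduction and the slots already
treated. -/
theorem exists_sesquilinear_lift {D : DiffModule δ M} (hX : X.IsFree)
    (φ : Multi F E k (QPoly k D.D))
    (hφ : ∀ (u : Fin k → E) (i : Fin k) (a : Polynomial A),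
      φ (Function.update u i (X.op a (u i))) =
        descend (adjMul δ i a) (adjMul_total D i a) (φ u)) :
    ∃ ψ : Multi F E k (LPoly F (Fin k) M), (proj k D.D).compMultilinearMap ψ = φ ∧
      ∀ i, IsSesquilinear X ψ i := by
  obtain ⟨ι, e, r, hr⟩ := exists_repr hX
  have h : ∀ S : Finset (Fin k), ∃ ψ : Multi F E k (LPoly F (Fin k) M),
      (proj k D.D).compMultilinearMap ψ = φ ∧ ∀ i ∈ S, IsSesquilinear X ψ i := by
    intro S
    induction S using Finset.induction_on with
    | empty =>
      obtain ⟨ψ, hψ⟩ := exists_lift (proj k D.D) φ fun u => proj_surjective _ _ _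
      exact ⟨ψ, hψ, by simp⟩
    | insert i S hi ih =>
      obtain ⟨ψ, h1, h2⟩ := ih
      refine ⟨extendSlot δ e r i ψ, proj_extendSlot hr i h1 (fun u a => hφ u i a), ?_⟩
      intro j hj
      by_cases hij : i = j
      · subst hij
        exact isSesquilinear_extendSlot_self hr i ψ
      · exact (h2 j (by simpa [Ne.symm hij] using hj)).extendSlot hij
  obtain ⟨ψ, h1, h2⟩ := h Finset.univ
  exact ⟨ψ, h1, fun i => h2 i (Finset.mem_univ i)⟩

end Extend

/-- The antisymmetrization of a multilinear map, up to the factor `k!`. -/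
def antisymmetrize {k : ℕ} (ψ : Multi F E k (LPoly F (Fin k) M)) :
    Multi F E k (LPoly F (Fin k) M) :=
  ∑ π : Equiv.Perm (Fin k), (Equiv.Perm.sign π : ℤ) •
    (perm π).compMultilinearMap (ψ.domDomCongr π)

theorem antisymmetrize_apply {k : ℕ} (ψ : Multi F E k (LPoly F (Fin k) M)) (u : Fin k → E) :
    antisymmetrize ψ u = ∑ π : Equiv.Perm (Fin k), (Equiv.Perm.sign π : ℤ) • perm π (ψ (u ∘ π)) := by
  simp only [antisymmetrize, sum_apply]
  rfl

theorem antisymmetrize_skew [Infinite F] {k : ℕ} (ψ : Multi F E k (LPoly F (Fin k) M))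
    (τ : Equiv.Perm (Fin k)) (u : Fin k → E) :
    antisymmetrize ψ u = (Equiv.Perm.sign τ : ℤ) • perm τ (antisymmetrize ψ (u ∘ τ)) := by
  have hp : ∀ (π : Equiv.Perm (Fin k)) (f : LPoly F (Fin k) M),
      perm τ (perm π f) = perm (τ * π) f := by
    intro π f
    refine ev_ext fun t => ?_
    simp only [ev_perm]
    rfl
  rw [antisymmetrize_apply, antisymmetrize_apply, map_sum, Finset.smul_sum]
  rw [← Equiv.sum_comp (Equiv.mulLeft τ)]
  refine Finset.sum_congr rfl fun π _ => ?_
  rw [map_zsmul, hp, smul_smul, Equiv.coe_mulLeft, Equiv.Perm.sign_mul, Units.val_mul]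
  rfl

theorem IsSesquilinear.antisymmetrize [Infinite F] {X : DiffModule δ E} {k : ℕ}
    {ψ : Multi F E k (LPoly F (Fin k) M)} (h : ∀ i, IsSesquilinear X ψ i) (i : Fin k) :
    IsSesquilinear X (antisymmetrize ψ) i := by
  intro u a
  rw [antisymmetrize_apply, antisymmetrize_apply, map_sum]
  refine Finset.sum_congr rfl fun π _ => ?_
  have h1 : Function.update u i (X.op a (u i)) ∘ π =
      Function.update (u ∘ π) (π.symm i) (X.op a ((u ∘ π) (π.symm i))) := by
    ext s
    by_cases hs : s = π.symm i
    · subst hs; simp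
    · have : π s ≠ i := fun e => hs (by rw [← e]; simp)
      simp [hs, this]
  rw [h1, h, perm_adjMul, Equiv.apply_symm_apply, map_zsmul]

/-- Since `φ` is skew, each of the `k!` signed permutations of a lift reduces to `φ`; characteristic
`0` allows division by `k!`. -/
theorem exists_basic_lift [CharZero F] {L : LieConformalAlgebroid δ E}
    (hE : L.toDiffModule.IsFree) (R : L.Rep M) (k : ℕ) :
    ∀ φ ∈ R.cochains k, ∃ ψ ∈ R.basicCochains k, R.pStar k ψ = φ := by
  rintro φ ⟨h1, h2⟩
  obtain ⟨ψ, e, hψ⟩ := exists_sesquilinear_lift (D := R.toDiffModule) hE φ h1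
  have hk : (k.factorial : F) ≠ 0 := Nat.cast_ne_zero.2 k.factorial_ne_zero
  have hs : antisymmetrize ψ ∈ R.basicCochains k :=
    (mem_cochains_iff R).2 ⟨IsSesquilinear.antisymmetrize hψ, antisymmetrize_skew ψ⟩
  refine ⟨(k.factorial : F)⁻¹ • antisymmetrize ψ, Submodule.smul_mem _ _ hs, ?_⟩
  rw [map_smul]
  have : R.pStar k (antisymmetrize ψ) = (k.factorial : F) • φ := by
    ext u
    change proj k R.D (antisymmetrize ψ u) = _
    have h3 : ∀ π : Equiv.Perm (Fin k),
        proj k R.D ((Equiv.Perm.sign π : ℤ) • perm π (ψ (u ∘ π))) = φ u := by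
      intro π
      rw [h2 π u, map_zsmul, ← descend_proj (perm π) (perm_total R.D π)]
      congr 2
      exact congrArg (fun χ => χ (u ∘ π)) e
    rw [antisymmetrize_apply, map_sum, Finset.sum_congr rfl fun π _ => h3 π]
    simp [Fintype.card_perm, Nat.cast_smul_eq_nsmul]
  rw [this, smul_smul, inv_mul_cancel₀ hk, one_smul]

end Lift

/-! ### The long exact sequence of an injective operator with quotient -/

section LongExact

variable {F : Type*} [Field F] {V : ℕ → Type*} [∀ k, AddCommGroup (V k)] [∀ k, Module F (V k)]
variable {W : ℕ → Type*} [∀ k, AddCommGroup (W k)] [∀ k, Module F (W k)]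
variable {d : ∀ k, V k →ₗ[F] V (k + 1)} {C : ∀ k, Submodule F (V k)}
variable {d' : ∀ k, W k →ₗ[F] W (k + 1)} {C' : ∀ k, Submodule F (W k)}

theorem cls_surjective (k : ℕ) : Function.Surjective (cls d C k) := Submodule.mkQ_surjective _

theorem cls_eq_zero_iff {k : ℕ} {x : cocycles d C k} :
    cls d C k x = 0 ↔ (x : V k) ∈ coboundaries d C k := by
  rw [cls, Submodule.mkQ_apply, Submodule.Quotient.mk_eq_zero]
  rfl

theorem cls_eq_iff {k : ℕ} {x y : cocycles d C k} :
    cls d C k x = cls d C k y ↔ (x : V k) - y ∈ coboundaries d C k := by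
  rw [← sub_eq_zero, ← map_sub, cls_eq_zero_iff]
  rfl

theorem map_mem_cocycles {f : ∀ k, V k →ₗ[F] W k} (hC : ∀ k, ∀ φ ∈ C k, f k φ ∈ C' k)
    (hd : ∀ k φ, d' k (f k φ) = f (k + 1) (d k φ)) {k : ℕ} {φ : V k} (hφ : φ ∈ cocycles d C k) :
    f k φ ∈ cocycles d' C' k :=
  ⟨hC k φ hφ.1, by
    have h : d k φ = 0 := hφ.2
    simp [hd, h]⟩

theorem cohMap_cls {f : ∀ k, V k →ₗ[F] W k} (hC : ∀ k, ∀ φ ∈ C k, f k φ ∈ C' k)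
    (hd : ∀ k φ, d' k (f k φ) = f (k + 1) (d k φ)) {k : ℕ} (x : cocycles d C k) :
    cohMap f hC hd k (cls d C k x) = cls d' C' k ⟨f k x, map_mem_cocycles hC hd x.2⟩ := rfl

variable (d C d' C') in
/-- An operator `P` on the complex `C`, injective in positive degrees, and a surjective map `p` of
complexes `C → C'` with kernel `P C`. -/
structure IsQuotientBy (P : ∀ k, V k →ₗ[F] V k) (p : ∀ k, V k →ₗ[F] W k) : Prop where
  isComplex : IsComplex d C
  mem : ∀ k, ∀ φ ∈ C k, P k φ ∈ C k
  comm : ∀ k φ, d k (P k φ) = P (k + 1) (d k φ)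
  mem' : ∀ k, ∀ φ ∈ C k, p k φ ∈ C' k
  comm' : ∀ k φ, d' k (p k φ) = p (k + 1) (d k φ)
  comp : ∀ k φ, p k (P k φ) = 0
  exact : ∀ k, ∀ φ ∈ C k, p k φ = 0 → ∃ ψ ∈ C k, P k ψ = φ
  surj : ∀ k, ∀ x ∈ C' k, ∃ φ ∈ C k, p k φ = x
  inj : ∀ k, Function.Injective (P (k + 1))

variable {P : ∀ k, V k →ₗ[F] V k} {p : ∀ k, V k →ₗ[F] W k}

namespace IsQuotientBy

/-- In degree `k + 1` only the injectivity of `P` in degrees `k + 1` and `k + 2` matters, so its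
possible kernel in degree `0` is harmless. -/
theorem bijective_cohMap (h : IsQuotientBy d C d' C' P p) (k : ℕ) :
    Function.Bijective (cohMap (d := d) (C := C) (d' := d) (C' := fun k => (C k).map (P k)) P
      (fun _ _ hφ => Submodule.mem_map_of_mem hφ) h.comm (k + 1)) := by
  constructor
  · rw [injective_iff_map_eq_zero]
    intro x hx
    obtain ⟨⟨φ, hφ⟩, rfl⟩ := cls_surjective _ x
    rw [cohMap_cls, cls_eq_zero_iff] at hx
    obtain ⟨_, ⟨ψ, hψ, rfl⟩, e⟩ := hx
    rw [cls_eq_zero_iff]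
    refine ⟨ψ, hψ, h.inj k ?_⟩
    rw [← h.comm]
    exact e
  · intro z
    obtain ⟨⟨_, ⟨φ, hφ, rfl⟩, hz⟩, rfl⟩ := cls_surjective _ z
    refine ⟨cls d C (k + 1) ⟨φ, hφ, h.inj (k + 1) ?_⟩, rfl⟩
    rw [← h.comm, map_zero]
    exact hz

theorem isComplex_map (h : IsQuotientBy d C d' C' P p) :
    IsComplex d fun k => (C k).map (P k) := by
  rintro k _ ⟨φ, hφ, rfl⟩
  obtain ⟨h1, h2⟩ := h.isComplex k φ hφ
  exact ⟨⟨d k φ, h1, (h.comm k φ).symm⟩, by rw [h.comm, h.comm, h2, map_zero]⟩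

theorem isComplex_quotient (h : IsQuotientBy d C d' C' P p) : IsComplex d' C' := by
  intro k x hx
  obtain ⟨φ, hφ, rfl⟩ := h.surj k x hx
  obtain ⟨h1, h2⟩ := h.isComplex k φ hφ
  exact ⟨by rw [h.comm']; exact h.mem' _ _ h1, by rw [h.comm', h.comm', h2, map_zero]⟩

/-- Subtracting a lifted primitive from `φ` leaves an element of `ker p = P C`. This serves both the
well-definedness of the connecting map and exactness at the term before it. -/
theorem exists_of_coboundary (h : IsQuotientBy d C d' C' P p) {k : ℕ} {φ : V k} (hφ : φ ∈ C k)
    (hc : p k φ ∈ coboundaries d' C' k) :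
    ∃ ψ ∈ C k, φ - P k ψ ∈ coboundaries d C k ∧ d k φ = P (k + 1) (d k ψ) := by
  cases k with
  | zero =>
    obtain ⟨ψ, hψ, rfl⟩ := h.exact 0 φ hφ hc
    exact ⟨ψ, hψ, by simp, h.comm 0 ψ⟩
  | succ k =>
    obtain ⟨x, hx, e⟩ := hc
    obtain ⟨χ, hχ, rfl⟩ := h.surj k x hx
    obtain ⟨h1, h2⟩ := h.isComplex k χ hχ
    obtain ⟨ψ, hψ, e'⟩ := h.exact (k + 1) (φ - d k χ) (sub_mem hφ h1) (by
      rw [map_sub, ← h.comm', e, sub_self])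
    refine ⟨ψ, hψ, ⟨χ, hχ, by rw [e']; abel⟩, ?_⟩
    rw [← h.comm, e', map_sub, h2, sub_zero]

/-- The pairs `(φ, y)` of cochains with `dφ = P y`. -/
def connPairs (d : ∀ k, V k →ₗ[F] V (k + 1)) (C : ∀ k, Submodule F (V k))
    (P : ∀ k, V k →ₗ[F] V k) (k : ℕ) : Submodule F (V k × V (k + 1)) :=
  (C k).prod (C (k + 1)) ⊓
    LinearMap.ker (d k ∘ₗ LinearMap.fst F _ _ - P (k + 1) ∘ₗ LinearMap.snd F _ _)

theorem mem_connPairs {k : ℕ} {z : V k × V (k + 1)} :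
    z ∈ connPairs d C P k ↔ (z.1 ∈ C k ∧ z.2 ∈ C (k + 1)) ∧ d k z.1 = P (k + 1) z.2 := by
  rw [connPairs, Submodule.mem_inf, Submodule.mem_prod, LinearMap.mem_ker, LinearMap.sub_apply,
    sub_eq_zero]
  rfl

theorem fst_cocycle (h : IsQuotientBy d C d' C' P p) {k : ℕ} (z : connPairs d C P k) :
    p k z.1.1 ∈ cocycles d' C' k := by
  obtain ⟨⟨h1, h2⟩, h3⟩ := mem_connPairs.1 z.2
  exact ⟨h.mem' _ _ h1, by
    change d' k (p k z.1.1) = 0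
    rw [h.comm', h3, h.comp]⟩

/-- From `d φ = P y` follows `P d y = d d φ = 0`, and `P` is injective in positive degree. -/
theorem snd_cocycle (h : IsQuotientBy d C d' C' P p) {k : ℕ} (z : connPairs d C P k) :
    z.1.2 ∈ cocycles d C (k + 1) := by
  obtain ⟨⟨h1, h2⟩, h3⟩ := mem_connPairs.1 z.2
  refine ⟨h2, h.inj (k + 1) ?_⟩
  rw [← h.comm, ← h3, (h.isComplex k _ h1).2, map_zero]

/-- The map `(φ, y) ↦ [p φ]`. -/
def fstClass (h : IsQuotientBy d C d' C' P p) (k : ℕ) :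
    connPairs d C P k →ₗ[F] Cohomology d' C' k :=
  cls d' C' k ∘ₗ LinearMap.codRestrict _
    (p k ∘ₗ LinearMap.fst F _ _ ∘ₗ (connPairs d C P k).subtype) fun z => h.fst_cocycle z

/-- The map `(φ, y) ↦ [y]`. -/
def sndClass (h : IsQuotientBy d C d' C' P p) (k : ℕ) :
    connPairs d C P k →ₗ[F] Cohomology d C (k + 1) :=
  cls d C (k + 1) ∘ₗ LinearMap.codRestrict _
    (LinearMap.snd F _ _ ∘ₗ (connPairs d C P k).subtype) fun z => h.snd_cocycle z

theorem exists_connPair (h : IsQuotientBy d C d' C' P p) {k : ℕ} (x : cocycles d' C' k) :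
    ∃ z : connPairs d C P k, p k z.1.1 = x := by
  obtain ⟨φ, hφ, e⟩ := h.surj k x x.2.1
  obtain ⟨y, hy, e'⟩ := h.exact (k + 1) (d k φ) (h.isComplex k φ hφ).1 (by
    rw [← h.comm', e]; exact x.2.2)
  exact ⟨⟨(φ, y), mem_connPairs.2 ⟨⟨hφ, hy⟩, e'.symm⟩⟩, e⟩

theorem fstClass_surjective (h : IsQuotientBy d C d' C' P p) (k : ℕ) :
    Function.Surjective (h.fstClass k) := by
  intro x
  obtain ⟨x, rfl⟩ := cls_surjective _ x
  obtain ⟨z, e⟩ := h.exists_connPair x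
  exact ⟨z, congrArg (cls d' C' k) (Subtype.ext e)⟩

/-- The independence of the connecting map from all choices: if `p φ` is a coboundary, then `P y = d
φ = P d ψ` for some `ψ`, and cancelling `P` makes `y` a coboundary. -/
theorem ker_fstClass_le (h : IsQuotientBy d C d' C' P p) (k : ℕ) :
    LinearMap.ker (h.fstClass k) ≤ LinearMap.ker (h.sndClass k) := by
  intro z hz
  obtain ⟨⟨h1, h2⟩, h3⟩ := mem_connPairs.1 z.2
  obtain ⟨ψ, hψ, -, e⟩ := h.exists_of_coboundary h1 (cls_eq_zero_iff.1 hz)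
  refine cls_eq_zero_iff.2 ⟨ψ, hψ, h.inj k ?_⟩
  rw [← e, h3]
  rfl

/-- The connecting map. -/
def conn (h : IsQuotientBy d C d' C' P p) (k : ℕ) :
    Cohomology d' C' k →ₗ[F] Cohomology d C (k + 1) :=
  (LinearMap.ker (h.fstClass k)).liftQ (h.sndClass k) (h.ker_fstClass_le k) ∘ₗ
    ((h.fstClass k).quotKerEquivOfSurjective (h.fstClass_surjective k)).symm.toLinearMap

theorem conn_fstClass (h : IsQuotientBy d C d' C' P p) {k : ℕ} (z : connPairs d C P k) :
    h.conn k (h.fstClass k z) = h.sndClass k z := by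
  have e : ((h.fstClass k).quotKerEquivOfSurjective (h.fstClass_surjective k)).symm
      (h.fstClass k z) = Submodule.Quotient.mk z := by
    rw [LinearEquiv.symm_apply_eq]
    rfl
  rw [conn, LinearMap.comp_apply, LinearEquiv.coe_coe, e]
  rfl

theorem conn_cls (h : IsQuotientBy d C d' C' P p) {k : ℕ} {φ : V k} (hφ : φ ∈ C k)
    (x : cocycles d' C' k) (y : cocycles d C (k + 1)) (hx : p k φ = x)
    (hy : d k φ = P (k + 1) y) : h.conn k (cls d' C' k x) = cls d C (k + 1) y := by
  have e := h.conn_fstClass ⟨(φ, (y : V (k + 1))), mem_connPairs.2 ⟨⟨hφ, y.2.1⟩, hy⟩⟩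
  have ex : x = ⟨p k φ, hx ▸ x.2⟩ := Subtype.ext hx.symm
  rw [ex]
  exact e

theorem exact_left (h : IsQuotientBy d C d' C' P p) (k : ℕ) :
    Function.Exact (cohMap P h.mem h.comm k : Cohomology d C k →ₗ[F] _)
      (cohMap p h.mem' h.comm' k) := by
  intro x
  obtain ⟨x, rfl⟩ := cls_surjective _ x
  constructor
  · intro hx
    rw [cohMap_cls, cls_eq_zero_iff] at hx
    obtain ⟨ψ, hψ, h1, h2⟩ := h.exists_of_coboundary x.2.1 hx
    -- That `ψ` is a cocycle follows from `P d ψ = d φ = 0`; here `P` acts in degree `k + 1`, so `k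
    -- = 0` is included.
    refine ⟨cls d C k ⟨ψ, hψ, h.inj k ?_⟩, ?_⟩
    · rw [← h2, map_zero]
      exact x.2.2
    · rw [cohMap_cls, cls_eq_iff, ← neg_sub]
      exact neg_mem h1
  · rintro ⟨y, e⟩
    obtain ⟨y, rfl⟩ := cls_surjective _ y
    rw [← e, cohMap_cls, cohMap_cls, cls_eq_zero_iff]
    simp [h.comp]

theorem exact_middle (h : IsQuotientBy d C d' C' P p) (k : ℕ) :
    Function.Exact (cohMap p h.mem' h.comm' k : Cohomology d C k →ₗ[F] _) (h.conn k) := by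
  intro x
  constructor
  · intro hx
    obtain ⟨x, rfl⟩ := cls_surjective _ x
    obtain ⟨z, e⟩ := h.exists_connPair x
    obtain ⟨⟨h1, h2⟩, h3⟩ := mem_connPairs.1 z.2
    rw [h.conn_cls h1 x ⟨z.1.2, h.snd_cocycle z⟩ e h3, cls_eq_zero_iff] at hx
    obtain ⟨ψ, hψ, e'⟩ := hx
    -- With `y = d ψ`, the correction by `P ψ` turns the lift into a cocycle, and `p` does not see
    -- it.
    refine ⟨cls d C k ⟨z.1.1 - P k ψ, sub_mem h1 (h.mem _ _ hψ), ?_⟩, ?_⟩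
    · change d k (z.1.1 - P k ψ) = 0
      rw [map_sub, h3, h.comm, e', sub_self]
    · rw [cohMap_cls]
      refine congrArg (cls d' C' k) (Subtype.ext ?_)
      change p k (z.1.1 - P k ψ) = x
      rw [map_sub, h.comp, sub_zero, e]
  · rintro ⟨y, rfl⟩
    obtain ⟨y, rfl⟩ := cls_surjective _ y
    rw [cohMap_cls, h.conn_cls y.2.1 _ 0 rfl, map_zero]
    have e : d k y = 0 := y.2.2
    rw [e]
    simp

theorem exact_right (h : IsQuotientBy d C d' C' P p) (k : ℕ) :
    Function.Exact (h.conn k)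
      (cohMap P h.mem h.comm (k + 1) : Cohomology d C (k + 1) →ₗ[F] _) := by
  intro y
  constructor
  · intro hy
    obtain ⟨y, rfl⟩ := cls_surjective _ y
    rw [cohMap_cls, cls_eq_zero_iff] at hy
    obtain ⟨φ, hφ, e⟩ := hy
    have hz : (φ, (y : V (k + 1))) ∈ connPairs d C P k := mem_connPairs.2 ⟨⟨hφ, y.2.1⟩, e⟩
    exact ⟨h.fstClass k ⟨_, hz⟩, h.conn_fstClass ⟨_, hz⟩⟩
  · rintro ⟨x, rfl⟩
    obtain ⟨z, rfl⟩ := h.fstClass_surjective k x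
    obtain ⟨⟨h1, h2⟩, h3⟩ := mem_connPairs.1 z.2
    rw [h.conn_fstClass]
    exact cls_eq_zero_iff.2 ⟨z.1.1, h1, h3⟩

end IsQuotientBy

end LongExact

/-! ### Application to free algebroids -/

section Main

variable {F : Type uF} [Field F] {A : Type uA} [CommRing A] [Algebra F A]
variable {δ : Derivation F A A}
variable {E : Type uE} [AddCommGroup E] [Module F E] [Module A E] [IsScalarTower F A E]
variable {M : Type uM} [AddCommGroup M] [Module F M] [Module A M] [IsScalarTower F A M]

/-- The complex of a free algebroid is the quotient of the basic complex by the image of `∂`. -/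
theorem isQuotientBy_partialMap [CharZero F] {L : LieConformalAlgebroid δ E}
    (hE : L.toDiffModule.IsFree) (R : L.Rep M) :
    IsQuotientBy R.basicDiff R.basicCochains R.diff R.cochains R.partialMap R.pStar where
  isComplex := isComplex_basic R
  mem := R.partialMap_mem
  comm := R.basicDiff_partialMap
  mem' := R.pStar_mem
  comm' := R.diff_pStar
  comp := pStar_partialMap R
  exact k _ h h0 := exists_partialMap_eq R k h h0
  surj := exists_basic_lift hE R
  inj := partialMap_injective R

end Main

end LCAd

end

theorem mainTheorem5
    {F : Type*} [Field F] [CharZero F]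
    {A : Type*} [CommRing A] [Algebra F A] (δ : Derivation F A A)
    {E : Type*} [AddCommGroup E] [Module F E] [Module A E] [IsScalarTower F A E]
    (L : LCAd.LieConformalAlgebroid δ E) (hE : L.toDiffModule.IsFree)
    {M : Type*} [AddCommGroup M] [Module F M] [Module A M] [IsScalarTower F A M]
    (R : L.Rep M) :
    -- the basic complex, its subcomplex, and the complex of the algebroid are complexes
    (LCAd.IsComplex R.basicDiff R.basicCochains ∧
      LCAd.IsComplex R.basicDiff R.partialCochains ∧
      LCAd.IsComplex R.diff R.cochains) ∧
    -- the short exact sequence of complexes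
    (∀ k, R.partialCochains k = R.basicCochains k ⊓ LinearMap.ker (R.pStar k) ∧
      (R.basicCochains k).map (R.pStar k) = R.cochains k) ∧
    -- the cohomology of the subcomplex in positive degrees
    (∀ k, 1 ≤ k → Function.Bijective (R.ontoPartialH k)) ∧
    -- the long exact sequence, with its connecting maps
    (∃ conn : ∀ k, R.H k →ₗ[F] R.BasicH (k + 1),
      (∀ (k : ℕ) (φ : R.basicCochains k) (x : LCAd.cocycles R.diff R.cochains k)
        (y : LCAd.cocycles R.basicDiff R.basicCochains (k + 1)),
        R.pStar k φ = x → R.basicDiff k φ = R.partialMap (k + 1) y →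
          conn k (LCAd.cls R.diff R.cochains k x) =
            LCAd.cls R.basicDiff R.basicCochains (k + 1) y) ∧
      ∀ k, Function.Exact (R.partialH k) (R.pStarH k) ∧
        Function.Exact (R.pStarH k) (conn k) ∧
        Function.Exact (conn k) (R.partialH (k + 1))) ∧
    -- vanishing
    (∀ d : ℕ, (∀ k, d ≤ k → Subsingleton (R.BasicH k)) →
      ∀ k, d ≤ k → Subsingleton (R.H k)) := by
  have h := LCAd.isQuotientBy_partialMap hE R
  refine ⟨⟨h.isComplex, h.isComplex_map, h.isComplex_quotient⟩, fun k => ⟨?_, ?_⟩, ?_,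
    ⟨h.conn, fun k φ x y hx hy => h.conn_cls φ.2 x y hx hy,
      fun k => ⟨h.exact_left k, h.exact_middle k, h.exact_right k⟩⟩, ?_⟩
  · ext φ
    constructor
    · rintro ⟨ψ, hψ, rfl⟩
      exact ⟨h.mem k ψ hψ, h.comp k ψ⟩
    · rintro ⟨h1, h2⟩
      exact h.exact k φ h1 h2
  · ext φ
    constructor
    · rintro ⟨ψ, hψ, rfl⟩
      exact h.mem' k ψ hψ
    · exact h.surj k φ
  · rintro (_ | k) hk
    · omega
    · exact h.bijective_cohMap k
  · intro d hd k hk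
    have h1 := hd k hk
    have h2 := hd (k + 1) (by omega)
    refine subsingleton_of_forall_eq 0 fun x => ?_
    -- The group `H^k` lies between `H̃^k` and `H̃^{k+1}`: vanishing of the latter lifts `x` to
    -- `H̃^k`, which is zero as well.
    obtain ⟨y, rfl⟩ := (h.exact_middle k x).1 (Subsingleton.elim _ _)
    rw [Subsingleton.elim y 0, map_zero]
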